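/- **Conventions.** $\log$ is the logarithm to base $2$ (with the convention $\log 0:=0$), $\mathbb N=\{1,2,\dots\}$, and suprema of subsets of $[0,\infty]$ are taken in $[0,\infty]$ (with $\sup\emptyset=0$). *Networks.* A ReLU network $\Phi\in\mathcal N_{d,d'}$ is a map $\Phi=W_L\circ\rho\circ W_{L-1}\circ\dots\circ\rho\circ W_1:\mathbb R^d\to\mathbb R^{d'}$, given together with its affine maps $W_\ell(x)=A_\ell x+b_\ell$, where $\rho=\max(\cdot,0)$ acts component-wise; every node of the input layer and of the hidden layers has an outgoing edge and every output node has an incoming edge (edges are the non-zero entries of the $A_\ell$). The connectivity $\mathcal M(\Phi)$ is the number of non-zero entries of all $A_\ell,b_\ell$; the depth is $\mathcal L(\Phi)=L$; the weight magnitude $\mathcal B(\Phi)$ is the largest absolute value of an entry of the $A_\ell,b_\ell$. Networks with complex output are $\mathcal N^{\mathbb C}_{d,1}:=\mathcal N_{d,2}$, the two components being real and imaginary part. *Rates.* A function class is a compact set $\mathcal C\subset L^2(\Omega)$ (real- or complex-valued functions). For a dictionary $\mathcal D=(\varphi_i)_{i\in\mathbb N}$ in $L^2(\Omega,\mathbb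 C)$, $\gamma^{*,\mathrm{eff}}(\mathcal C,\mathcal D)$ is the supremum of all $\gamma\ge0$ for which there is a polynomial $\pi$ with $$\sup_{f\in\mathcal C}\ \inf_{\substack{I\subset\{1,\dots,\pi(M)\},\ |I|=M,\\ c_i\in\mathbb C,\ |c_i|\le\pi(M)}}\Big\|f-\sum_{i\in I}c_i\varphi_i\Big\|_{L^2(\Omega)}\in\mathcal O(M^{-\gamma}),\quad M\to\infty .$$ $\gamma^{*,\mathrm{eff}}_{\mathcal N}(\mathcal C)$ is the supremum of all $\gamma\ge0$ for which there is a polynomial $\pi$ with $\sup_{f\in\mathcal C}\inf_\Phi\|f-\Phi\|_{L^2(\Omega)}\in\mathcal O(M^{-\gamma})$, $M\to\infty$, the infimum being over networks $\Phi$ with $\mathcal M(\Phi)\le M$, $\mathcal L(\Phi)\le\pi(\log M)$, $\mathcal B(\Phi)\le\pi(M)$; here $\Phi\in\mathcal N_{d,1}$ if $\mathcal C$ consists of real-valued functions, and $\Phi\in\mathcal N^{\mathbb C}_{d,1}$ if $\mathcal C\subset L^2(\Omega,\mathbb C)$. Let $L(\varepsilon,\mathcal C)$ be the smallest $\ell\in\mathbb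 N$ for which there are maps $E:\mathcal C\to\{0,1\}^\ell$ and $D:\{0,1\}^\ell\to L^2(\Omega)$ with $\sup_{f\in\mathcal C}\|D(E(f))-f\|_{L^2(\Omega)}\le\varepsilon$, and let $\gamma^*(\mathcal C)$ be the supremum of all $\gamma>0$ with $L(\varepsilon,\mathcal C)\in\mathcal O(\varepsilon^{-1/\gamma})$, $\varepsilon\to0$. The class $\mathcal C$ is *optimally representable by $\mathcal D$* if $\gamma^{*,\mathrm{eff}}(\mathcal C,\mathcal D)=\gamma^*(\mathcal C)$ and, for bounded $\Omega$, *optimally representable by neural networks* if $\gamma^{*,\mathrm{eff}}_{\mathcal N}(\mathcal C)=\gamma^*(\mathcal C)$. *Gabor systems.* For $g:\mathbb R^d\to\mathbb R$ and $\alpha,\beta>0$ let $\mathcal G(g,\alpha,\beta,\Omega)=\{M_\xi T_xg|_\Omega:(x,\xi)\in\alpha\mathbb Z^d\times\beta\mathbb Z^d\}\subset L^2(\Omega,\mathbb C)$, where $M_\xi T_xg(t)=e^{2\pi i\langle\xi,t\rangle}g(t-x)$. It is arranged as a sequence $(\varphi_i)_{i\in\mathbb N}=(\mathcal G_0,\mathcal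 G_1,\mathcal G_2,\dots)$, where $\mathcal G_n$ consists of the elements $M_\xi T_xg|_\Omega$ with $\|x\|_\infty\le n\alpha$, $\|\xi\|_\infty\le n\beta$ that lie in none of $\mathcal G_0,\dots,\mathcal G_{n-1}$; the order within each $\mathcal G_n$ is arbitrary, and elements are listed without repetition (repetitions are allowed if the system is a finite set). **Theorem.** Let $d\in\mathbb N$, let $\Omega\subseteq\mathbb R^d$ be measurable, $\alpha,\beta>0$, and let $g\in L^2(\mathbb R^d)\cap L^\infty(\mathbb R^d)$ be real-valued. Assume that $\Omega$ is bounded, or that $\Omega=\mathbb R^d$ and $g$ is compactly supported. Suppose that there is a bivariate polynomial $\pi$ such that for every $x\in\mathbb R^d$ and $\varepsilon\in(0,1/2)$ there is a network $\Phi_{x,\varepsilon}\in\mathcal N_{d,1}$ with $$\|g-\Phi_{x,\varepsilon}\|_{L^\infty(x+\Omega)}\le\varepsilon,\quad \mathcal M(\Phi_{x,\varepsilon})\le\pi(\log(\varepsilon^{-1}),\log\|x\|_\infty),\quad \mathcal B(\Phi_{x,\varepsilon})\le\pi(\varepsilon^{-1},\|x\|_\infty).$$ Let $\mathcal G=(\varphi_i)_{i\in\mathbb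 N}$ be the Gabor system $\mathcal G(g,\alpha,\beta,\Omega)$, arranged as above. Then: 1. $\mathcal G$ is effectively representable by neural networks: there is a bivariate polynomial $\pi'$ such that for all $i\in\mathbb N$, $\varepsilon\in(0,1/2)$ there is $\Phi_{i,\varepsilon}\in\mathcal N^{\mathbb C}_{d,1}$ with $\mathcal M(\Phi_{i,\varepsilon})\le\pi'(\log(\varepsilon^{-1}),\log i)$, $\mathcal B(\Phi_{i,\varepsilon})\le\pi'(\varepsilon^{-1},i)$ and $\|\varphi_i-\Phi_{i,\varepsilon}\|_{L^2(\Omega,\mathbb C)}\le\varepsilon$. 2. For all function classes $\mathcal C\subset L^2(\Omega)$ (of real-valued or of complex-valued functions), $\gamma^{*,\mathrm{eff}}_{\mathcal N}(\mathcal C)\ge\gamma^{*,\mathrm{eff}}(\mathcal C,\mathcal G)$. 3. If $\Omega$ is bounded and $\mathcal C$ is optimally representable by $\mathcal G$, then $\mathcal C$ is optimally representable by neural networks. -/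

import Mathlib

open MeasureTheory Set Filter Topology
open scoped ENNReal NNReal

/-! ### ReLU networks -/

/-- A ReLU network from `ℝ^m` to `ℝ^n`, given by its affine maps `x ↦ A x + b`: either a single
affine map, or an affine map followed by the ReLU function and by a further network. -/
inductive ReLUNet : ℕ → ℕ → Type
  | output {m n : ℕ} (A : Matrix (Fin n) (Fin m) ℝ) (b : Fin n → ℝ) : ReLUNet m n
  | hidden {m k n : ℕ} (A : Matrix (Fin k) (Fin m) ℝ) (b : Fin k → ℝ) (Φ : ReLUNet k n) :
      ReLUNet m n

namespace ReLUNet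

/-- The function realized by the network; the ReLU function acts component-wise. -/
noncomputable def realize : {m n : ℕ} → ReLUNet m n → (Fin m → ℝ) → (Fin n → ℝ)
  | _, _, output A b, x => A.mulVec x + b
  | _, _, hidden A b Φ, x => Φ.realize (fun i => max ((A.mulVec x + b) i) 0)

/-- Number of non-zero entries of a matrix and a vector. -/
noncomputable def nnz {m n : ℕ} (A : Matrix (Fin n) (Fin m) ℝ) (b : Fin n → ℝ) : ℕ :=
  (Finset.univ.filter (fun p : Fin n × Fin m => A p.1 p.2 ≠ 0)).card
    + (Finset.univ.filter (fun i : Fin n => b i ≠ 0)).card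

/-- Largest absolute value of an entry of a matrix and a vector. -/
noncomputable def maxAbs {m n : ℕ} (A : Matrix (Fin n) (Fin m) ℝ) (b : Fin n → ℝ) : ℝ≥0 :=
  (Finset.univ.sup fun p : Fin n × Fin m => ‖A p.1 p.2‖₊) ⊔ (Finset.univ.sup fun i => ‖b i‖₊)

/-- The connectivity: total number of non-zero weights. -/
noncomputable def connectivity : {m n : ℕ} → ReLUNet m n → ℕ
  | _, _, output A b => nnz A b
  | _, _, hidden A b Φ => nnz A b + Φ.connectivity

/-- The depth: number of affine maps. -/
def depth : {m n : ℕ} → ReLUNet m n → ℕ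
  | _, _, output _ _ => 1
  | _, _, hidden _ _ Φ => 1 + Φ.depth

/-- The weight magnitude: largest absolute value of a weight. -/
noncomputable def weightMagnitude : {m n : ℕ} → ReLUNet m n → ℝ≥0
  | _, _, output A b => maxAbs A b
  | _, _, hidden A b Φ => maxAbs A b ⊔ Φ.weightMagnitude

/-- Every node of the input layer and of the hidden layers has an outgoing edge, and every node
of the output layer has an incoming edge (an edge is a non-zero matrix entry). -/
def Nondegenerate : {m n : ℕ} → ReLUNet m n → Prop
  | _, _, output A _ => (∀ j, ∃ i, A i j ≠ 0) ∧ (∀ i, ∃ j, A i j ≠ 0)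
  | _, _, hidden A _ Φ => (∀ j, ∃ i, A i j ≠ 0) ∧ Φ.Nondegenerate

end ReLUNet

/-- The set `𝒩_{d,d'}` of (non-degenerate) ReLU networks with input dimension `d` and output
dimension `d'`. -/
def reluNets (d d' : ℕ) : Set (ReLUNet d d') := {Φ | Φ.Nondegenerate}

/-- The networks in `𝒩_{d,d'}` of connectivity at most `M`, depth at most `π(log M)` and weight
magnitude at most `π(M)`; `log` is the logarithm to base `2`. -/
noncomputable def reluNetsBdd (π : Polynomial ℝ) (M d d' : ℕ) : Set (ReLUNet d d') :=
  {Φ | Φ ∈ reluNets d d' ∧ Φ.connectivity ≤ M ∧ (Φ.depth : ℝ) ≤ π.eval (Real.logb 2 M) ∧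
    (Φ.weightMagnitude : ℝ) ≤ π.eval (M : ℝ)}

/-- Real-valued reading of a one-dimensional network output. -/
def realOut (y : Fin 1 → ℝ) : ℝ := y 0

/-- Complex-valued reading of a two-dimensional network output: the first component is the real
part and the second one the imaginary part. -/
noncomputable def complexOut (y : Fin 2 → ℝ) : ℂ := ⟨y 0, y 1⟩

/-! ### Approximation rates -/

/-- `e(M) ∈ 𝒪(M^{-γ})` as `M → ∞`. -/
def IsBigOPow (e : ℕ → ℝ≥0∞) (γ : ℝ) : Prop :=
  ∃ K : ℝ, ∀ᶠ M : ℕ in atTop, e M ≤ ENNReal.ofReal (K * (M : ℝ) ^ (-γ))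

section Hilbert

variable {H : Type*} [NormedAddCommGroup H]

/-- There is a binary encoder-decoder pair of length `ℓ` achieving uniform error `ε` over `C`. -/
def HasCode (C : Set H) (ε : ℝ) (ℓ : ℕ) : Prop :=
  ∃ (E : C → (Fin ℓ → Bool)) (D : (Fin ℓ → Bool) → H), ∀ f : C, ‖D (E f) - f‖ ≤ ε

/-- The minimax code length `L(ε, C)` (`∞` if there is no code). -/
noncomputable def minimaxCodeLength (ε : ℝ) (C : Set H) : ℕ∞ :=
  ⨅ (ℓ : ℕ) (_ : 1 ≤ ℓ ∧ HasCode C ε ℓ), (ℓ : ℕ∞)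

/-- The optimal exponent `γ*(C) ∈ [0,∞]`: the supremum of all `γ > 0` such that
`L(ε, C) ∈ 𝒪(ε^{-1/γ})` as `ε → 0` (and `0` if there is no such `γ`). -/
noncomputable def optimalExponent (C : Set H) : ℝ≥0∞ :=
  ⨆ (γ : ℝ≥0) (_ : 0 < γ ∧ ∃ K : ℝ, ∀ᶠ ε : ℝ in 𝓝[>] 0,
    (minimaxCodeLength ε C : ℝ≥0∞) ≤ ENNReal.ofReal (K * ε ^ (-1 / (γ : ℝ)))), (γ : ℝ≥0∞)

/-- The worst-case error over `C` of `M`-term approximation in the dictionary `φ₁, φ₂, …`, with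
indices in `{1, …, π(M)}` and coefficients bounded by `π(M)`. -/
noncomputable def dictError [NormedSpace ℂ H] (C : Set H) (φ : ℕ+ → H) (π : Polynomial ℝ)
    (M : ℕ) : ℝ≥0∞ :=
  ⨆ f ∈ C, ⨅ (I : Finset ℕ+) (c : ℕ+ → ℂ)
    (_ : I.card = M ∧ ∀ i ∈ I, ((i : ℕ) : ℝ) ≤ π.eval (M : ℝ) ∧ ‖c i‖ ≤ π.eval (M : ℝ)),
    ‖f - ∑ i ∈ I, c i • φ i‖ₑ

/-- The effective best `M`-term approximation rate of `C` in the dictionary `φ`. -/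
noncomputable def dictRate [NormedSpace ℂ H] (C : Set H) (φ : ℕ+ → H) : ℝ≥0∞ :=
  ⨆ (γ : ℝ≥0) (_ : ∃ π : Polynomial ℝ, IsBigOPow (dictError C φ π) γ), (γ : ℝ≥0∞)

/-- `C` is optimally representable by the dictionary `φ`. -/
def OptRepByDict [NormedSpace ℂ H] (C : Set H) (φ : ℕ+ → H) : Prop :=
  dictRate C φ = optimalExponent C

end Hilbert

section Networks

variable {F : Type*} [NormedAddCommGroup F] {d d' : ℕ}

/-- The space `L²(Ω, F)`. -/
noncomputable abbrev L2 (F : Type*) [NormedAddCommGroup F] {d : ℕ} (Ω : Set (Fin d → ℝ)) :=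
  Lp F 2 (volume.restrict Ω)

/-- The `L²(Ω)`-distance (possibly `∞`) of `f` to the function realized by the network `Φ`, whose
output is read in `F` through `out`. -/
noncomputable def netDist {Ω : Set (Fin d → ℝ)} (out : (Fin d' → ℝ) → F) (f : L2 F Ω)
    (Φ : ReLUNet d d') : ℝ≥0∞ :=
  eLpNorm (fun t => f t - out (Φ.realize t)) 2 (volume.restrict Ω)

/-- The worst-case error over `C` of approximation by networks with connectivity at most `M`,
depth at most `π(log M)` and weight magnitude at most `π(M)`. -/
noncomputable def netError {Ω : Set (Fin d → ℝ)} (out : (Fin d' → ℝ) → F) (C : Set (L2 F Ω))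
    (π : Polynomial ℝ) (M : ℕ) : ℝ≥0∞ :=
  ⨆ f ∈ C, ⨅ Φ ∈ reluNetsBdd π M d d', netDist out f Φ

/-- The effective best `M`-weight approximation rate of `C` by neural networks. -/
noncomputable def netRate {Ω : Set (Fin d → ℝ)} (out : (Fin d' → ℝ) → F) (C : Set (L2 F Ω)) :
    ℝ≥0∞ :=
  ⨆ (γ : ℝ≥0) (_ : ∃ π : Polynomial ℝ, IsBigOPow (netError out C π) γ), (γ : ℝ≥0∞)

/-- `C` is optimally representable by neural networks (a notion used for bounded `Ω`). -/
def OptRepByNets {Ω : Set (Fin d → ℝ)} (out : (Fin d' → ℝ) → F) (C : Set (L2 F Ω)) : Prop :=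
  netRate out C = optimalExponent C

/-- The dictionary `φ₁, φ₂, …` of complex-valued functions is effectively representable by neural
networks (with outputs in `ℝ² = ℂ`). -/
def EffectivelyRepresentable {Ω : Set (Fin d → ℝ)} (φ : ℕ+ → L2 ℂ Ω) : Prop :=
  ∃ π : MvPolynomial (Fin 2) ℝ, ∀ i : ℕ+, ∀ ε ∈ Ioo (0 : ℝ) (1 / 2), ∃ Φ ∈ reluNets d 2,
    (Φ.connectivity : ℝ) ≤ MvPolynomial.eval ![Real.logb 2 ε⁻¹, Real.logb 2 (i : ℕ)] π ∧
    (Φ.weightMagnitude : ℝ) ≤ MvPolynomial.eval ![ε⁻¹, ((i : ℕ) : ℝ)] π ∧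
    netDist complexOut (φ i) Φ ≤ ENNReal.ofReal ε

/-- The embedding `L²(Ω, ℝ) → L²(Ω, ℂ)`. -/
noncomputable def toComplexL2 {Ω : Set (Fin d → ℝ)} : L2 ℝ Ω →L[ℝ] L2 ℂ Ω :=
  Complex.ofRealCLM.compLpL 2 (volume.restrict Ω)

end Networks

/-! ### Gabor systems -/

section Gabor

variable {d : ℕ}

/-- The time-frequency shift `M_ξ T_x g`, that is `t ↦ exp(2πi⟨ξ,t⟩) g(t - x)`. -/
noncomputable def gaborAtom (g : (Fin d → ℝ) → ℝ) (x ξ : Fin d → ℝ) (t : Fin d → ℝ) : ℂ :=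
  Complex.exp (2 * Real.pi * Complex.I * ((ξ ⬝ᵥ t : ℝ) : ℂ)) * (g (t - x) : ℂ)

/-- The lattice `a ℤ^d`. -/
def scaledLattice (d : ℕ) (a : ℝ) : Set (Fin d → ℝ) := {x | ∃ k : Fin d → ℤ, ∀ j, x j = a * k j}

/-- The Gabor system `𝒢(g,α,β,Ω)`, a set of elements of `L²(Ω,ℂ)`. -/
def gaborSystem (g : (Fin d → ℝ) → ℝ) (α β : ℝ) (Ω : Set (Fin d → ℝ)) : Set (L2 ℂ Ω) :=
  {f | ∃ x ∈ scaledLattice d α, ∃ ξ ∈ scaledLattice d β,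
    f =ᵐ[volume.restrict Ω] gaborAtom g x ξ}

/-- The elements `M_ξ T_x g` of the Gabor system with `‖x‖_∞ ≤ nα` and `‖ξ‖_∞ ≤ nβ` (the norm on
`Fin d → ℝ` is the maximum norm). -/
def gaborBall (g : (Fin d → ℝ) → ℝ) (α β : ℝ) (Ω : Set (Fin d → ℝ)) (n : ℕ) : Set (L2 ℂ Ω) :=
  {f | ∃ x ∈ scaledLattice d α, ∃ ξ ∈ scaledLattice d β, ‖x‖ ≤ n * α ∧ ‖ξ‖ ≤ n * β ∧
    f =ᵐ[volume.restrict Ω] gaborAtom g x ξ}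

/-- The set `𝒢_n(g,α,β,Ω)`: what is in the `n`-th ball and in none of the previous ones,
equivalently in none of the sets `𝒢_k`, `k < n`. For `n = 0` it is `{g|_Ω}`. -/
def gaborShell (g : (Fin d → ℝ) → ℝ) (α β : ℝ) (Ω : Set (Fin d → ℝ)) (n : ℕ) : Set (L2 ℂ Ω) :=
  gaborBall g α β Ω n \ ⋃ k < n, gaborBall g α β Ω k

/-- `φ₁, φ₂, …` is the Gabor system `𝒢(g,α,β,Ω)` arranged as `(𝒢₀, 𝒢₁, 𝒢₂, …)` with an arbitrary
order within each `𝒢_n`. Elements are listed without repetition, except if the system is a finite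
set, so that a list indexed by the positive integers must repeat elements. -/
structure IsGaborOrdering (g : (Fin d → ℝ) → ℝ) (α β : ℝ) (Ω : Set (Fin d → ℝ))
    (φ : ℕ+ → L2 ℂ Ω) : Prop where
  range_eq : range φ = gaborSystem g α β Ω
  injective : (gaborSystem g α β Ω).Infinite → Function.Injective φ
  ordered : ∀ i j m n, φ i ∈ gaborShell g α β Ω m → φ j ∈ gaborShell g α β Ω n → m < n → i < j

end Gabor

/-! Two inequalities carry the argument: dictionary rates are at most network rates, because Gabor
atoms are cheap for networks, and for bounded `Ω` network rates are at most the optimal exponent,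
because networks can be quantized into short codes. Optimality for the dictionary then squeezes the
network rate between equal quantities.

Cheap atoms. Real and imaginary part of an atom are both of the form `cos (2θ) * g (t - x)` with `θ`
affine in `t`, and `cos (2θ) = 1 - 2 sin² θ`. The logistic map `s ↦ 4 s (1 - s)` sends `sin² y` to
`sin² (2y)`, so `sin² θ` is its `n`-th iterate at `sin² (θ / 2^n)`, which is nearly `(θ / 2^n)²`.
The parabola `s (1 - s)` is a series of iterated tent maps with terms decaying like `4^(-k)`, hence
realizable by networks with geometric accuracy (`parabolaApprox_bounds`). Each logistic step
amplifies errors by 4, but the initial error is of order `θ^4 / 16^n`, so `n` logarithmic in the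
frequency, the position and the accuracy suffices, at total size of order `n²`
(`sinSqApprox_mem_and_error`). Multiplication by the network for `g` uses polarization and the same
approximate square. Clamping by a bump function makes the result vanish far away, which turns a
pointwise bound into an `L²` bound even on all of `ℝ^d` (`atomApprox_error`,
`exists_gaborAtom_net`).

Indices control parameters. The window is real, so a non-zero atom determines its modulation `ξ`
(`modulation_unique`). Hence, unless all atoms vanish, every shell from some point on is non-empty,
and the `i`-th element lies in a shell of number at most a constant plus `i`
(`IsGaborOrdering.exists_parameters`). Bounds polynomial in the parameters become bounds polynomial
in `i`.

Transfer. Networks of connectivity `N` can imitate `M = N^θ` dictionary terms with `θ < 1`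
arbitrarily close to 1, since each term costs only a power of `log N` (`exists_isBigOPow_netError`).
Depth comes for free: in a non-degenerate network it is at most the connectivity.

Converse. Rounding the weights of a network with `M` weights, polylogarithmic depth and polynomial
magnitude to a suitable grid changes the function by a prescribed power of `1 / M`, and the rounded
networks can be counted: `M` times a power of `log M` bits are enough (`hasCode_of_nets`,
`netRate_le_optimalExponent`).

Constructions are done in a calculus (`HiddenLayers`, `NetFun`, `ScalarNet`) that ignores
non-degeneracy. Values cross a ReLU layer as a pair `v, -v`, so composition never multiplies
weights. Non-degeneracy is restored once, at the end, by dummy nodes (`NetFun.exists_reluNet`);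
these connect to every node, which is why sizes count nodes as well as weights. -/

set_option linter.unusedSectionVars false

/-! ### A calculus of functions realized by ReLU networks -/

/-- The ReLU function, acting component-wise. -/
def relu {κ : Type*} (v : κ → ℝ) : κ → ℝ := fun i => max (v i) 0

/-- `1` for a non-zero number and `0` for zero. -/
noncomputable def nz (a : ℝ) : ℕ := if a = 0 then 0 else 1

lemma nz_le_one (a : ℝ) : nz a ≤ 1 := by unfold nz; split_ifs <;> simp

@[simp] lemma nz_zero : nz 0 = 0 := by simp [nz]

@[simp] lemma nz_neg (a : ℝ) : nz (-a) = nz a := by simp [nz]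

lemma nz_one : nz 1 = 1 := by simp [nz]

/-- Number of non-zero entries of an affine map between arbitrary finite coordinate spaces. -/
noncomputable def weightCount {κ ι : Type*} [Fintype κ] [Fintype ι] (A : Matrix κ ι ℝ)
    (b : κ → ℝ) : ℕ := ∑ i, (∑ j, nz (A i j) + nz (b i))

lemma weightCount_le_card {κ ι : Type*} [Fintype κ] [Fintype ι] (A : Matrix κ ι ℝ) (b : κ → ℝ) :
    weightCount A b ≤ Fintype.card κ * (Fintype.card ι + 1) := by
  have h : ∀ i ∈ (Finset.univ : Finset κ), ∑ j, nz (A i j) + nz (b i) ≤ Fintype.card ι + 1 := by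
    intro i _
    have : ∑ j, nz (A i j) ≤ ∑ _j : ι, 1 := Finset.sum_le_sum fun j _ => nz_le_one _
    simp only [Finset.sum_const, Finset.card_univ, smul_eq_mul, mul_one] at this
    have := nz_le_one (b i)
    omega
  simpa [weightCount] using Finset.sum_le_sum h

lemma nnz_eq_weightCount {m n : ℕ} (A : Matrix (Fin n) (Fin m) ℝ) (b : Fin n → ℝ) :
    ReLUNet.nnz A b = weightCount A b := by
  unfold ReLUNet.nnz weightCount
  rw [Finset.card_filter, Finset.card_filter, Fintype.sum_prod_type, ← Finset.sum_add_distrib]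
  refine Finset.sum_congr rfl fun i _ => ?_
  simp [nz, ite_not]

/-- All weights of an affine map have absolute value at most `B`. -/
def WeightsLE {κ ι : Type*} (B : ℝ) (A : Matrix κ ι ℝ) (b : κ → ℝ) : Prop :=
  (∀ i j, |A i j| ≤ B) ∧ ∀ i, |b i| ≤ B

lemma WeightsLE.mono {κ ι : Type*} {B B' : ℝ} {A : Matrix κ ι ℝ} {b : κ → ℝ}
    (h : WeightsLE B A b) (hB : B ≤ B') : WeightsLE B' A b :=
  ⟨fun i j => (h.1 i j).trans hB, fun i => (h.2 i).trans hB⟩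

lemma maxAbs_le_iff {m n : ℕ} {A : Matrix (Fin n) (Fin m) ℝ} {b : Fin n → ℝ} {B : ℝ}
    (hB : 0 ≤ B) : (ReLUNet.maxAbs A b : ℝ) ≤ B ↔ WeightsLE B A b := by
  lift B to ℝ≥0 using hB
  rw [NNReal.coe_le_coe, ReLUNet.maxAbs, sup_le_iff, Finset.sup_le_iff, Finset.sup_le_iff]
  simp only [Finset.mem_univ, true_imp_iff, Prod.forall, WeightsLE, ← NNReal.coe_le_coe,
    coe_nnnorm, Real.norm_eq_abs]

/-- `F` is the vector of activations in the last of `L + 1` hidden layers with weights at most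
`B`; the number of nodes plus the number of non-zero weights is at most `S`. -/
def HiddenLayers {d : ℕ} (B : ℝ) : (L S : ℕ) → (κ : Type) → Fintype κ →
    ((Fin d → ℝ) → κ → ℝ) → Prop
  | 0, S, κ, _, F => ∃ (A : Matrix κ (Fin d) ℝ) (b : κ → ℝ), WeightsLE B A b ∧
      weightCount A b + Fintype.card κ ≤ S ∧ ∀ x, F x = relu (A.mulVec x + b)
  | L + 1, S, κ, _, F => ∃ (κ₀ : Type) (_ : Fintype κ₀) (F₀ : (Fin d → ℝ) → κ₀ → ℝ) (S₀ : ℕ)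
      (A : Matrix κ κ₀ ℝ) (b : κ → ℝ), HiddenLayers B L S₀ κ₀ inferInstance F₀ ∧ WeightsLE B A b ∧
      S₀ + (weightCount A b + Fintype.card κ) ≤ S ∧ ∀ x, F x = relu (A.mulVec (F₀ x) + b)

lemma HiddenLayers.mono {d : ℕ} {B B' : ℝ} {L S S' : ℕ} {κ : Type} [i : Fintype κ]
    {F : (Fin d → ℝ) → κ → ℝ} (h : HiddenLayers B L S κ i F) (hB : B ≤ B') (hS : S ≤ S') :
    HiddenLayers B' L S' κ i F := by
  induction L generalizing S S' κ with
  | zero =>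
    obtain ⟨A, b, hw, hc, hF⟩ := h
    exact ⟨A, b, hw.mono hB, hc.trans hS, hF⟩
  | succ L ih =>
    obtain ⟨κ₀, i₀, F₀, S₀, A, b, h₀, hw, hc, hF⟩ := h
    exact ⟨κ₀, i₀, F₀, S₀, A, b, ih h₀ le_rfl, hw.mono hB, hc.trans hS, hF⟩

/-- The vector-valued function `f` is an affine function, with at most `s` non-zero weights, of
activations as in `HiddenLayers`. -/
def NetFun {d : ℕ} (B : ℝ) (L S s : ℕ) {ι : Type} [Fintype ι] (f : (Fin d → ℝ) → ι → ℝ) : Prop :=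
  ∃ (κ : Type) (i : Fintype κ) (F : (Fin d → ℝ) → κ → ℝ) (A : Matrix ι κ ℝ) (b : ι → ℝ),
    HiddenLayers B L S κ i F ∧ WeightsLE B A b ∧ weightCount A b ≤ s ∧
    ∀ x, f x = A.mulVec (F x) + b

section Calculus

variable {d : ℕ} {B B' : ℝ} {L S s : ℕ} {ι ι' ι'' : Type} [Fintype ι] [Fintype ι'] [Fintype ι'']
  {f : (Fin d → ℝ) → ι → ℝ}

lemma NetFun.mono (h : NetFun B L S s f) (hB : B ≤ B') {S' s' : ℕ} (hS : S ≤ S')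
    (hs : s ≤ s') : NetFun B' L S' s' f := by
  obtain ⟨κ, i, F, A, b, h₀, hw, hc, hf⟩ := h
  exact ⟨κ, i, F, A, b, h₀.mono hB hS, hw.mono hB, hc.trans hs, hf⟩

lemma weightCount_fromRows_neg (A : Matrix ι ι' ℝ) (b : ι → ℝ) :
    weightCount (Matrix.fromRows A (-A)) (Sum.elim b (-b)) = 2 * weightCount A b := by
  simp [weightCount, Fintype.sum_sum_type, two_mul]

lemma weightCount_fromCols_neg_le (A : Matrix ι ι' ℝ) (b : ι → ℝ) :
    weightCount (Matrix.fromCols A (-A)) b ≤ 2 * weightCount A b := by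
  simp only [weightCount, Fintype.sum_sum_type, Finset.mul_sum]
  refine Finset.sum_le_sum fun i _ => ?_
  simp
  omega

/-- Since `z = max z 0 - max (-z) 0`, a layer holding `v` and `-v` passes `v` through the activation
unchanged. All depth adjustments and compositions rest on this. -/
lemma fromCols_neg_mulVec_relu (A : Matrix ι ι' ℝ) (v : ι' → ℝ) :
    (Matrix.fromCols A (-A)).mulVec (relu (Sum.elim v (-v))) = A.mulVec v := by
  ext i
  simp only [Matrix.mulVec, dotProduct, Fintype.sum_sum_type, Matrix.fromCols_apply_inl,
    Matrix.fromCols_apply_inr, relu, Sum.elim_inl, Sum.elim_inr, Pi.neg_apply, Matrix.neg_apply,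
    ← Finset.sum_add_distrib]
  refine Finset.sum_congr rfl fun j _ => ?_
  rcases le_total (v j) 0 with h | h
  · rw [max_eq_right h, max_eq_left (by linarith)]; ring
  · rw [max_eq_left h, max_eq_right (by linarith)]; ring

lemma WeightsLE.fromRows_neg {A : Matrix ι ι' ℝ} {b : ι → ℝ} (h : WeightsLE B A b) :
    WeightsLE B (Matrix.fromRows A (-A)) (Sum.elim b (-b)) :=
  ⟨by rintro (i | i) j <;> simpa using h.1 i j, by rintro (i | i) <;> simpa using h.2 i⟩

lemma WeightsLE.fromCols_neg {A : Matrix ι ι' ℝ} {b : ι → ℝ} (h : WeightsLE B A b) :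
    WeightsLE B (Matrix.fromCols A (-A)) b :=
  ⟨by rintro i (j | j) <;> simpa using h.1 i j, h.2⟩

/-- Affine functions of the input. -/
lemma NetFun.affine_input (hB : 1 ≤ B) (A : Matrix ι (Fin d) ℝ) (b : ι → ℝ)
    (hw : WeightsLE B A b) :
    NetFun B 0 (4 * d) (2 * weightCount A b) (fun x => A.mulVec x + b) := by
  refine ⟨Fin d ⊕ Fin d, inferInstance, fun x => relu (Sum.elim x (-x)), Matrix.fromCols A (-A), b,
    ⟨Matrix.fromRows 1 (-1), Sum.elim 0 (-0), WeightsLE.fromRows_neg ⟨fun i j => ?_, fun i => ?_⟩,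
      ?_, fun x => ?_⟩, hw.fromCols_neg, weightCount_fromCols_neg_le A b, fun x => ?_⟩
  · rw [Matrix.one_apply]; split_ifs <;> simp <;> linarith
  · simp; linarith
  · rw [weightCount_fromRows_neg]
    have : weightCount (1 : Matrix (Fin d) (Fin d) ℝ) 0 = d := by
      simp [weightCount, Matrix.one_apply, nz]
    rw [this]
    simp; omega
  · rw [Matrix.fromRows_mulVec]
    refine congrArg relu ?_
    ext (i | i) <;> simp [Matrix.neg_mulVec]
  · rw [fromCols_neg_mulVec_relu]

/-- Affine functions of a realized function; the weights are not multiplied. -/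
lemma NetFun.affine (h : NetFun B L S s f) (A : Matrix ι' ι ℝ) (b : ι' → ℝ)
    (hw : WeightsLE B A b) :
    NetFun B (L + 1) (S + 2 * s + 2 * Fintype.card ι) (2 * weightCount A b)
      (fun x => A.mulVec (f x) + b) := by
  obtain ⟨κ, i, F, A₀, b₀, h₀, hw₀, hc₀, hf⟩ := h
  refine ⟨ι ⊕ ι, inferInstance, fun x => relu (Sum.elim (f x) (-f x)), Matrix.fromCols A (-A), b,
    ⟨κ, i, F, S, Matrix.fromRows A₀ (-A₀), Sum.elim b₀ (-b₀), h₀, hw₀.fromRows_neg, ?_,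
      fun x => ?_⟩, hw.fromCols_neg, weightCount_fromCols_neg_le A b, fun x => ?_⟩
  · rw [weightCount_fromRows_neg, Fintype.card_sum]; omega
  · rw [Matrix.fromRows_mulVec]
    refine congrArg relu ?_
    ext (i | i) <;> simp [hf, Matrix.neg_mulVec]
    ring
  · rw [fromCols_neg_mulVec_relu]

lemma weightsLE_one [DecidableEq ι] (hB : 1 ≤ B) : WeightsLE B (1 : Matrix ι ι ℝ) 0 :=
  ⟨fun i j => by rw [Matrix.one_apply]; split_ifs <;> simp <;> linarith,
    fun i => by simp; linarith⟩

lemma weightCount_one [DecidableEq ι] :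
    weightCount (1 : Matrix ι ι ℝ) (0 : ι → ℝ) = Fintype.card ι := by
  simp [weightCount, Matrix.one_apply, nz]

/-- The ReLU function of a realized function. -/
lemma NetFun.relu_comp (hB : 1 ≤ B) (h : NetFun B L S s f) :
    NetFun B (L + 1) (S + s + Fintype.card ι) (Fintype.card ι) (fun x => relu (f x)) := by
  classical
  obtain ⟨κ, i, F, A₀, b₀, h₀, hw₀, hc₀, hf⟩ := h
  refine ⟨ι, inferInstance, fun x => relu (f x), 1, 0,
    ⟨κ, i, F, S, A₀, b₀, h₀, hw₀, by omega, fun x => by simp only [hf]⟩,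
    weightsLE_one hB, weightCount_one.le, fun x => by simp⟩

/-- A function realized by a network may be composed with a network with one hidden layer. -/
lemma NetFun.shallow (hB : 1 ≤ B) (h : NetFun B L S s f) (A : Matrix ι' ι ℝ) (b : ι' → ℝ)
    (hw : WeightsLE B A b) (A' : Matrix ι'' ι' ℝ) (b' : ι'' → ℝ) (hw' : WeightsLE B A' b') :
    NetFun B (L + 3) (S + 2 * s + 2 * Fintype.card ι +
        (2 * (Fintype.card ι' * (Fintype.card ι + 1)) + 5 * Fintype.card ι'))
      (2 * (Fintype.card ι'' * (Fintype.card ι' + 1)))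
      (fun x => A'.mulVec (relu (A.mulVec (f x) + b)) + b') := by
  have h1 := ((h.affine A b hw).relu_comp hB).affine A' b' hw'
  refine h1.mono le_rfl ?_ ?_
  · have := weightCount_le_card A b
    omega
  · have := weightCount_le_card A' b'
    omega

lemma NetFun.pad_succ (hB : 1 ≤ B) (h : NetFun B L S s f) :
    NetFun B (L + 1) (S + 2 * s + 2 * Fintype.card ι) (2 * Fintype.card ι) f := by
  classical
  simpa [weightCount_one] using h.affine 1 0 (weightsLE_one hB)

/-- A realized function is realized at every larger depth. -/
lemma NetFun.pad (hB : 1 ≤ B) (h : NetFun B L S s f) {L' : ℕ} (hL : L ≤ L') :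
    NetFun B L' (S + 2 * s + 6 * Fintype.card ι * (L' - L)) (s + 2 * Fintype.card ι) f := by
  obtain ⟨n, rfl⟩ := Nat.exists_eq_add_of_le hL
  rw [Nat.add_sub_cancel_left]
  rcases n with _ | n
  · exact h.mono le_rfl (by omega) (by omega)
  -- One identity layer replaces the output count `s` by `2 * Fintype.card ι`; from then on every
  -- further layer has the same cost, so `s` is paid for only once.
  · suffices NetFun B (L + (n + 1)) (S + 2 * s + 6 * Fintype.card ι * (n + 1))
        (2 * Fintype.card ι) f from this.mono le_rfl le_rfl (by omega)
    induction n with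
    | zero => exact (h.pad_succ hB).mono le_rfl (by omega) le_rfl
    | succ n ih =>
      refine ((ih (by omega)).pad_succ hB).mono le_rfl ?_ le_rfl
      rw [show 6 * Fintype.card ι * (n + 1 + 1) =
        6 * Fintype.card ι * (n + 1) + 6 * Fintype.card ι by ring]
      omega

lemma weightCount_blockDiagonal' {ι : Type} [Fintype ι] [DecidableEq ι] {κ κ' : ι → Type}
    [∀ i, Fintype (κ i)] [∀ i, Fintype (κ' i)] (A : ∀ i, Matrix (κ i) (κ' i) ℝ)
    (b : ∀ i, κ i → ℝ) :
    weightCount (Matrix.blockDiagonal' A) (fun p : Σ i, κ i => b p.1 p.2) =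
      ∑ i, weightCount (A i) (b i) := by
  simp only [weightCount, Fintype.sum_sigma]
  refine Finset.sum_congr rfl fun i _ => Finset.sum_congr rfl fun k _ => ?_
  congr 1
  rw [Finset.sum_eq_single i]
  · simp
  · intro j _ hj
    exact Finset.sum_eq_zero fun k' _ => by
      rw [Matrix.blockDiagonal'_apply_ne _ _ _ (Ne.symm hj), nz_zero]
  · simp

lemma blockDiagonal'_mulVec_apply {ι : Type} [Fintype ι] [DecidableEq ι] {κ κ' : ι → Type}
    [∀ i, Fintype (κ i)] [∀ i, Fintype (κ' i)] (A : ∀ i, Matrix (κ i) (κ' i) ℝ)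
    (v : ∀ i, κ' i → ℝ) (p : Σ i, κ i) :
    (Matrix.blockDiagonal' A).mulVec (fun q : Σ i, κ' i => v q.1 q.2) p =
      (A p.1).mulVec (v p.1) p.2 := by
  obtain ⟨i, k⟩ := p
  simp only [Matrix.mulVec, dotProduct, Fintype.sum_sigma]
  rw [Finset.sum_eq_single i]
  · simp
  · intro j _ hj
    exact Finset.sum_eq_zero fun k' _ => by
      rw [Matrix.blockDiagonal'_apply_ne _ _ _ (Ne.symm hj), zero_mul]
  · simp

lemma WeightsLE.blockDiagonal' {ι : Type} [DecidableEq ι] {κ κ' : ι → Type} (hB : 0 ≤ B)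
    {A : ∀ i, Matrix (κ i) (κ' i) ℝ} {b : ∀ i, κ i → ℝ} (h : ∀ i, WeightsLE B (A i) (b i)) :
    WeightsLE B (Matrix.blockDiagonal' A) (fun p : Σ i, κ i => b p.1 p.2) := by
  refine ⟨?_, fun p => (h p.1).2 p.2⟩
  rintro ⟨i, k⟩ ⟨j, l⟩
  by_cases hij : i = j
  · subst hij
    simpa using (h i).1 k l
  · rw [Matrix.blockDiagonal'_apply_ne _ _ _ hij]
    simpa using hB

/-- Parallel composition of hidden layers. -/
lemma HiddenLayers.sigma {ι : Type} [Fintype ι] (hB : 0 ≤ B) {κ : ι → Type}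
    [hi : ∀ i, Fintype (κ i)] {F : ∀ i, (Fin d → ℝ) → κ i → ℝ} {S : ι → ℕ}
    (h : ∀ i, HiddenLayers B L (S i) (κ i) (hi i) (F i)) :
    HiddenLayers B L (∑ i, S i) (Σ i, κ i) inferInstance (fun x p => F p.1 x p.2) := by
  classical
  induction L generalizing κ S with
  | zero =>
    choose A b hw hc hF using h
    refine ⟨fun p => A p.1 p.2, fun p => b p.1 p.2,
      ⟨fun p j => (hw p.1).1 p.2 j, fun p => (hw p.1).2 p.2⟩, ?_, fun x => ?_⟩
    · rw [Fintype.card_sigma]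
      simp only [weightCount, Fintype.sum_sigma]
      rw [← Finset.sum_add_distrib]
      exact Finset.sum_le_sum fun i _ => hc i
    · ext p
      simp only [hF]
      rfl
  | succ L ih =>
    choose κ₀ i₀ F₀ S₀ A b h₀ hw hc hF using h
    refine ⟨Σ i, κ₀ i, inferInstance, fun x p => F₀ p.1 x p.2, ∑ i, S₀ i, Matrix.blockDiagonal' A,
      fun p => b p.1 p.2, ih h₀, WeightsLE.blockDiagonal' hB hw, ?_, fun x => ?_⟩
    · rw [weightCount_blockDiagonal', Fintype.card_sigma, ← Finset.sum_add_distrib,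
        ← Finset.sum_add_distrib]
      exact Finset.sum_le_sum fun i _ => hc i
    · ext p
      simp only [hF, relu, Pi.add_apply]
      rw [blockDiagonal'_mulVec_apply A (fun i => F₀ i x) p]

/-- Parallel composition: scalar functions realized with the same depth form a vector-valued
realized function. -/
lemma NetFun.stack {ι : Type} [Fintype ι] (hB : 0 ≤ B) {f : ι → (Fin d → ℝ) → ℝ} {S s : ι → ℕ}
    (h : ∀ i, NetFun B L (S i) (s i) (fun x (_ : Unit) => f i x)) :
    NetFun B L (∑ i, S i) (∑ i, s i) (fun x i => f i x) := by
  classical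
  choose κ hi F A b hF hw hc hf using h
  refine ⟨Σ i, κ i, inferInstance, fun x p => F p.1 x p.2,
    fun i q => Matrix.blockDiagonal' A ⟨i, ()⟩ q, fun i => b i (), HiddenLayers.sigma hB hF,
    ⟨fun i q => (WeightsLE.blockDiagonal' hB hw).1 _ _, fun i => (hw i).2 _⟩, ?_, fun x => ?_⟩
  · refine le_trans (le_of_eq ?_) (Finset.sum_le_sum fun i (_ : i ∈ Finset.univ) => hc i)
    rw [← weightCount_blockDiagonal' A b]
    simp only [weightCount]
    rw [Fintype.sum_sigma (α := fun _ : ι => Unit)]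
    simp
  · ext i
    have h1 := congrFun (hf i x) ()
    have h2 := blockDiagonal'_mulVec_apply A (fun i => F i x) ⟨i, ()⟩
    simp only [Pi.add_apply] at h1 ⊢
    rw [h1, ← h2]
    rfl

end Calculus

/-! ### Passing between networks and realized functions -/

namespace ReLUNet

/-- Total number of nodes in hidden layers. -/
def hiddenWidth : {m n : ℕ} → ReLUNet m n → ℕ
  | _, _, output _ _ => 0
  | _, _, @hidden _ k _ _ _ Φ => k + Φ.hiddenWidth

/-- The chosen outgoing edges of distinct input nodes lie in distinct columns. -/
lemma card_le_nnz {m n : ℕ} (A : Matrix (Fin n) (Fin m) ℝ) (b : Fin n → ℝ)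
    (h : ∀ j, ∃ i, A i j ≠ 0) : m ≤ nnz A b := by
  choose i hi using h
  unfold nnz
  refine le_trans ?_ (Nat.le_add_right _ _)
  calc m = (Finset.univ : Finset (Fin m)).card := by simp
    _ ≤ _ := Finset.card_le_card_of_injOn (fun j => (i j, j)) (by simpa using hi)
      (fun a _ b _ hab => (Prod.ext_iff.1 hab).2)

/-- Every input and hidden node owns an outgoing edge. -/
lemma Nondegenerate.width_le_connectivity {m n : ℕ} {Φ : ReLUNet m n} (h : Φ.Nondegenerate) :
    m + Φ.hiddenWidth ≤ Φ.connectivity := by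
  induction Φ with
  | output A b => exact card_le_nnz A b h.1
  | hidden A b Φ ih =>
    have := ih h.2
    have := card_le_nnz A b h.1
    simp only [hiddenWidth, connectivity]
    omega

/-- A non-empty layer has an outgoing edge, so the next layer is non-empty too; starting from a
positive input dimension, each affine map contributes at least one weight. -/
lemma Nondegenerate.depth_le_connectivity {m n : ℕ} {Φ : ReLUNet m n} (h : Φ.Nondegenerate)
    (hm : 0 < m) : Φ.depth ≤ Φ.connectivity := by
  induction Φ with
  | output A b => exact hm.trans_le (card_le_nnz A b h.1)
  | hidden A b Φ ih =>
    obtain ⟨i, -⟩ := h.1 ⟨0, hm⟩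
    have := ih h.2 i.pos
    have := card_le_nnz A b h.1
    simp only [depth, connectivity]
    omega

lemma continuous_realize {m n : ℕ} (Φ : ReLUNet m n) : Continuous Φ.realize := by
  induction Φ with
  | output A b =>
    exact (Continuous.matrix_mulVec continuous_const continuous_id).add continuous_const
  | hidden A b Φ ih =>
    refine ih.comp (continuous_pi fun i => Continuous.max ?_ continuous_const)
    exact (continuous_apply i).comp
      ((Continuous.matrix_mulVec continuous_const continuous_id).add continuous_const)

end ReLUNet

section Conversion

variable {d : ℕ} {B : ℝ} {L S s : ℕ}

/-- A function realized by a network may be composed with an arbitrary network. -/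
lemma NetFun.comp_net (hB : 1 ≤ B) {m n : ℕ} (Φ : ReLUNet m n) (hΦ : (Φ.weightMagnitude : ℝ) ≤ B)
    {f : (Fin d → ℝ) → Fin m → ℝ} (h : NetFun B L S s f) :
    NetFun B (L + (2 * Φ.depth - 1)) (S + 2 * s + 2 * m + 2 * Φ.connectivity + 5 * Φ.hiddenWidth)
      (2 * Φ.connectivity) (fun x => Φ.realize (f x)) := by
  induction Φ generalizing L S s with
  | output A b =>
    have h1 := h.affine A b ((maxAbs_le_iff (by linarith)).1 hΦ)
    refine h1.mono le_rfl ?_ ?_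
    · simp only [Fintype.card_fin]; omega
    · rw [ReLUNet.connectivity, nnz_eq_weightCount]
  | @hidden m k n A b Φ ih =>
    rw [ReLUNet.weightMagnitude, NNReal.coe_max, max_le_iff] at hΦ
    have h1 := (h.affine A b ((maxAbs_le_iff (by linarith)).1 hΦ.1)).relu_comp hB
    have h2 := ih hΦ.2 h1
    -- A hidden layer of the network costs two layers, one to carry the incoming values as `±` pairs
    -- and one for its own ReLU; the output map costs one.
    have hdepth : L + (2 * (ReLUNet.hidden A b Φ).depth - 1) =
        L + 1 + 1 + (2 * Φ.depth - 1) := by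
      have : 1 ≤ Φ.depth := by cases Φ <;> simp [ReLUNet.depth]
      simp only [ReLUNet.depth]; omega
    rw [hdepth]
    refine h2.mono le_rfl ?_ ?_
    · simp only [Fintype.card_fin, ReLUNet.connectivity, ReLUNet.hiddenWidth, nnz_eq_weightCount]
      omega
    · simp only [ReLUNet.connectivity]; omega

lemma weightCount_submatrix {κ κ' ι ι' : Type*} [Fintype κ] [Fintype κ'] [Fintype ι] [Fintype ι']
    (A : Matrix κ ι ℝ) (b : κ → ℝ) (e : κ' ≃ κ) (e' : ι' ≃ ι) :
    weightCount (A.submatrix e e') (b ∘ e) = weightCount A b := by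
  unfold weightCount
  rw [← e.sum_comp]
  refine Finset.sum_congr rfl fun i _ => ?_
  rw [← e'.sum_comp]
  rfl

lemma WeightsLE.submatrix {κ κ' ι ι' : Type*} {A : Matrix κ ι ℝ} {b : κ → ℝ} (h : WeightsLE B A b)
    (e : κ' → κ) (e' : ι' → ι) : WeightsLE B (A.submatrix e e') (b ∘ e) :=
  ⟨fun _ _ => h.1 _ _, fun _ => h.2 _⟩

/-- Every node of the last layer of `h` is made to have an outgoing edge by two dummy nodes per
layer, with equal activations `z`. -/
lemma HiddenLayers.exists_net (hB : 1 ≤ B) {κ : Type} [hκ : Fintype κ]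
    {F : (Fin d → ℝ) → κ → ℝ} (h : HiddenLayers B L S κ hκ F) :
    ∃ z : (Fin d → ℝ) → ℝ, ∀ {n : ℕ} (Ψ : ReLUNet (Fintype.card (κ ⊕ Bool)) n), Ψ.Nondegenerate →
      (Ψ.weightMagnitude : ℝ) ≤ B → ∃ Φ : ReLUNet d n, Φ.Nondegenerate ∧
        (Φ.weightMagnitude : ℝ) ≤ B ∧ Φ.depth = Ψ.depth + L + 1 ∧
        Φ.connectivity + 2 * Fintype.card κ ≤ Ψ.connectivity + 2 * S + 2 * d + 4 * L ∧
        ∀ x, Φ.realize x = Ψ.realize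
          (Sum.elim (F x) (fun _ => z x) ∘ (Fintype.equivFin (κ ⊕ Bool)).symm) := by
  induction L generalizing κ S with
  | zero =>
    obtain ⟨A, b, hw, hc, hF⟩ := h
    refine ⟨fun x => max (∑ j, x j) 0, fun {n} Ψ hΨ hΨw => ?_⟩
    set e := (Fintype.equivFin (κ ⊕ Bool)).symm
    -- The rows of both dummy nodes are all ones, so each input node has an outgoing edge, and the
    -- two dummies share the activation `z`.
    let A' : Matrix (κ ⊕ Bool) (Fin d) ℝ := Matrix.fromRows A (Matrix.of fun _ _ => 1)
    let b' : κ ⊕ Bool → ℝ := Sum.elim b 0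
    have hw' : WeightsLE B A' b' := by
      refine ⟨?_, ?_⟩
      · rintro (i | i) j
        · exact hw.1 i j
        · simpa [A'] using hB
      · rintro (i | i)
        · exact hw.2 i
        · simp [b']; linarith
    refine ⟨.hidden (A'.submatrix e (Equiv.refl _)) (b' ∘ e) Ψ,
      ⟨fun j => ⟨e.symm (Sum.inr true), ?_⟩, hΨ⟩, ?_, ?_, ?_, fun x => ?_⟩
    · simp [A']
    · rw [ReLUNet.weightMagnitude, NNReal.coe_max, max_le_iff, maxAbs_le_iff (by linarith)]
      exact ⟨hw'.submatrix _ _, hΨw⟩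
    · simp only [ReLUNet.depth]; omega
    · simp only [ReLUNet.connectivity, nnz_eq_weightCount, weightCount_submatrix]
      have : weightCount A' b' = weightCount A b + 2 * d := by
        simp [weightCount, A', b', nz_one]
      omega
    · rw [ReLUNet.realize]
      congr 1
      ext i
      rw [Matrix.submatrix_mulVec_equiv]
      simp only [Pi.add_apply, Function.comp_apply]
      rcases e i with k | k
      · simp [A', b', hF, relu, Matrix.mulVec, dotProduct]
      · simp [A', b', Matrix.mulVec, dotProduct]
  | succ L ih =>
    obtain ⟨κ₀, i₀, F₀, S₀, A, b, h₀, hw, hc, hF⟩ := h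
    obtain ⟨z, hz⟩ := ih h₀
    refine ⟨fun x => max (∑ j, F₀ x j + (z x + z x)) 0, fun {n} Ψ hΨ hΨw => ?_⟩
    set e := (Fintype.equivFin (κ ⊕ Bool)).symm
    set e₀ := (Fintype.equivFin (κ₀ ⊕ Bool)).symm
    -- Old dummies feed only the new dummies (zero block), so the computed activations are
    -- untouched, while the all-ones rows give every node of the previous layer an outgoing edge.
    let A' : Matrix (κ ⊕ Bool) (κ₀ ⊕ Bool) ℝ :=
      Matrix.fromRows (Matrix.fromCols A 0) (Matrix.of fun _ _ => 1)
    let b' : κ ⊕ Bool → ℝ := Sum.elim b 0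
    have hw' : WeightsLE B A' b' := by
      refine ⟨?_, ?_⟩
      · rintro (i | i) (j | j)
        · exact hw.1 i j
        · simp [A']; linarith
        · simpa [A'] using hB
        · simpa [A'] using hB
      · rintro (i | i)
        · exact hw.2 i
        · simp [b']; linarith
    obtain ⟨Φ, hΦ, hΦw, hΦd, hΦc, hΦr⟩ := hz (.hidden (A'.submatrix e e₀) (b' ∘ e) Ψ)
      ⟨fun j => ⟨e.symm (Sum.inr true), by simp [A']⟩, hΨ⟩ (by
        rw [ReLUNet.weightMagnitude, NNReal.coe_max, max_le_iff, maxAbs_le_iff (by linarith)]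
        exact ⟨hw'.submatrix _ _, hΨw⟩)
    refine ⟨Φ, hΦ, hΦw, ?_, ?_, fun x => ?_⟩
    · rw [hΦd, ReLUNet.depth]; omega
    · simp only [ReLUNet.connectivity, nnz_eq_weightCount, weightCount_submatrix] at hΦc
      have : weightCount A' b' = weightCount A b + 2 * (Fintype.card κ₀ + 2) := by
        simp [weightCount, A', b', nz_one]
      omega
    · rw [hΦr, ReLUNet.realize]
      congr 1
      ext i
      rw [Matrix.submatrix_mulVec_equiv]
      simp only [Pi.add_apply, Function.comp_apply]
      have hcomp : (Sum.elim (F₀ x) (fun _ : Bool => z x) ∘ e₀) ∘ e₀.symm =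
          Sum.elim (F₀ x) (fun _ => z x) := by
        ext j; simp
      rw [hcomp]
      rcases e i with k | k
      · simp [A', b', hF, relu, Matrix.mulVec, dotProduct]
      · simp [A', b', Matrix.mulVec, dotProduct, two_mul]

/-- Every realized function is realized by a non-degenerate network. -/
lemma NetFun.exists_reluNet (hB : 1 ≤ B) {n : ℕ} (hn : 0 < n) {f : (Fin d → ℝ) → Fin n → ℝ}
    (h : NetFun B L S s f) :
    ∃ Φ ∈ reluNets d n, (∀ x, Φ.realize x = f x) ∧ (Φ.weightMagnitude : ℝ) ≤ B ∧
      Φ.depth = L + 3 ∧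
      Φ.connectivity ≤ n * (2 * n + 3) + 2 * S + 4 * s + 4 * n + 2 * d + 4 * (L + 1) := by
  classical
  obtain ⟨κ, i, F, A₀, b₀, h₀, hw₀, hc₀, hf⟩ := h
  have h1 : HiddenLayers B (L + 1) (S + 2 * s + 2 * n) (Fin n ⊕ Fin n) inferInstance
      (fun x => relu (Sum.elim (f x) (-f x))) := by
    refine ⟨κ, i, F, S, Matrix.fromRows A₀ (-A₀), Sum.elim b₀ (-b₀), h₀, hw₀.fromRows_neg, ?_,
      fun x => ?_⟩
    · rw [weightCount_fromRows_neg, Fintype.card_sum, Fintype.card_fin]; omega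
    · rw [Matrix.fromRows_mulVec]
      refine congrArg relu ?_
      ext (i | i) <;> simp [hf, Matrix.neg_mulVec]
      ring
  obtain ⟨z, hz⟩ := h1.exists_net hB
  set e := (Fintype.equivFin ((Fin n ⊕ Fin n) ⊕ Bool)).symm
  -- The blocks `1, -1` decode the pair `f, -f`. The dummies have equal activations and weights `1`
  -- and `-1`, so they cancel, yet no dummy lacks an outgoing edge and no output an incoming one.
  let M : Matrix (Fin n) ((Fin n ⊕ Fin n) ⊕ Bool) ℝ :=
    Matrix.fromCols (Matrix.fromCols 1 (-1)) (Matrix.of fun _ k => if k then 1 else -1)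
  have hM : WeightsLE B M 0 := by
    refine ⟨?_, fun i => by simp; linarith⟩
    rintro i ((j | j) | (_ | _))
    · simpa [M] using (weightsLE_one hB).1 i j
    · simpa [M] using (weightsLE_one hB).1 i j
    · simpa [M] using hB
    · simpa [M] using hB
  have hcol : ∀ j, ∃ i, M.submatrix (Equiv.refl _) e i j ≠ 0 := by
    intro j
    rcases hj : e j with (k | k) | k
    · exact ⟨k, by simp [M, hj]⟩
    · exact ⟨k, by simp [M, hj]⟩
    · exact ⟨⟨0, hn⟩, by cases k <;> simp [M, hj]⟩
  obtain ⟨Φ, hΦ, hΦw, hΦd, hΦc, hΦr⟩ := hz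
    (.output (M.submatrix (Equiv.refl _) e) ((0 : Fin n → ℝ) ∘ Equiv.refl _))
    ⟨hcol, fun i => ⟨e.symm (Sum.inr true), by simp [M]⟩⟩ (by
      rw [ReLUNet.weightMagnitude, maxAbs_le_iff (by linarith)]
      exact hM.submatrix _ _)
  refine ⟨Φ, hΦ, fun x => ?_, hΦw, by rw [hΦd, ReLUNet.depth]; omega, ?_⟩
  · rw [hΦr, ReLUNet.realize, Matrix.submatrix_mulVec_equiv]
    have hcomp : (Sum.elim (relu (Sum.elim (f x) (-f x))) (fun _ : Bool => z x) ∘ e) ∘ e.symm =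
        Sum.elim (relu (Sum.elim (f x) (-f x))) (fun _ => z x) := by
      ext j; simp
    simp only [M]
    rw [hcomp, Matrix.fromCols_mulVec, Sum.elim_comp_inl, Sum.elim_comp_inr,
      fromCols_neg_mulVec_relu]
    ext i
    simp [Matrix.mulVec, dotProduct]
  · simp only [ReLUNet.connectivity, nnz_eq_weightCount, weightCount_submatrix] at hΦc
    have := weightCount_le_card M 0
    simp only [Fintype.card_sum, Fintype.card_fin, Fintype.card_bool] at this hΦc
    rw [show n + n + 2 + 1 = 2 * n + 3 by ring] at this
    omega

end Conversion

/-! ### Approximate squaring and its error -/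

/-- The tent map `s ↦ min (2s) (2 - 2s)` on `[0, 1]`. -/
noncomputable def tent (s : ℝ) : ℝ := 2 * max s 0 - 4 * max (s - 1 / 2) 0

/-- A sum of iterated tent maps, approximating `s (1 - s)` on `[0, 1]`. -/
noncomputable def parabolaApprox : ℕ → ℝ → ℝ
  | 0, _ => 0
  | m + 1, s => (tent s + parabolaApprox m (tent s)) / 4

/-- An approximation of `s ^ 2` on `[-1, 1]`. -/
noncomputable def sqApprox (m : ℕ) (s : ℝ) : ℝ := |s| - parabolaApprox m |s|

/-- An approximation of `sin θ ^ 2`, by iterating an approximation of the logistic map. -/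
noncomputable def sinSqApprox (n m : ℕ) (θ : ℝ) : ℝ :=
  (fun s => 4 * parabolaApprox m s)^[n] (sqApprox m (θ / 2 ^ n))

/-- An approximation of `u * v` for `|u| ≤ D`, `|v| ≤ 1`. -/
noncomputable def mulApprox (m : ℕ) (D u v : ℝ) : ℝ :=
  D * sqApprox m ((u / D + v) / 2) - D * sqApprox m ((u / D - v) / 2)

/-- Truncation of `u` to `[-p, p]`, for `p ≥ 0`. -/
noncomputable def truncate (p u : ℝ) : ℝ := max (u + p) 0 - max (u - p) 0 - max p 0

lemma tent_mem {s : ℝ} (hs : s ∈ Icc (0 : ℝ) 1) : tent s ∈ Icc (0 : ℝ) 1 := by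
  unfold tent
  rw [max_eq_left hs.1]
  rcases le_total s (1 / 2) with h | h
  · rw [max_eq_right (by linarith)]; constructor <;> linarith [hs.1]
  · rw [max_eq_left (by linarith)]; constructor <;> linarith [hs.2]

/-- Self-similarity of the parabola `p s = s (1 - s)`: `p = (tent + p ∘ tent) / 4` on `[0, 1]`.
`parabolaApprox` iterates this equation starting from `0`. -/
lemma tent_parabola {s : ℝ} (hs : s ∈ Icc (0 : ℝ) 1) :
    tent s + tent s * (1 - tent s) = 4 * (s * (1 - s)) := by
  unfold tent
  rw [max_eq_left hs.1]
  rcases le_total s (1 / 2) with h | h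
  · rw [max_eq_right (by linarith)]; ring
  · rw [max_eq_left (by linarith)]; ring

/-- The functional equation `tent_parabola` divides the error by 4 at each recursion step, and the
approximation stays below the parabola because the omitted terms are non-negative. -/
lemma parabolaApprox_bounds (m : ℕ) {s : ℝ} (hs : s ∈ Icc (0 : ℝ) 1) :
    0 ≤ parabolaApprox m s ∧ parabolaApprox m s ≤ s * (1 - s) ∧
      s * (1 - s) - (1 / 4) ^ m ≤ parabolaApprox m s := by
  induction m generalizing s with
  | zero =>
    simp only [parabolaApprox, pow_zero]
    refine ⟨le_rfl, mul_nonneg hs.1 (by linarith [hs.2]), by nlinarith [hs.1, hs.2]⟩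
  | succ m ih =>
    obtain ⟨h1, h2, h3⟩ := ih (tent_mem hs)
    have h4 := tent_parabola hs
    have h5 := (tent_mem hs).1
    simp only [parabolaApprox, pow_succ]
    refine ⟨by linarith, by linarith, by linarith⟩

/-- Uses `s² = |s| - |s| (1 - |s|)`. The approximation is from above; the bound by `1` makes it an
admissible starting value in `[0, 1]` for the logistic iteration. -/
lemma sqApprox_bounds (m : ℕ) {s : ℝ} (hs : |s| ≤ 1) :
    s ^ 2 ≤ sqApprox m s ∧ sqApprox m s ≤ s ^ 2 + (1 / 4) ^ m ∧ sqApprox m s ≤ 1 := by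
  obtain ⟨h1, h2, h3⟩ := parabolaApprox_bounds m ⟨abs_nonneg s, hs⟩
  unfold sqApprox
  have : |s| ^ 2 = s ^ 2 := sq_abs s
  refine ⟨by nlinarith, by nlinarith, by linarith⟩

/-- Polarization: `u v / D` is the difference of the squares of `(u / D ± v) / 2`. Both squares are
approximated from above, so the two errors do not add up. -/
lemma mulApprox_error (m : ℕ) {D u v : ℝ} (hD : 0 < D) (hu : |u| ≤ D) (hv : |v| ≤ 1) :
    |mulApprox m D u v - u * v| ≤ D * (1 / 4) ^ m := by
  have hu' : |u / D| ≤ 1 := by rw [abs_div, abs_of_pos hD]; exact div_le_one_of_le₀ hu hD.le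
  have ha : |(u / D + v) / 2| ≤ 1 := by
    rw [abs_le] at *; constructor <;> linarith
  have hb : |(u / D - v) / 2| ≤ 1 := by
    rw [abs_le] at *; constructor <;> linarith
  obtain ⟨h1, h2, -⟩ := sqApprox_bounds m ha
  obtain ⟨h3, h4, -⟩ := sqApprox_bounds m hb
  have key : u * v = D * (((u / D + v) / 2) ^ 2 - ((u / D - v) / 2) ^ 2) := by
    field_simp; ring
  rw [mulApprox, key, ← mul_sub, ← mul_sub, abs_mul, abs_of_pos hD]
  refine mul_le_mul_of_nonneg_left ?_ hD.le
  rw [abs_le]; constructor <;> linarith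

lemma truncate_zero (u : ℝ) : truncate 0 u = 0 := by simp [truncate]

/-- Projection onto an interval does not move a point away from an element `h` of that interval. -/
lemma abs_truncate_sub_le {p u h : ℝ} (hp : |h| ≤ p) : |truncate p u - h| ≤ |u - h| := by
  obtain ⟨h1, h2⟩ := abs_le.1 hp
  unfold truncate
  rw [max_eq_left (by linarith : (0 : ℝ) ≤ p)]
  rcases le_total 0 (u + p) with ha | ha <;> rcases le_total 0 (u - p) with hb | hb
  · rw [max_eq_left ha, max_eq_left hb]
    rw [abs_of_nonneg (by linarith), abs_of_nonneg (by linarith)]; linarith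
  · rw [max_eq_left ha, max_eq_right hb]
    refine le_of_eq (congrArg _ ?_); ring
  · rw [max_eq_right ha, max_eq_left hb]
    rw [abs_le]; constructor <;> linarith [abs_nonneg (u - h)]
  · rw [max_eq_right ha, max_eq_right hb]
    rw [abs_of_nonpos (by linarith), abs_of_nonpos (by linarith)]; linarith

/-- With `δ = (1/4)^m` and `e` the current error, one step gives at most `4 (e + δ)`, because `s (1
- s)` is 1-Lipschitz on `[0, 1]`. Adding `2 δ` to the error turns this recursion into pure
multiplication by 4. -/
lemma logistic_iterate_error (m n : ℕ) {s y : ℝ} (hs : s ∈ Icc (0 : ℝ) 1) :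
    (fun s => 4 * parabolaApprox m s)^[n] s ∈ Icc (0 : ℝ) 1 ∧
    |(fun s => 4 * parabolaApprox m s)^[n] s - Real.sin (2 ^ n * y) ^ 2| + 2 * (1 / 4) ^ m ≤
      4 ^ n * (|s - Real.sin y ^ 2| + 2 * (1 / 4) ^ m) := by
  induction n with
  | zero => simpa using hs
  | succ n ih =>
    obtain ⟨⟨h0, h1⟩, h2⟩ := ih
    rw [Function.iterate_succ_apply']
    set a := (fun s => 4 * parabolaApprox m s)^[n] s
    obtain ⟨h3, h4, h5⟩ := parabolaApprox_bounds m ⟨h0, h1⟩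
    refine ⟨⟨by linarith, by nlinarith [sq_nonneg (2 * a - 1)]⟩, ?_⟩
    have hz : Real.sin (2 ^ (n + 1) * y) ^ 2 =
        4 * (Real.sin (2 ^ n * y) ^ 2 * (1 - Real.sin (2 ^ n * y) ^ 2)) := by
      rw [show (2 : ℝ) ^ (n + 1) * y = 2 * (2 ^ n * y) by ring, Real.sin_two_mul]
      nlinarith [Real.sin_sq_add_cos_sq (2 ^ n * y)]
    rw [hz]
    set b := Real.sin (2 ^ n * y) ^ 2
    have hb0 : 0 ≤ b := sq_nonneg _
    have hb1 : b ≤ 1 := by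
      have := Real.sin_sq_add_cos_sq (2 ^ n * y)
      nlinarith [sq_nonneg (Real.cos (2 ^ n * y))]
    have hab : |a * (1 - a) - b * (1 - b)| ≤ |a - b| := by
      rw [show a * (1 - a) - b * (1 - b) = (a - b) * (1 - a - b) by ring, abs_mul]
      refine mul_le_of_le_one_right (abs_nonneg _) ?_
      rw [abs_le]; constructor <;> linarith
    have hp : |parabolaApprox m a - a * (1 - a)| ≤ (1 / 4) ^ m := by
      rw [abs_le]; constructor <;> linarith [show (0 : ℝ) < (1 / 4) ^ m by positivity]
    have : |4 * parabolaApprox m a - 4 * (b * (1 - b))| ≤ 4 * ((1 / 4) ^ m + |a - b|) := by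
      rw [← mul_sub, abs_mul, abs_of_pos (by norm_num : (0 : ℝ) < 4)]
      refine mul_le_mul_of_nonneg_left ?_ (by norm_num)
      calc _ ≤ |parabolaApprox m a - a * (1 - a)| + |a * (1 - a) - b * (1 - b)| :=
            abs_sub_le _ _ _
        _ ≤ _ := add_le_add hp hab
    rw [pow_succ]
    linarith

lemma abs_sq_sub_sin_sq_le {y : ℝ} (hy : |y| ≤ 1) : |y ^ 2 - Real.sin y ^ 2| ≤ y ^ 4 := by
  wlog h : 0 ≤ y generalizing y
  · have := this (y := -y) (by simpa using hy) (by linarith)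
    rwa [Real.sin_neg, neg_sq, neg_sq, Even.neg_pow (by decide)] at this
  rcases h.eq_or_lt with rfl | h0
  · simp
  have h1 := Real.sin_gt_sub_cube h0
  have h2 := Real.sin_lt h0
  have hy1 : y ≤ 1 := (le_abs_self y).trans hy
  have h3 : 0 ≤ Real.sin y := Real.sin_nonneg_of_nonneg_of_le_pi h (by linarith [Real.pi_gt_three])
  rw [show y ^ 2 - Real.sin y ^ 2 = (y - Real.sin y) * (y + Real.sin y) by ring,
    abs_of_nonneg (mul_nonneg (by linarith) (by linarith))]
  calc (y - Real.sin y) * (y + Real.sin y) ≤ (y ^ 3 / 6) * (2 * y) :=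
        mul_le_mul (by linarith) (by linarith) (by linarith) (by positivity)
    _ ≤ y ^ 4 := by nlinarith [pow_pos h0 4]

/-- For `y = θ / 2^n` the starting error is `y^4 + 4^(-m)`. Amplified by `4^n`, its first part
becomes `θ^4 / 4^n`; the choice `m = 2 n + 3` keeps all errors from the tent series below `1 / 4^n`.
-/
lemma sinSqApprox_mem_and_error (n : ℕ) {θ : ℝ} (hθ : |θ| ≤ 2 ^ n) :
    sinSqApprox n (2 * n + 3) θ ∈ Icc (0 : ℝ) 1 ∧
    |sinSqApprox n (2 * n + 3) θ - Real.sin θ ^ 2| ≤ (θ ^ 4 + 1) / 4 ^ n := by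
  set m := 2 * n + 3
  set y := θ / 2 ^ n with hy
  have hyθ : 2 ^ n * y = θ := by rw [hy]; field_simp
  have hy1 : |y| ≤ 1 := by
    rw [hy, abs_div, abs_of_pos (by positivity : (0 : ℝ) < 2 ^ n)]
    exact div_le_one_of_le₀ hθ (by positivity)
  obtain ⟨h1, h2, h3⟩ := sqApprox_bounds m hy1
  obtain ⟨h4, h5⟩ := logistic_iterate_error m n (y := y) (s := sqApprox m y)
    ⟨(sq_nonneg y).trans h1, h3⟩
  refine ⟨h4, ?_⟩
  rw [hyθ] at h5
  have hδ : (0 : ℝ) < (1 / 4) ^ m := by positivity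
  have h6 : |sqApprox m y - Real.sin y ^ 2| ≤ (1 / 4) ^ m + y ^ 4 := by
    calc _ ≤ |sqApprox m y - y ^ 2| + |y ^ 2 - Real.sin y ^ 2| := abs_sub_le _ _ _
      _ ≤ _ := by
        refine add_le_add ?_ (abs_sq_sub_sin_sq_le hy1)
        rw [abs_le]; constructor <;> linarith
  have h7 : (4 : ℝ) ^ n * (y ^ 4 + 3 * (1 / 4) ^ m) ≤ (θ ^ 4 + 1) / 4 ^ n := by
    have e1 : (4 : ℝ) ^ n * y ^ 4 = θ ^ 4 / 4 ^ n := by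
      rw [hy, div_pow, ← pow_mul, mul_comm n 4, pow_mul]
      rw [show (2 : ℝ) ^ 4 = 4 * 4 by norm_num, mul_pow]
      field_simp
    have e2 : (4 : ℝ) ^ n * (3 * (1 / 4) ^ m) ≤ 1 / 4 ^ n := by
      rw [show m = n + n + 3 by omega, pow_add, pow_add, one_div_pow, one_div_pow]
      field_simp
      norm_num
    rw [mul_add, e1, add_div]
    linarith
  unfold sinSqApprox
  calc _ ≤ (4 : ℝ) ^ n * (|sqApprox m y - Real.sin y ^ 2| + 2 * (1 / 4) ^ m) := by linarith
    _ ≤ (4 : ℝ) ^ n * (y ^ 4 + 3 * (1 / 4) ^ m) :=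
      mul_le_mul_of_nonneg_left (by linarith) (by positivity)
    _ ≤ _ := h7

/-! ### Networks for the elementary approximants -/

/-- The scalar function `f` is realized with weights at most `B` and complexity at most `K`. -/
def ScalarNet {d : ℕ} (B : ℝ) (K : ℕ) (f : (Fin d → ℝ) → ℝ) : Prop :=
  ∃ L S s, NetFun B L S s (fun x (_ : Unit) => f x) ∧ L ≤ K ∧ S ≤ K ∧ s ≤ K

section Elementary

variable {d : ℕ} {B : ℝ} {L S s K : ℕ}

lemma ScalarNet.mono {f : (Fin d → ℝ) → ℝ} (h : ScalarNet B K f) {B' : ℝ} (hB : B ≤ B') {K' : ℕ}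
    (hK : K ≤ K') : ScalarNet B' K' f := by
  obtain ⟨L, S, s, h, h1, h2, h3⟩ := h
  exact ⟨L, S, s, h.mono hB le_rfl le_rfl, h1.trans hK, h2.trans hK, h3.trans hK⟩

lemma NetFun.congr {ι : Type} [Fintype ι] {f g : (Fin d → ℝ) → ι → ℝ} (h : NetFun B L S s f)
    (hfg : ∀ x i, f x i = g x i) : NetFun B L S s g := by
  have : f = g := funext fun x => funext fun i => hfg x i
  exact this ▸ h

lemma ScalarNet.congr {f g : (Fin d → ℝ) → ℝ} (h : ScalarNet B K f) (hfg : ∀ x, f x = g x) :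
    ScalarNet B K g := (funext hfg : f = g) ▸ h

lemma NetFun.reindex {ι ι' : Type} [Fintype ι] [Fintype ι'] (e : ι' ≃ ι)
    {f : (Fin d → ℝ) → ι → ℝ} (h : NetFun B L S s f) : NetFun B L S s (fun x i => f x (e i)) := by
  obtain ⟨κ, i, F, A, b, h₀, hw, hc, hf⟩ := h
  refine ⟨κ, i, F, A.submatrix e (Equiv.refl _), b ∘ e, h₀, hw.submatrix _ _, ?_, fun x => ?_⟩
  · rwa [weightCount_submatrix]
  · rw [Matrix.submatrix_mulVec_equiv]
    ext i
    simp [hf]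

lemma NetFun.scalarNet {ι : Type} [Fintype ι] [Unique ι] {f : (Fin d → ℝ) → ι → ℝ}
    (h : NetFun B L S s f) (h1 : L ≤ K) (h2 : S ≤ K) (h3 : s ≤ K) :
    ScalarNet B K (fun x => f x default) :=
  ⟨L, S, s, h.reindex (Equiv.ofUnique Unit ι), h1, h2, h3⟩

/-- Few scalar functions may be combined by a network with one hidden layer. -/
lemma ScalarNet.shallow (hB : 1 ≤ B) {n k : ℕ} (hn : n ≤ 3) (hk : k ≤ 4)
    {f : Fin n → (Fin d → ℝ) → ℝ} (h : ∀ i, ScalarNet B K (f i)) (A : Matrix (Fin k) (Fin n) ℝ)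
    (b : Fin k → ℝ) (hw : WeightsLE B A b) (A' : Matrix Unit (Fin k) ℝ) (b' : Unit → ℝ)
    (hw' : WeightsLE B A' b') :
    ScalarNet B (40 * K + 80)
      (fun x => (A'.mulVec (relu (A.mulVec (fun i => f i x) + b)) + b') ()) := by
  have hs : NetFun B K (27 * K) (3 * (K + 2)) (fun x i => f i x) := by
    -- Padding to the common depth `K` costs at most `K + 2 * K + 6 * K`, by `NetFun.pad`.
    have h1 : ∀ i, NetFun B K (9 * K) (K + 2) (fun x (_ : Unit) => f i x) := by
      intro i
      obtain ⟨L, S, s, h, h1, h2, h3⟩ := h i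
      refine (h.pad hB h1).mono le_rfl ?_ ?_
      · simp only [Fintype.card_unit]; omega
      · simp only [Fintype.card_unit]; omega
    refine (NetFun.stack (by linarith) h1).mono le_rfl ?_ ?_
    · simp only [Finset.sum_const, Finset.card_univ, Fintype.card_fin, smul_eq_mul]; nlinarith
    · simp only [Finset.sum_const, Finset.card_univ, Fintype.card_fin, smul_eq_mul]; nlinarith
  have := hs.shallow hB A b hw A' b' hw'
  refine ⟨_, _, _, this, by omega, ?_, ?_⟩
  · simp only [Fintype.card_fin]
    have : k * (n + 1) ≤ 4 * 4 := Nat.mul_le_mul hk (by omega)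
    omega
  · simp only [Fintype.card_fin, Fintype.card_unit]
    omega

/-- A two-coordinate register: the first coordinate runs through the tent iterates, the second
accumulates the series, and `c` is divided by 4 at each step. The final iterate `u` is irrelevant.
Starting from `|c| ≤ 4` keeps all weights at most `4`. -/
lemma NetFun.parabola (hB : 4 ≤ B) (m : ℕ) {c : ℝ} (hc : |c| ≤ 4)
    {f : (Fin d → ℝ) → Fin 2 → ℝ} (h : NetFun B L S s f) :
    ∃ u : (Fin d → ℝ) → ℝ, NetFun B (L + 3 * m) (S + 2 * s + 88 * m) (max s 20)
      (fun x => ![u x, f x 1 + c * parabolaApprox m (f x 0)]) := by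
  induction m generalizing L S s f c with
  | zero =>
    refine ⟨fun x => f x 0, ?_⟩
    have : (fun x => ![f x 0, f x 1 + c * parabolaApprox 0 (f x 0)]) = f := by
      ext x i; fin_cases i <;> simp [parabolaApprox]
    rw [this]
    exact h.mono le_rfl (by omega) (by omega)
  | succ m ih =>
    have hc' := abs_le.1 hc
    have h1 := h.shallow (by linarith) (!![1, 0; 1, 0; 0, 1; 0, -1] : Matrix (Fin 4) (Fin 2) ℝ)
      ![0, -(1 / 2), 0, 0] (by
        refine ⟨fun i j => ?_, fun i => ?_⟩
        · fin_cases i <;> fin_cases j <;> norm_num <;> linarith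
        · fin_cases i <;> norm_num [abs_of_pos] <;> linarith)
      (!![2, -4, 0, 0; c / 2, -c, 1, -1] : Matrix (Fin 2) (Fin 4) ℝ) 0 (by
        refine ⟨fun i j => ?_, fun i => ?_⟩
        · fin_cases i <;> fin_cases j <;> simp [abs_le] <;> (try constructor) <;> linarith
        · simp; linarith)
    have h2 : (fun x => (!![2, -4, 0, 0; c / 2, -c, 1, -1] : Matrix (Fin 2) (Fin 4) ℝ).mulVec
        (relu ((!![1, 0; 1, 0; 0, 1; 0, -1] : Matrix (Fin 4) (Fin 2) ℝ).mulVec (f x) +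
          ![0, -(1 / 2), 0, 0])) + 0) = fun x => ![tent (f x 0), f x 1 + c / 4 * tent (f x 0)] := by
      ext x i
      have hmm : max (f x 1) 0 = f x 1 + max (-f x 1) 0 := by
        rcases le_total (f x 1) 0 with h | h
        · rw [max_eq_right h, max_eq_left (by linarith)]; ring
        · rw [max_eq_left h, max_eq_right (by linarith)]; ring
      fin_cases i
      · simp [dotProduct, Fin.sum_univ_succ, relu, tent, sub_eq_add_neg]
      · simp [dotProduct, Fin.sum_univ_succ, relu, tent, sub_eq_add_neg]
        rw [hmm]; ring
    rw [h2] at h1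
    obtain ⟨u, hu⟩ := ih (c := c / 4) (by rw [abs_div, abs_of_pos (by norm_num : (0 : ℝ) < 4)]
                                          linarith) h1
    refine ⟨u, ?_⟩
    have h3 : (fun x => ![u x, (![tent (f x 0), f x 1 + c / 4 * tent (f x 0)] : Fin 2 → ℝ) 1 +
        c / 4 * parabolaApprox m ((![tent (f x 0), f x 1 + c / 4 * tent (f x 0)] : Fin 2 → ℝ) 0)]) =
        fun x => ![u x, f x 1 + c * parabolaApprox (m + 1) (f x 0)] := by
      ext x i
      fin_cases i
      · simp
      · simp [parabolaApprox]; ring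
    rw [h3] at hu
    rw [show L + 3 * (m + 1) = L + 3 + 3 * m by ring]
    refine hu.mono le_rfl ?_ ?_
    · simp only [Fintype.card_fin]; omega
    · simp only [Fintype.card_fin]; omega

lemma NetFun.snd (hB : 1 ≤ B) {f : (Fin d → ℝ) → Fin 2 → ℝ} (h : NetFun B L S s f) :
    NetFun B (L + 1) (S + 2 * s + 4) 6 (fun x (_ : Unit) => f x 1) := by
  have h1 := h.affine (!![0, 1] : Matrix (Fin 1) (Fin 2) ℝ) 0 (by
    refine ⟨fun i j => ?_, fun i => ?_⟩
    · fin_cases i; fin_cases j <;> simp <;> linarith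
    · simp; linarith)
  have h2 := (h1.reindex (Equiv.ofUnique Unit (Fin 1))).mono (le_refl B) (le_refl _)
    (Nat.mul_le_mul_left 2 (weightCount_le_card _ _))
  refine h2.congr fun x i => ?_
  simp [dotProduct]

/-- The register of `NetFun.parabola` is started at `(g, 0)` with `c = 4` and its second coordinate
is read off. -/
lemma NetFun.logistic (hB : 4 ≤ B) (m : ℕ) {g : (Fin d → ℝ) → ℝ}
    (h : NetFun B L S s (fun x (_ : Unit) => g x)) :
    NetFun B (L + (3 * m + 2)) (S + 2 * s + 78 + 88 * m) 6
      (fun x (_ : Unit) => 4 * parabolaApprox m (g x)) := by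
  have h1 := h.affine (Matrix.of ![fun _ => 1, fun _ => 0] : Matrix (Fin 2) Unit ℝ) 0 (by
    refine ⟨fun i j => ?_, fun i => ?_⟩
    · fin_cases i <;> simp <;> linarith
    · simp; linarith)
  obtain ⟨u, hu⟩ := (h1.mono le_rfl le_rfl
    (Nat.mul_le_mul_left 2 (weightCount_le_card _ _))).parabola hB m (c := 4) (by norm_num)
  rw [show L + (3 * m + 2) = L + 1 + 3 * m + 1 by ring]
  refine ((hu.snd (by linarith)).mono le_rfl ?_ le_rfl).congr fun x i => ?_
  rotate_left
  · simp [dotProduct]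
  · simp only [Fintype.card_fin, Fintype.card_unit]; omega

lemma NetFun.logistic_iterate (hB : 4 ≤ B) (m n : ℕ) {g : (Fin d → ℝ) → ℝ}
    (h : NetFun B L S s (fun x (_ : Unit) => g x)) :
    NetFun B (L + n * (3 * m + 2)) (S + 2 * s + n * (90 + 88 * m)) (s + 6)
      (fun x (_ : Unit) => (fun s => 4 * parabolaApprox m s)^[n] (g x)) := by
  rcases n with _ | n
  · rw [Nat.zero_mul, add_zero]
    exact h.mono le_rfl (by omega) (by omega)
  -- After one step the output count is the constant 6, so the size grows linearly in the number of
  -- iterations.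
  suffices NetFun B (L + (n + 1) * (3 * m + 2)) (S + 2 * s + (n + 1) * (90 + 88 * m)) 6
      (fun x (_ : Unit) => (fun s => 4 * parabolaApprox m s)^[n + 1] (g x)) from
    this.mono le_rfl le_rfl (by omega)
  induction n with
  | zero => simpa using (h.logistic hB m).mono le_rfl (by omega) le_rfl
  | succ n ih =>
    simp only [Function.iterate_succ_apply' _ (n + 1)]
    have := ih.logistic hB m
    rw [show L + (n + 1 + 1) * (3 * m + 2) = L + (n + 1) * (3 * m + 2) + (3 * m + 2) by ring]
    refine this.mono le_rfl (le_of_eq ?_) le_rfl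
    ring

lemma NetFun.sq (hB : 4 ≤ B) (m : ℕ) {g : (Fin d → ℝ) → ℝ}
    (h : NetFun B L S s (fun x (_ : Unit) => g x)) :
    NetFun B (L + (3 * m + 4)) (S + 2 * s + 112 + 88 * m) 6
      (fun x (_ : Unit) => sqApprox m (g x)) := by
  have h1 := h.shallow (by linarith)
    (Matrix.of ![fun _ => 1, fun _ => -1] : Matrix (Fin 2) Unit ℝ) 0 (by
      refine ⟨fun i j => ?_, fun i => ?_⟩
      · fin_cases i <;> simp <;> linarith
      · simp; linarith)
    (!![1, 1; 1, 1] : Matrix (Fin 2) (Fin 2) ℝ) 0 (by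
      refine ⟨fun i j => ?_, fun i => ?_⟩
      · fin_cases i <;> fin_cases j <;> simp <;> linarith
      · simp; linarith)
  -- The register starts at `(|g|, |g|)`; subtracting the parabola in the second coordinate yields
  -- `sqApprox`.
  obtain ⟨u, hu⟩ := h1.parabola hB m (c := -1) (by norm_num)
  rw [show L + (3 * m + 4) = L + 3 + 3 * m + 1 by ring]
  refine ((hu.snd (by linarith)).mono le_rfl ?_ le_rfl).congr fun x i => ?_
  rotate_left
  · have : max (g x) 0 + max (-g x) 0 = |g x| := by
      rcases le_total (g x) 0 with h | h
      · rw [max_eq_right h, max_eq_left (by linarith), abs_of_nonpos h]; ring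
      · rw [max_eq_left h, max_eq_right (by linarith), abs_of_nonneg h]; ring
    simp [dotProduct, relu, this, sqApprox, sub_eq_add_neg]
  · simp only [Fintype.card_fin, Fintype.card_unit]; omega

lemma ScalarNet.sq (hB : 4 ≤ B) (m : ℕ) {g : (Fin d → ℝ) → ℝ} (h : ScalarNet B K g) :
    ScalarNet B (3 * K + 112 + 88 * m) (fun x => sqApprox m (g x)) := by
  obtain ⟨L, S, s, h, h1, h2, h3⟩ := h
  exact ⟨_, _, _, h.sq hB m, by omega, by omega, by omega⟩

/-- The approximation of the squared sine of an affine function. -/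
lemma ScalarNet.sinSq (hB : 4 ≤ B) (n m : ℕ) (a : Fin d → ℝ) (b : ℝ) (ha : ∀ j, |a j| ≤ B)
    (hb : |b| ≤ B) :
    ScalarNet B (20 * (d + 1) + 150 + 88 * m + n * (90 + 88 * m))
      (fun x => sinSqApprox n m (a ⬝ᵥ x + b)) := by
  have h2n : (1 : ℝ) ≤ 2 ^ n := one_le_pow₀ (by norm_num)
  have hdiv : ∀ z : ℝ, |z| ≤ B → |z / 2 ^ n| ≤ B := by
    intro z hz
    rw [abs_div, abs_of_pos (by positivity : (0 : ℝ) < 2 ^ n)]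
    exact (div_le_self (abs_nonneg z) h2n).trans hz
  have h1 := (NetFun.affine_input (by linarith) (Matrix.of fun (_ : Unit) j => a j / 2 ^ n)
    (fun _ => b / 2 ^ n) ⟨fun _ j => hdiv _ (ha j), fun _ => hdiv _ hb⟩).mono (le_refl B) le_rfl
    (Nat.mul_le_mul_left 2 (weightCount_le_card _ _))
  have h2 : (fun x : Fin d → ℝ => (Matrix.of fun (_ : Unit) j => a j / 2 ^ n).mulVec x +
      (fun _ => b / 2 ^ n)) = fun x (_ : Unit) => (a ⬝ᵥ x + b) / 2 ^ n := by
    ext x i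
    simp only [Matrix.mulVec, dotProduct, Matrix.of_apply, Pi.add_apply, add_div, Finset.sum_div]
    congr 1
    exact Finset.sum_congr rfl fun j _ => by ring
  rw [h2] at h1
  refine ⟨_, _, _, (h1.sq hB m).logistic_iterate hB m n, ?_, ?_, by omega⟩
  · have : n * (3 * m + 2) ≤ n * (90 + 88 * m) := Nat.mul_le_mul_left _ (by omega)
    omega
  · simp only [Fintype.card_fin, Fintype.card_unit]
    omega

/-- The approximate product of two realized functions. -/
lemma ScalarNet.mul {D : ℝ} (hD : 1 ≤ D) (hDB : D ≤ B) (hB : 4 ≤ B) (m : ℕ)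
    {f g : (Fin d → ℝ) → ℝ} (hf : ScalarNet B K f) (hg : ScalarNet B K g) :
    ScalarNet B (40 * (3 * (40 * K + 80) + 112 + 88 * m) + 80)
      (fun x => mulApprox m D (f x) (g x)) := by
  have hfg : ∀ i, ScalarNet B K ((![f, g] : Fin 2 → (Fin d → ℝ) → ℝ) i) := by
    intro i; fin_cases i
    · exact hf
    · exact hg
  have hD2 : |1 / D / 2| ≤ B := by
    rw [abs_of_pos (by positivity)]
    have : 1 / D ≤ 1 := (div_le_one₀ (by linarith)).2 hD
    linarith
  -- The two arguments of the polarization formula are the cases `σ = 1` and `σ = -1`.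
  have hlin : ∀ σ : ℝ, |σ| ≤ 1 →
      ScalarNet B (40 * K + 80) (fun x => (f x / D + σ * g x) / 2) := by
    intro σ hσ
    have hσ' := abs_le.1 hσ
    have h := ScalarNet.shallow (by linarith) (by norm_num) (by norm_num) hfg
      (!![1 / D / 2, σ / 2; -(1 / D / 2), -(σ / 2)] : Matrix (Fin 2) (Fin 2) ℝ) 0 (by
        refine ⟨fun i j => ?_, fun i => ?_⟩
        · fin_cases i <;> fin_cases j
          · exact hD2
          · change |σ / 2| ≤ B
            rw [abs_le]; constructor <;> linarith
          · change |-(1 / D / 2)| ≤ B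
            rwa [abs_neg]
          · change |-(σ / 2)| ≤ B
            rw [abs_le]; constructor <;> linarith
        · simp; linarith)
      (Matrix.of fun _ => ![1, -1] : Matrix Unit (Fin 2) ℝ) 0 (by
        refine ⟨fun i j => ?_, fun i => ?_⟩
        · fin_cases j <;> simp <;> linarith
        · simp; linarith)
    refine h.congr fun x => ?_
    simp only [Matrix.mulVec, dotProduct, Fin.sum_univ_two, relu, Matrix.of_apply, Pi.add_apply,
      Pi.zero_apply, Matrix.cons_val_zero, Matrix.cons_val_one, Matrix.cons_val', add_zero,
      Matrix.cons_val_fin_one]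
    rw [show -(1 / D / 2) * f x + -(σ / 2) * g x = -(1 / D / 2 * f x + σ / 2 * g x) by ring]
    have hmm : ∀ z : ℝ, 1 * max z 0 + -1 * max (-z) 0 = z := by
      intro z
      rcases le_total z 0 with h | h
      · rw [max_eq_right h, max_eq_left (by linarith)]; ring
      · rw [max_eq_left h, max_eq_right (by linarith)]; ring
    rw [hmm]; ring
  have h1 := (hlin 1 (by simp)).sq hB m
  have h2 := (hlin (-1) (by simp)).sq hB m
  have h12 : ∀ i, ScalarNet B (3 * (40 * K + 80) + 112 + 88 * m)
      ((![fun x => sqApprox m ((f x / D + 1 * g x) / 2),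
        fun x => sqApprox m ((f x / D + (-1) * g x) / 2)] : Fin 2 → (Fin d → ℝ) → ℝ) i) := by
    intro i; fin_cases i
    · exact h1
    · exact h2
  have h := ScalarNet.shallow (by linarith) (by norm_num) (by norm_num) h12
    (!![1, 0; -1, 0; 0, 1; 0, -1] : Matrix (Fin 4) (Fin 2) ℝ) 0 (by
      refine ⟨fun i j => ?_, fun i => ?_⟩
      · fin_cases i <;> fin_cases j <;> simp <;> linarith
      · simp; linarith)
    (Matrix.of fun _ => ![D, -D, -D, D] : Matrix Unit (Fin 4) ℝ) 0 (by
      refine ⟨fun i j => ?_, fun i => ?_⟩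
      · fin_cases j <;> simp [abs_of_pos (by linarith : 0 < D), hDB]
      · simp; linarith)
  refine h.congr fun x => ?_
  have hmm : ∀ z : ℝ, max z 0 = z + max (-z) 0 := by
    intro z
    rcases le_total z 0 with h | h
    · rw [max_eq_right h, max_eq_left (by linarith)]; ring
    · rw [max_eq_left h, max_eq_right (by linarith)]; ring
  simp [Matrix.mulVec, dotProduct, Fin.sum_univ_succ, relu, mulApprox, ← sub_eq_add_neg]
  rw [hmm (sqApprox m ((f x / D + g x) / 2)), hmm (sqApprox m ((f x / D - g x) / 2))]
  ring

lemma ScalarNet.truncate (hB : 4 ≤ B) {p f : (Fin d → ℝ) → ℝ} (hp : ScalarNet B K p)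
    (hf : ScalarNet B K f) :
    ScalarNet B (40 * K + 80) (fun x => truncate (p x) (f x)) := by
  have hfg : ∀ i, ScalarNet B K ((![f, p] : Fin 2 → (Fin d → ℝ) → ℝ) i) := by
    intro i; fin_cases i
    · exact hf
    · exact hp
  have h := ScalarNet.shallow (by linarith) (by norm_num) (by norm_num) hfg
    (!![1, 1; 1, -1; 0, 1] : Matrix (Fin 3) (Fin 2) ℝ) 0 (by
      refine ⟨fun i j => ?_, fun i => ?_⟩
      · fin_cases i <;> fin_cases j <;> simp <;> linarith
      · simp; linarith)
    (Matrix.of fun _ => ![1, -1, -1] : Matrix Unit (Fin 3) ℝ) 0 (by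
      refine ⟨fun i j => ?_, fun i => ?_⟩
      · fin_cases j <;> simp <;> linarith
      · simp; linarith)
  refine h.congr fun x => ?_
  simp [Matrix.mulVec, dotProduct, Fin.sum_univ_succ, relu, _root_.truncate, ← sub_eq_add_neg]
  ring

/-- `D` on the cube with centre `c` and side length `2 R`, and `0` outside a slightly larger
cube. -/
noncomputable def bump (D R : ℝ) (c t : Fin d → ℝ) : ℝ :=
  D * max (1 - ∑ j, (max (t j - c j - R) 0 + max (c j - t j - R) 0)) 0

lemma ScalarNet.bump {D R : ℝ} (hB : 1 ≤ B) (hD : |D| ≤ B) (c : Fin d → ℝ)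
    (hc : ∀ j, |c j| + |R| ≤ B) :
    ScalarNet B (100 * (d + 1) ^ 2) (fun t => bump D R c t) := by
  have h1 := NetFun.affine_input hB (1 : Matrix (Fin d) (Fin d) ℝ) 0 (weightsLE_one hB)
  have h2 := h1.shallow hB (Matrix.fromRows 1 (-1)) (Sum.elim (fun j => -c j - R)
    (fun j => c j - R)) (by
      refine ⟨?_, ?_⟩
      · rintro (i | i) j
        · simpa using (weightsLE_one hB).1 i j
        · simpa using (weightsLE_one hB).1 i j
      · rintro (i | i)
        · have := hc i
          simp only [Sum.elim_inl]
          exact (abs_sub _ _).trans (by rwa [abs_neg])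
        · have := hc i
          simp only [Sum.elim_inr]
          exact (abs_sub _ _).trans this)
    (Matrix.of fun (_ : Unit) _ => -1) (fun _ => 1) ⟨fun _ _ => by simpa using hB,
      fun _ => by simpa using hB⟩
  have h3 := (h2.relu_comp hB).affine (Matrix.of fun (_ : Unit) (_ : Unit) => D) 0
    ⟨fun _ _ => by simpa using hD, fun _ => by simp; linarith⟩
  have hd2 : (d + 1) ^ 2 = d * d + 2 * d + 1 := by ring
  refine (h3.scalarNet (K := 100 * (d + 1) ^ 2) ?_ ?_ ?_).congr fun t => ?_
  rotate_left 3
  · have e1 : ∀ j, t j + (-c j - R) = t j - c j - R := fun j => by ring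
    have e2 : ∀ j, -t j + (c j - R) = c j - t j - R := fun j => by ring
    simp only [Matrix.mulVec, dotProduct, relu, _root_.bump, Fintype.sum_sum_type, Matrix.of_apply,
      Pi.add_apply, Matrix.fromRows_apply_inl, Matrix.fromRows_apply_inr, Sum.elim_inl,
      Sum.elim_inr, Matrix.neg_apply, Matrix.one_apply, Finset.sum_add_distrib]
    simp [e1, e2]
    left
    congr 1
    ring
  · omega
  · rw [weightCount_one]
    simp only [Fintype.card_sum, Fintype.card_fin, Fintype.card_unit]
    nlinarith
  · refine (Nat.mul_le_mul_left 2 (weightCount_le_card _ _)).trans ?_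
    simp only [Fintype.card_unit]
    omega

/-- A network applied to a translate of the argument. -/
lemma ScalarNet.net_translate (hB : 1 ≤ B) (hd : 0 < d) {Φ : ReLUNet d 1} (hΦ : Φ.Nondegenerate)
    (hΦB : (Φ.weightMagnitude : ℝ) ≤ B) (x : Fin d → ℝ) (hx : ∀ j, |x j| ≤ B) :
    ScalarNet B (10 * (d + 1) ^ 2 + 7 * Φ.connectivity)
      (fun t => realOut (Φ.realize (t - x))) := by
  have h1 := (NetFun.affine_input hB (1 : Matrix (Fin d) (Fin d) ℝ) (-x)
    ⟨(weightsLE_one hB).1, fun j => by simpa using hx j⟩).mono (le_refl B) le_rfl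
    (Nat.mul_le_mul_left 2 (weightCount_le_card _ _))
  have h2 := h1.comp_net hB Φ hΦB
  have hw := hΦ.width_le_connectivity
  have hdep := hΦ.depth_le_connectivity hd
  refine (h2.scalarNet (K := 10 * (d + 1) ^ 2 + 7 * Φ.connectivity) ?_ ?_ ?_).congr fun t => ?_
  rotate_left 3
  · simp [realOut, sub_eq_add_neg]
  · omega
  · simp only [Fintype.card_fin]
    nlinarith
  · omega

end Elementary

/-! ### Networks for Gabor atoms -/

section Atom

variable {d : ℕ} {B : ℝ} {K : ℕ}

/-- Scalar functions form the components of a non-degenerate network. -/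
lemma exists_reluNet_of_scalarNet (hB : 1 ≤ B) {n : ℕ} (hn : 0 < n) (hn2 : n ≤ 2)
    {f : Fin n → (Fin d → ℝ) → ℝ} (h : ∀ i, ScalarNet B K (f i)) :
    ∃ Φ ∈ reluNets d n, (∀ x, Φ.realize x = fun i => f i x) ∧ (Φ.weightMagnitude : ℝ) ≤ B ∧
      Φ.connectivity ≤ 50 * K + 2 * d + 60 := by
  have hs : NetFun B K (18 * K) (2 * (K + 2)) (fun x i => f i x) := by
    have h1 : ∀ i, NetFun B K (9 * K) (K + 2) (fun x (_ : Unit) => f i x) := by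
      intro i
      obtain ⟨L, S, s, h, h1, h2, h3⟩ := h i
      refine (h.pad hB h1).mono le_rfl ?_ ?_
      · simp only [Fintype.card_unit]; omega
      · simp only [Fintype.card_unit]; omega
    refine (NetFun.stack (by linarith) h1).mono le_rfl ?_ ?_
    · simp only [Finset.sum_const, Finset.card_univ, Fintype.card_fin, smul_eq_mul]; nlinarith
    · simp only [Finset.sum_const, Finset.card_univ, Fintype.card_fin, smul_eq_mul]; nlinarith
  obtain ⟨Φ, hΦ, hr, hw, -, hc⟩ := hs.exists_reluNet hB hn
  refine ⟨Φ, hΦ, hr, hw, ?_⟩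
  have : n * (2 * n + 3) ≤ 2 * 7 := Nat.mul_le_mul hn2 (by omega)
  omega

lemma bump_nonneg {D R : ℝ} (hD : 0 ≤ D) (c t : Fin d → ℝ) : 0 ≤ bump D R c t :=
  mul_nonneg hD (le_max_right _ _)

lemma bump_eq_of_norm_le {D R : ℝ} {c t : Fin d → ℝ} (h : ‖t - c‖ ≤ R) : bump D R c t = D := by
  have h1 : ∀ j, |t j - c j| ≤ R := fun j => (norm_le_pi_norm (t - c) j).trans h
  have h2 : ∑ j, (max (t j - c j - R) 0 + max (c j - t j - R) 0) = 0 := by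
    refine Finset.sum_eq_zero fun j _ => ?_
    have := abs_le.1 (h1 j)
    rw [max_eq_right (by linarith), max_eq_right (by linarith), add_zero]
  rw [bump, h2]
  simp

/-- One coordinate exceeds `R` by more than 1, and the corresponding summand alone brings the outer
argument below zero. -/
lemma bump_eq_zero_of_lt {D R : ℝ} (hR : 0 ≤ R) {c t : Fin d → ℝ} (h : R + 1 < ‖t - c‖) :
    bump D R c t = 0 := by
  obtain ⟨j, hj⟩ : ∃ j, R + 1 < |t j - c j| := by
    by_contra! hcon
    exact absurd h (not_lt.2 ((pi_norm_le_iff_of_nonneg (by linarith)).2 hcon))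
  have h1 : max (t j - c j - R) 0 + max (c j - t j - R) 0 ≤
      ∑ j, (max (t j - c j - R) 0 + max (c j - t j - R) 0) :=
    Finset.single_le_sum (f := fun j => max (t j - c j - R) 0 + max (c j - t j - R) 0)
      (fun i _ => add_nonneg (le_max_right _ _) (le_max_right _ _)) (Finset.mem_univ j)
  have h2 : 1 ≤ max (t j - c j - R) 0 + max (c j - t j - R) 0 := by
    rcases lt_abs.1 hj with h | h
    · linarith [le_max_left (t j - c j - R) 0, le_max_right (c j - t j - R) 0]
    · linarith [le_max_left (c j - t j - R) 0, le_max_right (t j - c j - R) 0]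
  rw [bump, max_eq_right (by linarith), mul_zero]

/-- The approximation of `t ↦ cos (2 (⟨a, t⟩ + b)) g (t - x)`, when `Φ` approximates `g`. -/
noncomputable def atomApprox (n : ℕ) (D R : ℝ) (c x a : Fin d → ℝ) (b : ℝ) (Φ : ReLUNet d 1)
    (t : Fin d → ℝ) : ℝ :=
  truncate (bump D R c t) (mulApprox (2 * n + 3) D (realOut (Φ.realize (t - x)))
    (1 - 2 * sinSqApprox n (2 * n + 3) (a ⬝ᵥ t + b)))

/-- The size is quadratic in `n` because `n` logistic steps each use `2 n + 3` tent maps; all other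
constituents are linear in `n`, quadratic in `d` or linear in the connectivity of `Φ`. The constant
is a crude bound for the nested overheads. -/
lemma ScalarNet.atomApprox (hd : 0 < d) (n : ℕ) {D R : ℝ} {c x a : Fin d → ℝ} {b : ℝ}
    {Φ : ReLUNet d 1} (hΦ : Φ.Nondegenerate) (hB : 4 ≤ B) (hD : 1 ≤ D) (hDB : D ≤ B)
    (hΦB : (Φ.weightMagnitude : ℝ) ≤ B) (hx : ∀ j, |x j| ≤ B) (ha : ∀ j, |a j| ≤ B) (hb : |b| ≤ B)
    (hc : ∀ j, |c j| + |R| ≤ B) :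
    ScalarNet B (10 ^ 10 * ((d + 1) ^ 2 + (n + 1) ^ 2 + Φ.connectivity))
      (atomApprox n D R c x a b Φ) := by
  set m := 2 * n + 3 with hm
  have h1 := ScalarNet.sinSq hB n m a b ha hb
  have h2 : ScalarNet B (40 * (20 * (d + 1) + 150 + 88 * m + n * (90 + 88 * m)) + 80)
      (fun t => 1 - 2 * sinSqApprox n m (a ⬝ᵥ t + b)) := by
    have := ScalarNet.shallow (B := B) (by linarith) (n := 1) (k := 2) (by norm_num) (by norm_num)
      (fun _ => h1) (!![1; -1] : Matrix (Fin 2) (Fin 1) ℝ) 0 (by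
        refine ⟨fun i j => ?_, fun i => ?_⟩
        · fin_cases i <;> fin_cases j <;> simp <;> linarith
        · simp; linarith)
      (Matrix.of fun _ => ![-2, 2] : Matrix Unit (Fin 2) ℝ) (fun _ => 1) (by
        refine ⟨fun i j => ?_, fun i => ?_⟩
        · fin_cases j <;> simp <;> linarith
        · simp; linarith)
    refine this.congr fun t => ?_
    have hmm : ∀ z : ℝ, max z 0 = z + max (-z) 0 := by
      intro z
      rcases le_total z 0 with h | h
      · rw [max_eq_right h, max_eq_left (by linarith)]; ring
      · rw [max_eq_left h, max_eq_right (by linarith)]; ring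
    simp [Matrix.mulVec, dotProduct, relu]
    rw [hmm (sinSqApprox _ _ _)]
    ring
  have h3 := ScalarNet.net_translate (B := B) (by linarith) hd hΦ hΦB x hx
  have h4 := ScalarNet.mul hD hDB hB m (h3.mono le_rfl (Nat.le_add_right _
    (40 * (20 * (d + 1) + 150 + 88 * m + n * (90 + 88 * m)) + 80)))
    (h2.mono le_rfl (Nat.le_add_left _ _))
  have h5 := ScalarNet.bump (B := B) (by linarith) (D := D) (R := R)
    (by rwa [abs_of_pos (by linarith)]) c hc
  have h6 := ScalarNet.truncate hB (h5.mono le_rfl (Nat.le_add_right _ _))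
    (h4.mono le_rfl (Nat.le_add_left _ _))
  refine h6.mono le_rfl ?_
  have e1 : (d + 1) ^ 2 = d * d + 2 * d + 1 := by ring
  have e2 : (n + 1) ^ 2 = n * n + 2 * n + 1 := by ring
  have e3 : n * (90 + 88 * m) = 176 * (n * n) + 354 * n := by rw [hm]; ring
  rw [e1, e2, e3, hm]
  omega

/-- The target is bounded by the bump function, so truncation cannot increase the error. What
remains is the error of the product, the error of the cosine times `D`, and the error `ε` of the
window. The margin in `|y| ≤ D - 1` together with `ε ≤ 1` keeps the network output within the range
`D` of the approximate product. -/
lemma atomApprox_error {n : ℕ} {D R Θ ε : ℝ} {c x a : Fin d → ℝ} {b : ℝ} {Φ : ReLUNet d 1}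
    {t : Fin d → ℝ} {y : ℝ} (hD : 1 ≤ D) (hy : |y| ≤ D - 1) (hε : ε ≤ 1)
    (hΦ : |y - realOut (Φ.realize (t - x))| ≤ ε) (hΘ : |a ⬝ᵥ t + b| ≤ Θ) (hn : Θ ^ 4 + 1 ≤ 2 ^ n)
    (hΘ1 : 1 ≤ Θ) (hR : ‖t - c‖ ≤ R ∨ y = 0) :
    |atomApprox n D R c x a b Φ t - Real.cos (2 * (a ⬝ᵥ t + b)) * y| ≤
      3 * D * (Θ ^ 4 + 1) / 4 ^ n + ε := by
  set θ := a ⬝ᵥ t + b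
  set u := realOut (Φ.realize (t - x))
  have hΘn : Θ ≤ 2 ^ n := by
    have : Θ ≤ Θ ^ 4 := le_self_pow₀ hΘ1 (by norm_num)
    linarith
  obtain ⟨⟨h0, h1⟩, h2⟩ := sinSqApprox_mem_and_error n (hΘ.trans hΘn)
  set σ := sinSqApprox n (2 * n + 3) θ
  have hcos : Real.cos (2 * θ) = 1 - 2 * Real.sin θ ^ 2 := by
    rw [Real.cos_two_mul]; linarith [Real.sin_sq_add_cos_sq θ]
  have hcos1 := Real.abs_cos_le_one (2 * θ)
  have hp : |Real.cos (2 * θ) * y| ≤ bump D R c t := by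
    rcases hR with h | h
    · rw [bump_eq_of_norm_le h, abs_mul]
      calc _ ≤ 1 * |y| := mul_le_mul_of_nonneg_right hcos1 (abs_nonneg _)
        _ ≤ D := by linarith
    · rw [h, mul_zero, abs_zero]; exact bump_nonneg (by linarith) _ _
  refine (abs_truncate_sub_le hp).trans ?_
  have hu : |u| ≤ D := by
    have := abs_sub_abs_le_abs_sub u y
    rw [abs_sub_comm] at this
    linarith
  have hv : |1 - 2 * σ| ≤ 1 := by rw [abs_le]; constructor <;> linarith
  have h3 := mulApprox_error (2 * n + 3) (by linarith) hu hv
  have h4 : |u * (1 - 2 * σ) - u * Real.cos (2 * θ)| ≤ D * (2 * ((Θ ^ 4 + 1) / 4 ^ n)) := by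
    rw [← mul_sub, abs_mul]
    refine mul_le_mul hu ?_ (abs_nonneg _) (by linarith)
    rw [hcos, show 1 - 2 * σ - (1 - 2 * Real.sin θ ^ 2) = -(2 * (σ - Real.sin θ ^ 2)) by ring,
      abs_neg, abs_mul, abs_of_pos (by norm_num : (0 : ℝ) < 2)]
    refine mul_le_mul_of_nonneg_left (h2.trans ?_) (by norm_num)
    have : θ ^ 4 ≤ Θ ^ 4 := by
      rw [← Even.pow_abs (by decide : Even 4) θ]
      exact pow_le_pow_left₀ (abs_nonneg _) hΘ 4
    gcongr
  have h5 : |u * Real.cos (2 * θ) - Real.cos (2 * θ) * y| ≤ ε := by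
    rw [show u * Real.cos (2 * θ) - Real.cos (2 * θ) * y = Real.cos (2 * θ) * (u - y) by ring,
      abs_mul, abs_sub_comm]
    calc _ ≤ 1 * |y - u| := mul_le_mul_of_nonneg_right hcos1 (abs_nonneg _)
      _ ≤ ε := by linarith
  have h6 : D * (1 / 4) ^ (2 * n + 3) ≤ D * ((Θ ^ 4 + 1) / 4 ^ n) := by
    refine mul_le_mul_of_nonneg_left ?_ (by linarith)
    calc ((1 : ℝ) / 4) ^ (2 * n + 3) ≤ (1 / 4) ^ n :=
          pow_le_pow_of_le_one (by norm_num) (by norm_num) (by omega)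
      _ = 1 / 4 ^ n := by rw [one_div_pow]
      _ ≤ _ := by gcongr; linarith [show 0 ≤ Θ ^ 4 by positivity]
  have h7 : 3 * D * (Θ ^ 4 + 1) / 4 ^ n =
      D * ((Θ ^ 4 + 1) / 4 ^ n) + D * (2 * ((Θ ^ 4 + 1) / 4 ^ n)) := by ring
  rw [h7]
  calc _ ≤ |mulApprox (2 * n + 3) D u (1 - 2 * σ) - u * (1 - 2 * σ)| +
        |u * (1 - 2 * σ) - Real.cos (2 * θ) * y| := abs_sub_le _ _ _
    _ ≤ _ := by
      have := abs_sub_le (u * (1 - 2 * σ)) (u * Real.cos (2 * θ)) (Real.cos (2 * θ) * y)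
      linarith

/-- A sine is a cosine shifted by `π / 2`, so both components are instances of one real function,
with offsets `0` and `-π / 4`. -/
lemma gaborAtom_eq (g : (Fin d → ℝ) → ℝ) (x ξ t : Fin d → ℝ) :
    gaborAtom g x ξ t = ⟨Real.cos (2 * ((Real.pi • ξ) ⬝ᵥ t + 0)) * g (t - x),
      Real.cos (2 * ((Real.pi • ξ) ⬝ᵥ t + (-Real.pi / 4))) * g (t - x)⟩ := by
  have h : 2 * (Real.pi : ℂ) * Complex.I * ((ξ ⬝ᵥ t : ℝ) : ℂ) =
      ((2 * (Real.pi * (ξ ⬝ᵥ t)) : ℝ) : ℂ) * Complex.I := by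
    push_cast; ring
  have h2 : 2 * ((Real.pi • ξ) ⬝ᵥ t + (-Real.pi / 4)) = 2 * (Real.pi * (ξ ⬝ᵥ t)) - Real.pi / 2 := by
    rw [smul_dotProduct, smul_eq_mul]; ring
  rw [gaborAtom, h, h2, Real.cos_sub_pi_div_two, add_zero, smul_dotProduct, smul_eq_mul]
  apply Complex.ext
  · rw [Complex.re_mul_ofReal, Complex.exp_ofReal_mul_I_re]
  · rw [Complex.im_mul_ofReal, Complex.exp_ofReal_mul_I_im]

lemma abs_dotProduct_le (a t : Fin d → ℝ) : |a ⬝ᵥ t| ≤ d * (‖a‖ * ‖t‖) := by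
  calc |a ⬝ᵥ t| ≤ ∑ j, |a j * t j| := Finset.abs_sum_le_sum_abs _ _
    _ ≤ ∑ _j : Fin d, ‖a‖ * ‖t‖ := by
      refine Finset.sum_le_sum fun j _ => ?_
      rw [abs_mul]
      exact mul_le_mul (norm_le_pi_norm a j) (norm_le_pi_norm t j) (abs_nonneg _) (norm_nonneg _)
    _ = _ := by simp

/-- The centre may depend on the atom, but by translation invariance the volume of the ball does
not; this makes the final constants uniform in `x`. -/
lemma eLpNorm_le_of_bound_on_closedBall {Ω : Set (Fin d → ℝ)} {h : (Fin d → ℝ) → ℂ} {η r : ℝ}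
    (c : Fin d → ℝ) (hη : 0 ≤ η)
    (hh : ∀ᵐ t ∂(volume.restrict Ω), ‖h t‖ ≤ η ∧ (r < ‖t - c‖ → h t = 0)) :
    eLpNorm h 2 (volume.restrict Ω) ≤
      ENNReal.ofReal η * volume (Metric.closedBall (0 : Fin d → ℝ) r) ^ (1 / 2 : ℝ) := by
  calc eLpNorm h 2 (volume.restrict Ω)
      ≤ eLpNorm ((Metric.closedBall c r).indicator fun _ => η) 2 (volume.restrict Ω) := by
        refine eLpNorm_mono_ae_real ?_
        filter_upwards [hh] with t ht
        by_cases h' : t ∈ Metric.closedBall c r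
        · rw [indicator_of_mem h']; exact ht.1
        · rw [indicator_of_notMem h', ht.2 (by simpa [dist_eq_norm] using h'), norm_zero]
    _ ≤ eLpNorm ((Metric.closedBall c r).indicator fun _ => η) 2 volume :=
        eLpNorm_mono_measure _ Measure.restrict_le_self
    _ = _ := by
        rw [eLpNorm_indicator_const Metric.isClosed_closedBall.measurableSet (by simp) (by simp),
          Real.enorm_eq_ofReal hη, Measure.addHaar_closedBall_center]
        simp

/-- Networks for the Gabor atom `M_ξ T_x g`, from a network approximating `g` near `-x + Ω`. -/
lemma exists_gaborAtom_net (hd : 0 < d) {Ω : Set (Fin d → ℝ)} {g : (Fin d → ℝ) → ℝ}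
    {D R Θ ε : ℝ} (n : ℕ) (hD : 1 ≤ D) (hR : 0 ≤ R) {x ξ c : Fin d → ℝ} (hc : ‖c‖ ≤ ‖x‖)
    {Φ : ReLUNet d 1} (hΦ : Φ ∈ reluNets d 1)
    (hae : ∀ᵐ t ∂(volume.restrict Ω), |g (t - x)| ≤ D - 1 ∧ (‖t - c‖ ≤ R ∨ g (t - x) = 0) ∧
      |g (t - x) - realOut (Φ.realize (t - x))| ≤ ε) (hε0 : 0 ≤ ε) (hε : ε ≤ 1)
    (hΘ : Real.pi * (d * (‖ξ‖ * (‖x‖ + R + 1))) + 1 ≤ Θ) (hn : Θ ^ 4 + 1 ≤ 2 ^ n)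
    (hB : 4 ≤ B) (hDB : D ≤ B) (hΦB : (Φ.weightMagnitude : ℝ) ≤ B) (hxB : ‖x‖ + R ≤ B)
    (hξB : Real.pi * ‖ξ‖ ≤ B) :
    ∃ Ψ ∈ reluNets d 2, (Ψ.weightMagnitude : ℝ) ≤ B ∧
      Ψ.connectivity ≤ 10 ^ 12 * ((d + 1) ^ 2 + (n + 1) ^ 2 + Φ.connectivity) ∧
      ∀ f : L2 ℂ Ω, f =ᵐ[volume.restrict Ω] gaborAtom g x ξ → netDist complexOut f Ψ ≤
        ENNReal.ofReal (2 * (3 * D * (Θ ^ 4 + 1) / 4 ^ n + ε)) *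
          volume (Metric.closedBall (0 : Fin d → ℝ) (R + 1)) ^ (1 / 2 : ℝ) := by
  have hpi := Real.pi_gt_three
  have hpi4 := Real.pi_le_four
  let b : Fin 2 → ℝ := ![0, -Real.pi / 4]
  have hb : ∀ k, |b k| ≤ 1 := by
    intro k
    fin_cases k
    · simp [b]
    · simp only [b, Fin.mk_one, Matrix.cons_val_one, Matrix.cons_val_fin_one]
      rw [abs_le]; constructor <;> linarith
  have hnet : ∀ k, ScalarNet B (10 ^ 10 * ((d + 1) ^ 2 + (n + 1) ^ 2 + Φ.connectivity))
      (atomApprox n D R c x (Real.pi • ξ) (b k) Φ) := by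
    intro k
    refine ScalarNet.atomApprox hd n hΦ hB hD hDB hΦB (fun j => ?_) (fun j => ?_)
      ((hb k).trans (by linarith)) (fun j => ?_)
    · exact (norm_le_pi_norm x j).trans (by linarith)
    · have := norm_le_pi_norm ξ j
      rw [Pi.smul_apply, smul_eq_mul, abs_mul, abs_of_pos Real.pi_pos]
      exact (mul_le_mul_of_nonneg_left this Real.pi_pos.le).trans hξB
    · rw [abs_of_nonneg hR]
      have : |c j| ≤ ‖c‖ := norm_le_pi_norm c j
      linarith
  obtain ⟨Ψ, hΨ, hr, hw, hconn⟩ := exists_reluNet_of_scalarNet (by linarith) two_pos le_rfl hnet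
  refine ⟨Ψ, hΨ, hw, hconn.trans ?_, fun f hf => ?_⟩
  · have e1 : (d + 1) ^ 2 = d * d + 2 * d + 1 := by ring
    rw [e1]
    omega
  have hΘ1 : 1 ≤ Θ := by
    have : 0 ≤ Real.pi * (d * (‖ξ‖ * (‖x‖ + R + 1))) := by positivity
    linarith
  refine eLpNorm_le_of_bound_on_closedBall c (by positivity) ?_
  filter_upwards [hf, hae] with t hft ⟨h1, h2, h3⟩
  rw [hft, gaborAtom_eq, hr]
  -- Inside the ball the phase is bounded by `Θ` and the error estimate applies; outside, the atom
  -- and the truncated network vanish exactly.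
  by_cases hball : ‖t - c‖ ≤ R + 1
  · refine ⟨?_, fun h => absurd hball (not_le.2 h)⟩
    have ht : ‖t‖ ≤ ‖x‖ + R + 1 := by
      have := norm_sub_norm_le t c
      linarith
    have hθ : ∀ k, |(Real.pi • ξ) ⬝ᵥ t + b k| ≤ Θ := by
      intro k
      refine (abs_add_le _ _).trans (le_trans (add_le_add ?_ (hb k)) hΘ)
      rw [smul_dotProduct, smul_eq_mul, abs_mul, abs_of_pos Real.pi_pos]
      refine mul_le_mul_of_nonneg_left ((abs_dotProduct_le ξ t).trans ?_) Real.pi_pos.le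
      gcongr
    have herr := fun k => atomApprox_error (D := D) (R := R) (c := c) hD h1 hε h3 (hθ k) hn hΘ1 h2
    have e0 := herr 0
    have e1 := herr 1
    simp only [b, Matrix.cons_val_zero, Matrix.cons_val_one, Matrix.cons_val_fin_one] at e0 e1
    rw [abs_sub_comm] at e0 e1
    refine (Complex.norm_le_abs_re_add_abs_im _).trans ?_
    simp only [complexOut, Complex.sub_re, Complex.sub_im, b, Matrix.cons_val_zero,
      Matrix.cons_val_one, Matrix.cons_val_fin_one]
    linarith
  · push Not at hball
    have hy : g (t - x) = 0 := h2.resolve_left (by linarith)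
    have hz : ∀ k, atomApprox n D R c x (Real.pi • ξ) (b k) Φ t = 0 := fun k => by
      rw [atomApprox, bump_eq_zero_of_lt hR hball, truncate_zero]
    have : (⟨Real.cos (2 * ((Real.pi • ξ) ⬝ᵥ t + 0)) * g (t - x),
        Real.cos (2 * ((Real.pi • ξ) ⬝ᵥ t + (-Real.pi / 4))) * g (t - x)⟩ : ℂ) -
        complexOut (fun i => atomApprox n D R c x (Real.pi • ξ) (b i) Φ t) = 0 := by
      apply Complex.ext <;> simp [complexOut, hz, hy]
    rw [this]
    refine ⟨by simpa using by positivity, fun _ => rfl⟩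

end Atom

/-! ### Polynomially bounded families -/

/-- The family `q` is bounded by a polynomial in the family `T`. -/
def PolyBdd {J : Type*} (T q : J → ℝ) : Prop := ∃ (C : ℝ) (p : ℕ), ∀ j, |q j| ≤ C * T j ^ p

namespace PolyBdd

variable {J : Type*} {T q q₁ q₂ : J → ℝ}

lemma const (c : ℝ) : PolyBdd T (fun _ => c) := ⟨|c|, 0, fun j => by simp⟩

lemma self (hT : ∀ j, 1 ≤ T j) : PolyBdd T T :=
  ⟨1, 1, fun j => by rw [abs_of_nonneg (by linarith [hT j])]; simp⟩

lemma of_abs_le (h : PolyBdd T q) (h' : ∀ j, |q₁ j| ≤ |q j|) : PolyBdd T q₁ := by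
  obtain ⟨C, p, h⟩ := h
  exact ⟨C, p, fun j => (h' j).trans (h j)⟩

lemma of_le (h : PolyBdd T q) (h0 : ∀ j, 0 ≤ q₁ j) (h' : ∀ j, q₁ j ≤ q j) : PolyBdd T q₁ :=
  h.of_abs_le fun j => by rw [abs_of_nonneg (h0 j)]; exact (h' j).trans (le_abs_self _)

/-- The exponent and the constant may be increased. -/
lemma exists_ge (hT : ∀ j, 1 ≤ T j) (h : PolyBdd T q) :
    ∃ (C : ℝ) (p : ℕ), 0 ≤ C ∧ ∀ C' ≥ C, ∀ p' ≥ p, ∀ j, |q j| ≤ C' * T j ^ p' := by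
  obtain ⟨C, p, h⟩ := h
  refine ⟨|C|, p, abs_nonneg _, fun C' hC p' hp j => (h j).trans ?_⟩
  have := hT j
  exact mul_le_mul ((le_abs_self C).trans hC) (pow_le_pow_right₀ this hp) (by positivity)
    ((abs_nonneg C).trans hC)

lemma add (hT : ∀ j, 1 ≤ T j) (h₁ : PolyBdd T q₁) (h₂ : PolyBdd T q₂) :
    PolyBdd T (fun j => q₁ j + q₂ j) := by
  obtain ⟨C₁, p₁, hC₁, h₁⟩ := h₁.exists_ge hT
  obtain ⟨C₂, p₂, hC₂, h₂⟩ := h₂.exists_ge hT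
  refine ⟨C₁ + C₂, p₁ + p₂, fun j => (abs_add_le _ _).trans ?_⟩
  rw [add_mul]
  exact add_le_add (h₁ _ le_rfl _ (by omega) j) (h₂ _ le_rfl _ (by omega) j)

lemma mul (h₁ : PolyBdd T q₁) (h₂ : PolyBdd T q₂) : PolyBdd T (fun j => q₁ j * q₂ j) := by
  obtain ⟨C₁, p₁, h₁⟩ := h₁
  obtain ⟨C₂, p₂, h₂⟩ := h₂
  refine ⟨C₁ * C₂, p₁ + p₂, fun j => ?_⟩
  rw [abs_mul, pow_add, mul_mul_mul_comm]
  exact mul_le_mul (h₁ j) (h₂ j) (abs_nonneg _) ((abs_nonneg _).trans (h₁ j))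

lemma pow (h : PolyBdd T q) (n : ℕ) : PolyBdd T (fun j => q j ^ n) := by
  induction n with
  | zero => simpa using const 1
  | succ n ih => simpa only [pow_succ] using ih.mul h

lemma mvEval (hT : ∀ j, 1 ≤ T j) (h₁ : PolyBdd T q₁) (h₂ : PolyBdd T q₂)
    (π : MvPolynomial (Fin 2) ℝ) :
    PolyBdd T (fun j => MvPolynomial.eval ![q₁ j, q₂ j] π) := by
  induction π using MvPolynomial.induction_on with
  | C a => simpa using const a
  | add p q hp hq => simpa using hp.add hT hq
  | mul_X p i hp =>
    fin_cases i
    · simpa using hp.mul h₁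
    · simpa using hp.mul h₂

lemma eval (hT : ∀ j, 1 ≤ T j) (h : PolyBdd T q) (π : Polynomial ℝ) :
    PolyBdd T (fun j => π.eval (q j)) := by
  induction π using Polynomial.induction_on' with
  | add p q hp hq => simpa using hp.add hT hq
  | monomial n a => simpa using (const a).mul (h.pow n)

/-- The logarithm of a polynomially bounded family is bounded by a polynomial in the logarithm. -/
lemma logb (hT : ∀ j, 2 ≤ T j) (h : PolyBdd T q) (hq : ∀ j, 1 ≤ q j) :
    PolyBdd (fun j => Real.logb 2 (T j)) (fun j => Real.logb 2 (q j)) := by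
  obtain ⟨C, p, hC, h⟩ := h.exists_ge (fun j => by linarith [hT j])
  refine ⟨Real.logb 2 (C + 1) + p, 1, fun j => ?_⟩
  have hTj := hT j
  have h1 : 1 ≤ Real.logb 2 (T j) := by
    rw [Real.le_logb_iff_rpow_le (by norm_num) (by linarith)]; simpa using hTj
  have h2 : 0 ≤ Real.logb 2 (q j) := Real.logb_nonneg (by norm_num) (hq j)
  have h3 : 0 ≤ Real.logb 2 (C + 1) := Real.logb_nonneg (by norm_num) (by linarith)
  rw [abs_of_nonneg h2, pow_one]
  calc Real.logb 2 (q j) ≤ Real.logb 2 ((C + 1) * T j ^ p) := by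
        refine Real.logb_le_logb_of_le (by norm_num) (by linarith [hq j]) ?_
        exact (le_abs_self _).trans (h _ (by linarith) _ le_rfl j)
    _ = Real.logb 2 (C + 1) * 1 + p * Real.logb 2 (T j) := by
        rw [Real.logb_mul (by positivity) (by positivity), Real.logb_pow, mul_one]
    _ ≤ _ := by
        rw [add_mul]
        gcongr

end PolyBdd

lemma one_le_logb_two {T : ℝ} (hT : 2 ≤ T) : 1 ≤ Real.logb 2 T := by
  rw [Real.le_logb_iff_rpow_le (by norm_num) (by linarith)]; simpa using hT

/-! ### Uniform bounds for Gabor atoms -/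

section Uniform

variable {d : ℕ} {Ω : Set (Fin d → ℝ)} {g : (Fin d → ℝ) → ℝ}

lemma ae_sub_of_ae {P : (Fin d → ℝ) → Prop} (x : Fin d → ℝ) (h : ∀ᵐ t, P t) :
    ∀ᵐ t, P (t - x) :=
  (measurePreserving_sub_right volume x).quasiMeasurePreserving.ae h

/-- Unifies the two cases: for bounded `Ω` the centre is `0` and the ball contains `Ω`; for
compactly supported `g` the centre is `x` and the ball contains the translated support. `D` is the
essential supremum of `g` plus 1. -/
lemma exists_ae_localization (hgtop : MemLp g ∞ volume)
    (hcase : Bornology.IsBounded Ω ∨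
      (Ω = univ ∧ ∃ K : Set (Fin d → ℝ), IsCompact K ∧ ∀ᵐ t, t ∉ K → g t = 0)) :
    ∃ R D : ℝ, 0 ≤ R ∧ 1 ≤ D ∧ ∀ x : Fin d → ℝ, ∃ c : Fin d → ℝ, ‖c‖ ≤ ‖x‖ ∧
      ∀ᵐ t ∂(volume.restrict Ω), |g (t - x)| ≤ D - 1 ∧ (‖t - c‖ ≤ R ∨ g (t - x) = 0) := by
  set G := (eLpNormEssSup g volume).toReal
  have hG : ∀ᵐ t, |g t| ≤ G := by
    filter_upwards [ae_le_eLpNormEssSup (f := g) (μ := volume)] with t ht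
    have h2 := hgtop.2
    rw [eLpNorm_exponent_top] at h2
    have := (ENNReal.toReal_le_toReal (by simp) h2.ne).2 ht
    simpa using this
  have hG0 : 0 ≤ G := ENNReal.toReal_nonneg
  rcases hcase with hb | ⟨-, K, hK, hgK⟩
  · obtain ⟨R, hR⟩ := hb.subset_closedBall 0
    refine ⟨max R 0, G + 1, le_max_right _ _, by linarith, fun x => ⟨0, by simp, ?_⟩⟩
    have hmem : ∀ᵐ t ∂(volume.restrict Ω), t ∈ Metric.closedBall (0 : Fin d → ℝ) R :=
      ae_restrict_of_ae_restrict_of_subset hR (ae_restrict_mem Metric.isClosed_closedBall.measurableSet)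
    filter_upwards [ae_restrict_of_ae (ae_sub_of_ae x hG), hmem] with t h1 h2
    refine ⟨by linarith, Or.inl ?_⟩
    rw [sub_zero]
    exact (mem_closedBall_zero_iff.1 h2).trans (le_max_left _ _)
  · obtain ⟨R, hR⟩ := hK.isBounded.subset_closedBall 0
    refine ⟨max R 0, G + 1, le_max_right _ _, by linarith, fun x => ⟨x, le_rfl, ?_⟩⟩
    filter_upwards [ae_restrict_of_ae (ae_sub_of_ae x hG),
      ae_restrict_of_ae (ae_sub_of_ae x hgK)] with t h1 h2
    refine ⟨by linarith, ?_⟩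
    by_cases h : t - x ∈ K
    · exact Or.inl ((mem_closedBall_zero_iff.1 (hR h)).trans (le_max_left _ _))
    · exact Or.inr (h2 h)

lemma ae_abs_sub_le_of_eLpNorm_le (hΩ : MeasurableSet Ω) {h : (Fin d → ℝ) → ℝ} {ε : ℝ}
    (hε : 0 ≤ ε) (x : Fin d → ℝ)
    (hh : eLpNorm h ∞ (volume.restrict ((fun t => -x + t) '' Ω)) ≤ ENNReal.ofReal ε) :
    ∀ᵐ t ∂(volume.restrict Ω), |h (t - x)| ≤ ε := by
  have hm : MeasurableSet ((fun t => -x + t) '' Ω) :=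
    (Homeomorph.addLeft (-x)).measurableEmbedding.measurableSet_image.2 hΩ
  rw [eLpNorm_exponent_top] at hh
  have h1 : ∀ᵐ t ∂(volume.restrict ((fun t => -x + t) '' Ω)), |h t| ≤ ε := by
    filter_upwards [ae_le_eLpNormEssSup (f := h)
      (μ := volume.restrict ((fun t => -x + t) '' Ω))] with t ht
    have := ht.trans hh
    rw [← ofReal_norm, ENNReal.ofReal_le_ofReal_iff hε] at this
    exact this
  rw [ae_restrict_iff' hm] at h1
  rw [ae_restrict_iff' hΩ]
  filter_upwards [ae_sub_of_ae x h1] with t ht htΩ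
  exact ht ⟨t, htΩ, by simp [sub_eq_add_neg, add_comm]⟩

/-- Gabor atoms are approximated by networks, with polynomial bounds that are uniform in the
parameters. -/
lemma exists_uniform_gaborAtom_net (hd : 0 < d) (hΩ : MeasurableSet Ω) (hgtop : MemLp g ∞ volume)
    (hcase : Bornology.IsBounded Ω ∨
      (Ω = univ ∧ ∃ K : Set (Fin d → ℝ), IsCompact K ∧ ∀ᵐ t, t ∉ K → g t = 0))
    (happrox : ∃ π : MvPolynomial (Fin 2) ℝ, ∀ x : Fin d → ℝ, ∀ ε ∈ Ioo (0 : ℝ) (1 / 2),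
      ∃ Φ ∈ reluNets d 1,
        eLpNorm (fun t => g t - realOut (Φ.realize t)) ∞
            (volume.restrict ((fun t => x + t) '' Ω)) ≤ ENNReal.ofReal ε ∧
        (Φ.connectivity : ℝ) ≤ MvPolynomial.eval ![Real.logb 2 ε⁻¹, Real.logb 2 ‖x‖] π ∧
        (Φ.weightMagnitude : ℝ) ≤ MvPolynomial.eval ![ε⁻¹, ‖x‖] π)
    {α : ℝ} (A : ℝ) (hα : 0 < α) :
    ∃ (C : ℝ) (p : ℕ), ∀ (x ξ : Fin d → ℝ) (ε T : ℝ), ε ∈ Ioo (0 : ℝ) (1 / 2) → ε⁻¹ ≤ T →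
      ‖x‖ ≤ A * T → ‖ξ‖ ≤ A * T → (x = 0 ∨ α ≤ ‖x‖) → ∃ Ψ ∈ reluNets d 2,
        (Ψ.connectivity : ℝ) ≤ C * Real.logb 2 T ^ p ∧ (Ψ.weightMagnitude : ℝ) ≤ C * T ^ p ∧
        ∀ f : L2 ℂ Ω, f =ᵐ[volume.restrict Ω] gaborAtom g x ξ →
          netDist complexOut f Ψ ≤ ENNReal.ofReal ε := by
  obtain ⟨π, hπ⟩ := happrox
  obtain ⟨R, D, hR, hD, hloc⟩ := exists_ae_localization hgtop hcase
  obtain ⟨V, hV1, hV⟩ : ∃ V : ℝ, 1 ≤ V ∧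
      volume (Metric.closedBall (0 : Fin d → ℝ) (R + 1)) ^ (1 / 2 : ℝ) ≤ ENNReal.ofReal V := by
    have hfin : volume (Metric.closedBall (0 : Fin d → ℝ) (R + 1)) ^ (1 / 2 : ℝ) ≠ ∞ :=
      ENNReal.rpow_ne_top_of_nonneg (by norm_num) measure_closedBall_lt_top.ne
    exact ⟨max 1 (ENNReal.toReal _), le_max_left _ _,
      (ENNReal.ofReal_toReal hfin).symm.le.trans (ENNReal.ofReal_le_ofReal (le_max_right _ _))⟩
  -- All admissible parameters are collected in one index type, so that `PolyBdd` over `J` delivers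
  -- constants independent of them.
  let J := {q : ((Fin d → ℝ) × (Fin d → ℝ)) × (ℝ × ℝ) // q.2.1 ∈ Ioo (0 : ℝ) (1 / 2) ∧
    q.2.1⁻¹ ≤ q.2.2 ∧ ‖q.1.1‖ ≤ A * q.2.2 ∧ ‖q.1.2‖ ≤ A * q.2.2 ∧ (q.1.1 = 0 ∨ α ≤ ‖q.1.1‖)}
  let x : J → Fin d → ℝ := fun j => j.1.1.1
  let ξ : J → Fin d → ℝ := fun j => j.1.1.2
  let ε : J → ℝ := fun j => j.1.2.1
  let T : J → ℝ := fun j => j.1.2.2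
  have hε : ∀ j, ε j ∈ Ioo (0 : ℝ) (1 / 2) := fun j => j.2.1
  have hεT : ∀ j, (ε j)⁻¹ ≤ T j := fun j => j.2.2.1
  have hε2 : ∀ j, 2 ≤ (ε j)⁻¹ := fun j => by
    rw [le_inv_comm₀ (by norm_num) (hε j).1]; linarith [(hε j).2]
  have hT2 : ∀ j, 2 ≤ T j := fun j => (hε2 j).trans (hεT j)
  have hT1 : ∀ j, 1 ≤ T j := fun j => by linarith [hT2 j]
  have hl1 : ∀ j, 1 ≤ Real.logb 2 (T j) := fun j => one_le_logb_two (hT2 j)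
  have pT : PolyBdd T T := PolyBdd.self hT1
  have pε : PolyBdd T (fun j => (ε j)⁻¹) := pT.of_le (fun j => by linarith [hε2 j]) hεT
  have px : PolyBdd T (fun j => ‖x j‖) :=
    ((PolyBdd.const A).mul pT).of_le (fun j => norm_nonneg _) fun j => j.2.2.2.1
  have pξ : PolyBdd T (fun j => ‖ξ j‖) :=
    ((PolyBdd.const A).mul pT).of_le (fun j => norm_nonneg _) fun j => j.2.2.2.2.1
  have hV0 : 0 < V := by linarith
  -- The factor 4: two components, each with a window error and an approximation error of at most
  -- this size; `V` bounds the square root of the volume of the ball.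
  have hε1 : ∀ j, ε j / (4 * V) ∈ Ioo (0 : ℝ) (1 / 2) := fun j => by
    refine ⟨div_pos (hε j).1 (by linarith), ?_⟩
    exact (div_le_self (hε j).1.le (by linarith)).trans_lt (hε j).2
  have hε1i : ∀ j, (ε j / (4 * V))⁻¹ = 4 * V * (ε j)⁻¹ := fun j => by
    rw [inv_div, div_eq_mul_inv]
  have pε1 : PolyBdd T (fun j => (ε j / (4 * V))⁻¹) := by
    simp only [hε1i]
    exact (PolyBdd.const (4 * V)).mul pε
  have lε1 := pε1.logb hT2 fun j => by
    rw [hε1i]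
    nlinarith [hε2 j]
  -- The given connectivity bound involves `log ‖x‖`, which could be very negative for small `x`.
  -- The lattice gap excludes this, and at `x = 0` the convention `log 0 = 0` applies.
  have lx : PolyBdd (fun j => Real.logb 2 (T j)) (fun j => Real.logb 2 ‖x j‖) := by
    have h1 : PolyBdd T (fun j => 1 + ‖x j‖) := (PolyBdd.const 1).add hT1 px
    have h2 := (h1.logb hT2 fun j => by linarith [norm_nonneg (x j)]).add hl1
      (PolyBdd.const |Real.logb 2 α|)
    refine h2.of_abs_le fun j => ?_
    have h3 : 0 ≤ Real.logb 2 (1 + ‖x j‖) :=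
      Real.logb_nonneg (by norm_num) (by linarith [norm_nonneg (x j)])
    rw [abs_of_nonneg (a := Real.logb 2 (1 + ‖x j‖) + _) (by positivity)]
    rcases j.2.2.2.2.2 with h0 | h0
    · have : x j = 0 := h0
      simp [this]
    · have h0' : α ≤ ‖x j‖ := h0
      have h4 := Real.logb_le_logb_of_le (b := 2) (by norm_num) hα h0'
      have h5 := Real.logb_le_logb_of_le (b := 2) (by norm_num) (hα.trans_le h0')
        (by linarith : ‖x j‖ ≤ 1 + ‖x j‖)
      rw [abs_le]
      constructor
      · linarith [neg_abs_le (Real.logb 2 α)]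
      · linarith [abs_nonneg (Real.logb 2 α)]
  choose Φ hΦ hΦe hΦc hΦw using fun j => hπ (-x j) (ε j / (4 * V)) (hε1 j)
  simp only [norm_neg] at hΦc hΦw
  have pw : PolyBdd T (fun j => ((Φ j).weightMagnitude : ℝ)) :=
    (pε1.mvEval hT1 px π).of_le (fun j => NNReal.coe_nonneg _) hΦw
  have lc : PolyBdd (fun j => Real.logb 2 (T j)) (fun j => ((Φ j).connectivity : ℝ)) :=
    (lε1.mvEval hl1 lx π).of_le (fun j => Nat.cast_nonneg _) hΦc
  let Θ : J → ℝ := fun j => Real.pi * (d * (‖ξ j‖ * (‖x j‖ + R + 1))) + 1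
  have hΘ1 : ∀ j, 1 ≤ Θ j := fun j => by
    have : 0 ≤ Real.pi * (d * (‖ξ j‖ * (‖x j‖ + R + 1))) := by positivity
    simp only [Θ]; linarith
  have pΘ : PolyBdd T Θ :=
    ((PolyBdd.const _).mul ((PolyBdd.const _).mul (pξ.mul
      ((px.add hT1 (PolyBdd.const R)).add hT1 (PolyBdd.const 1))))).add hT1 (PolyBdd.const 1)
  -- Chosen such that `3 D (Θ^4 + 1) = Q * (ε / (4 V))`. Then `Q ≤ 2^n` yields both the range
  -- condition on `Θ` and the desired accuracy.
  let Q : J → ℝ := fun j => 12 * D * V * ((Θ j ^ 4 + 1) * (ε j)⁻¹)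
  have hDV : 1 ≤ D * V := one_le_mul_of_one_le_of_one_le hD hV1
  have hQ : ∀ j, Θ j ^ 4 + 1 ≤ Q j := fun j => by
    have h1 : 0 ≤ Θ j ^ 4 + 1 := by positivity
    have h2 : 1 ≤ 12 * D * V * (ε j)⁻¹ := by nlinarith [hε2 j]
    calc Θ j ^ 4 + 1 = 1 * (Θ j ^ 4 + 1) := (one_mul _).symm
      _ ≤ (12 * D * V * (ε j)⁻¹) * (Θ j ^ 4 + 1) := mul_le_mul_of_nonneg_right h2 h1
      _ = Q j := by simp only [Q]; ring
  have hQ1 : ∀ j, 1 ≤ Q j := fun j => by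
    have := hQ j
    have h1 : 0 ≤ Θ j ^ 4 := by positivity
    linarith
  have pQ : PolyBdd T Q := (PolyBdd.const _).mul (((pΘ.pow 4).add hT1 (PolyBdd.const 1)).mul pε)
  let n : J → ℕ := fun j => ⌈Real.logb 2 (Q j)⌉₊
  have hn : ∀ j, Q j ≤ 2 ^ n j := fun j => by
    have := Nat.le_ceil (Real.logb 2 (Q j))
    rw [Real.logb_le_iff_le_rpow (by norm_num) (by linarith [hQ1 j]), Real.rpow_natCast] at this
    exact this
  have ln : PolyBdd (fun j => Real.logb 2 (T j)) (fun j => (n j : ℝ)) :=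
    ((pQ.logb hT2 hQ1).add hl1 (PolyBdd.const 1)).of_le (fun j => Nat.cast_nonneg _)
      fun j => (Nat.ceil_lt_add_one (Real.logb_nonneg (by norm_num) (hQ1 j))).le
  let B : J → ℝ := fun j => 4 + D + (Φ j).weightMagnitude + (‖x j‖ + R) + Real.pi * ‖ξ j‖
  have pB : PolyBdd T B :=
    ((((PolyBdd.const (4 + D)).add hT1 pw).add hT1 (px.add hT1 (PolyBdd.const R))).add hT1
      ((PolyBdd.const _).mul pξ))
  have lconn : PolyBdd (fun j => Real.logb 2 (T j))
      (fun j => (10 : ℝ) ^ 12 * (((d : ℝ) + 1) ^ 2 + ((n j : ℝ) + 1) ^ 2 + (Φ j).connectivity)) :=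
    (PolyBdd.const _).mul (((PolyBdd.const _).add hl1
      ((ln.add hl1 (PolyBdd.const 1)).pow 2)).add hl1 lc)
  obtain ⟨C₁, p₁, hC₁, hB⟩ := pB.exists_ge hT1
  obtain ⟨C₂, p₂, hC₂, hconn⟩ := lconn.exists_ge hl1
  refine ⟨C₁ + C₂, p₁ + p₂, fun x' ξ' ε' T' h1 h2 h3 h4 h5 => ?_⟩
  let j : J := ⟨((x', ξ'), (ε', T')), h1, h2, h3, h4, h5⟩
  obtain ⟨c, hc, hcae⟩ := hloc (x j)
  have hae : ∀ᵐ t ∂(volume.restrict Ω), |g (t - x j)| ≤ D - 1 ∧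
      (‖t - c‖ ≤ R ∨ g (t - x j) = 0) ∧
      |g (t - x j) - realOut ((Φ j).realize (t - x j))| ≤ ε j / (4 * V) := by
    filter_upwards [hcae, ae_abs_sub_le_of_eLpNorm_le hΩ (hε1 j).1.le (x j) (hΦe j)] with t h1 h2
    exact ⟨h1.1, h1.2, h2⟩
  have hw0 : (0 : ℝ) ≤ (Φ j).weightMagnitude := NNReal.coe_nonneg _
  have hx0 := norm_nonneg (x j)
  have hξ0 : 0 ≤ Real.pi * ‖ξ j‖ := by positivity
  obtain ⟨Ψ, hΨ, hΨw, hΨc, hΨd⟩ := exists_gaborAtom_net (B := B j) (Θ := Θ j) hd (n j) hD hR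
    (ξ := ξ j) hc (hΦ j)
    hae (hε1 j).1.le (by linarith [(hε1 j).2]) le_rfl ((hQ j).trans (hn j))
    (by simp only [B]; linarith) (by simp only [B]; linarith) (by simp only [B]; linarith)
    (by simp only [B]; linarith) (by simp only [B]; linarith)
  refine ⟨Ψ, hΨ, ?_, ?_, fun f hf => (hΨd f hf).trans ?_⟩
  · have h6 := (le_abs_self _).trans (hconn (C₁ + C₂) (by linarith) (p₁ + p₂) (by omega) j)
    refine le_trans ?_ h6
    exact_mod_cast hΨc
  · exact hΨw.trans ((le_abs_self _).trans (hB (C₁ + C₂) (by linarith) (p₁ + p₂) (by omega) j))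
  · refine (mul_le_mul_right hV _).trans ?_
    rw [← ENNReal.ofReal_mul (by have := (hε1 j).1; positivity)]
    refine ENNReal.ofReal_le_ofReal ?_
    have e1 : 3 * D * (Θ j ^ 4 + 1) = Q j * (ε j / (4 * V)) := by
      have := (hε j).1.ne'
      simp only [Q]; field_simp; ring
    have e2 : 3 * D * (Θ j ^ 4 + 1) / 4 ^ n j ≤ ε j / (4 * V) := by
      rw [e1, div_le_iff₀ (by positivity), mul_comm]
      refine mul_le_mul_of_nonneg_left ((hn j).trans ?_) (hε1 j).1.le
      exact pow_le_pow_left₀ (by norm_num) (by norm_num) _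
    calc 2 * (3 * D * (Θ j ^ 4 + 1) / 4 ^ n j + ε j / (4 * V)) * V
        ≤ 2 * (ε j / (4 * V) + ε j / (4 * V)) * V := by gcongr
      _ = ε' := by
        have : ε j = ε' := rfl
        rw [this]; field_simp; ring

end Uniform

/-! ### Arrangements of Gabor systems -/

section GaborOrdering

variable {d : ℕ} {Ω : Set (Fin d → ℝ)} {g : (Fin d → ℝ) → ℝ} {α β : ℝ}

lemma norm_gaborAtom (g : (Fin d → ℝ) → ℝ) (x ξ t : Fin d → ℝ) :
    ‖gaborAtom g x ξ t‖ = ‖g (t - x)‖ := by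
  have h : 2 * (Real.pi : ℂ) * Complex.I * ((ξ ⬝ᵥ t : ℝ) : ℂ) =
      ((2 * (Real.pi * (ξ ⬝ᵥ t)) : ℝ) : ℂ) * Complex.I := by
    push_cast; ring
  rw [gaborAtom, norm_mul, h, Complex.norm_exp_ofReal_mul_I, one_mul, Complex.norm_real]

lemma memLp_gaborAtom (hg : MemLp g 2 volume) (x ξ : Fin d → ℝ) :
    MemLp (gaborAtom g x ξ) 2 (volume.restrict Ω) := by
  have h1 : MemLp (fun t => g (t - x)) 2 volume :=
    hg.comp_measurePreserving (measurePreserving_sub_right volume x)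
  have h2 : MemLp (gaborAtom g x ξ) 2 volume := by
    refine h1.of_le ?_ (Eventually.of_forall fun t => (norm_gaborAtom g x ξ t).le)
    refine AEStronglyMeasurable.mul ?_ (Complex.continuous_ofReal.comp_aestronglyMeasurable h1.1)
    refine Continuous.aestronglyMeasurable ?_
    unfold dotProduct
    fun_prop
  exact h2.restrict Ω

lemma volume_hyperplane {ζ : Fin d → ℝ} (hζ : ζ ≠ 0) (c : ℝ) :
    volume {t : Fin d → ℝ | ζ ⬝ᵥ t = c} = 0 := by
  rcases eq_empty_or_nonempty {t : Fin d → ℝ | ζ ⬝ᵥ t = c} with h | ⟨p, hp⟩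
  · rw [h, measure_empty]
  let f : (Fin d → ℝ) →ₗ[ℝ] ℝ := dotProductBilin ℝ ℝ ζ
  have hf : ∀ t, f t = ζ ⬝ᵥ t := fun t => rfl
  have hs : {t : Fin d → ℝ | ζ ⬝ᵥ t = c} = (AffineSubspace.mk' p (LinearMap.ker f) : Set _) := by
    ext t
    rw [SetLike.mem_coe, AffineSubspace.mem_mk', LinearMap.mem_ker, vsub_eq_sub, map_sub, hf, hf,
      mem_ofPred_eq, show ζ ⬝ᵥ p = c from hp, sub_eq_zero]
  rw [hs]
  refine Measure.addHaar_affineSubspace _ _ fun htop => ?_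
  have h1 : LinearMap.ker f = ⊤ := by
    rw [← AffineSubspace.direction_mk' p (LinearMap.ker f), htop, AffineSubspace.direction_top]
  have h2 : ζ ∈ LinearMap.ker f := h1 ▸ Submodule.mem_top
  rw [LinearMap.mem_ker, hf] at h2
  exact hζ (dotProduct_self_eq_zero.1 h2)

/-- The modulation parameter of a non-zero Gabor atom with real window is unique. -/
lemma modulation_unique {x x' ξ ξ' : Fin d → ℝ}
    (h : gaborAtom g x ξ =ᵐ[volume.restrict Ω] gaborAtom g x' ξ')
    (h0 : ¬ ∀ᵐ t ∂(volume.restrict Ω), g (t - x) = 0) : ξ = ξ' := by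
  by_contra hne
  have hζ : ξ - ξ' ≠ 0 := sub_ne_zero.2 hne
  -- Dividing out the modulation by `ξ'` makes `exp (2πi⟨ξ - ξ', t⟩) g (t - x)` real. Where `g (t -
  -- x) ≠ 0`, the sine of the phase vanishes, which confines `t` to countably many hyperplanes.
  have hnull : ∀ᵐ t : Fin d → ℝ, ∀ k : ℤ, (ξ - ξ') ⬝ᵥ t ≠ (k : ℝ) / 2 := by
    rw [ae_all_iff]
    exact fun k => by simpa [ae_iff] using volume_hyperplane hζ ((k : ℝ) / 2)
  refine h0 ?_
  filter_upwards [h, ae_restrict_of_ae hnull] with t ht hk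
  by_contra hgt
  have e1 : gaborAtom g (x := x) (ξ - ξ') t = ((g (t - x') : ℝ) : ℂ) := by
    have h2 : Complex.exp (-(2 * Real.pi * Complex.I * ((ξ' ⬝ᵥ t : ℝ) : ℂ))) * gaborAtom g x ξ t =
        Complex.exp (-(2 * Real.pi * Complex.I * ((ξ' ⬝ᵥ t : ℝ) : ℂ))) * gaborAtom g x' ξ' t := by
      rw [ht]
    rw [gaborAtom, gaborAtom, ← mul_assoc, ← mul_assoc, ← Complex.exp_add, ← Complex.exp_add,
      neg_add_cancel, Complex.exp_zero, one_mul] at h2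
    rw [← h2, gaborAtom, sub_dotProduct]
    congr 2
    push_cast; ring
  have h3 : 2 * (Real.pi : ℂ) * Complex.I * (((ξ - ξ') ⬝ᵥ t : ℝ) : ℂ) =
      ((2 * (Real.pi * ((ξ - ξ') ⬝ᵥ t)) : ℝ) : ℂ) * Complex.I := by
    push_cast; ring
  have h4 := congrArg Complex.im e1
  rw [gaborAtom, h3, Complex.im_mul_ofReal, Complex.exp_ofReal_mul_I_im, Complex.ofReal_im,
    mul_eq_zero, or_iff_left hgt, Real.sin_eq_zero_iff] at h4
  obtain ⟨k, hk'⟩ := h4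
  refine hk k ?_
  have := Real.pi_pos
  field_simp
  nlinarith

lemma scaledLattice_eq_zero_or_le {a : ℝ} (ha : 0 < a) {x : Fin d → ℝ}
    (hx : x ∈ scaledLattice d a) : x = 0 ∨ a ≤ ‖x‖ := by
  obtain ⟨k, hk⟩ := hx
  by_cases h : ∃ j, k j ≠ 0
  · obtain ⟨j, hj⟩ := h
    right
    calc a = a * 1 := (mul_one a).symm
      _ ≤ a * |(k j : ℝ)| :=
        mul_le_mul_of_nonneg_left (by exact_mod_cast Int.one_le_abs hj) ha.le
      _ = ‖x j‖ := by rw [hk, Real.norm_eq_abs, abs_mul, abs_of_pos ha]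
      _ ≤ ‖x‖ := norm_le_pi_norm x j
  · push Not at h
    left
    ext j
    simp [hk, h]

lemma exists_nat_norm_le {a : ℝ} (ha : 0 < a) (x : Fin d → ℝ) : ∃ n : ℕ, ‖x‖ ≤ n * a := by
  obtain ⟨n, hn⟩ := exists_nat_ge (‖x‖ / a)
  exact ⟨n, (div_le_iff₀ ha).1 hn⟩

/-- Since the modulation is unique, an atom with `‖ξ‖ = n β` cannot reappear in a smaller ball with
other parameters. This shows that shells are non-empty. -/
lemma mem_gaborShell_of_norm_eq (hg : MemLp g 2 volume) (hβ : 0 < β) {x ξ : Fin d → ℝ}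
    (hx : x ∈ scaledLattice d α) (hξ : ξ ∈ scaledLattice d β) {n : ℕ} (hxn : ‖x‖ ≤ n * α)
    (hξn : ‖ξ‖ = n * β) (h0 : ¬ ∀ᵐ t ∂(volume.restrict Ω), g (t - x) = 0) :
    (memLp_gaborAtom hg x ξ).toLp _ ∈ gaborShell g α β Ω n := by
  have hc := (memLp_gaborAtom (Ω := Ω) hg x ξ).coeFn_toLp
  refine ⟨⟨x, hx, ξ, hξ, hxn, hξn.le, hc⟩, ?_⟩
  simp only [mem_iUnion, not_exists]
  rintro k hk ⟨x', -, ξ', -, -, hξ', he⟩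
  have := modulation_unique (hc.symm.trans he) h0
  rw [← this, hξn] at hξ'
  have : (n : ℝ) ≤ k := le_of_mul_le_mul_right hξ' hβ
  exact absurd (Nat.cast_le.1 this) (not_le.2 hk)

/-- The parameters of the `i`-th element of a Gabor system grow at most linearly in `i`. -/
lemma IsGaborOrdering.exists_parameters (hd : 0 < d) (hα : 0 < α) (hβ : 0 < β)
    (hg : MemLp g 2 volume) {φ : ℕ+ → L2 ℂ Ω} (hφ : IsGaborOrdering g α β Ω φ) :
    ∃ N : ℕ, ∀ i : ℕ+, ∃ x ∈ scaledLattice d α, ∃ ξ ∈ scaledLattice d β,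
      ‖x‖ ≤ (N + (i : ℕ) : ℕ) * α ∧ ‖ξ‖ ≤ (N + (i : ℕ) : ℕ) * β ∧
      φ i =ᵐ[volume.restrict Ω] gaborAtom g x ξ := by
  by_cases h : ∃ x₀ ∈ scaledLattice d α, ¬ ∀ᵐ t ∂(volume.restrict Ω), g (t - x₀) = 0
  · obtain ⟨x₀, hx₀, h0⟩ := h
    obtain ⟨n₀, hn₀⟩ := exists_nat_norm_le hα x₀
    have hne : Nonempty (Fin d) := ⟨⟨0, hd⟩⟩
    have hshell : ∀ m : ℕ, n₀ ≤ m → ∃ j : ℕ+, φ j ∈ gaborShell g α β Ω m := by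
      intro m hm
      have hξ : (fun _ => β * ((m : ℤ) : ℝ) : Fin d → ℝ) ∈ scaledLattice d β :=
        ⟨fun _ => m, fun j => rfl⟩
      have hmem := mem_gaborShell_of_norm_eq (Ω := Ω) hg hβ hx₀ hξ (n := m)
        (hn₀.trans (mul_le_mul_of_nonneg_right (Nat.cast_le.2 hm) hα.le)) (by
          rw [pi_norm_const, Real.norm_eq_abs, abs_of_nonneg (by positivity), mul_comm]
          simp) h0
      obtain ⟨j, hj⟩ : (memLp_gaborAtom hg x₀ _).toLp _ ∈ range φ := by
        rw [hφ.range_eq]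
        obtain ⟨x, hx, ξ, hξ, -, -, he⟩ := hmem.1
        exact ⟨x, hx, ξ, hξ, he⟩
      exact ⟨j, hj ▸ hmem⟩
    choose j hj using hshell
    refine ⟨n₀ + 1, fun i => ?_⟩
    obtain ⟨x, hx, ξ, hξ, he⟩ : φ i ∈ gaborSystem g α β Ω := hφ.range_eq ▸ mem_range_self i
    have hex : ∃ n, φ i ∈ gaborBall g α β Ω n := by
      obtain ⟨n₁, h1⟩ := exists_nat_norm_le hα x
      obtain ⟨n₂, h2⟩ := exists_nat_norm_le hβ ξ
      refine ⟨n₁ + n₂, x, hx, ξ, hξ, h1.trans ?_, h2.trans ?_, he⟩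
      · push_cast; nlinarith [show (0 : ℝ) ≤ n₂ by positivity]
      · push_cast; nlinarith [show (0 : ℝ) ≤ n₁ by positivity]
    classical
    set n := Nat.find hex with hn
    have hni : φ i ∈ gaborShell g α β Ω n := by
      refine ⟨Nat.find_spec hex, ?_⟩
      simp only [mem_iUnion, not_exists]
      exact fun k hk => Nat.find_min hex hk
    -- Otherwise the non-empty shells `n₀, …, n - 1` would each have an element listed before `φ i`,
    -- at pairwise distinct positions, and there are fewer than `i` earlier positions.
    have hle : n ≤ n₀ + 1 + i := by
      by_contra! hlt
      have hcard : (Finset.range (n - n₀)).card ≤ (Finset.range i).card := by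
        refine Finset.card_le_card_of_injOn (fun m => (j (n₀ + m) (Nat.le_add_right _ _) : ℕ))
          (fun m hm => ?_) (fun a ha b hb hab => ?_)
        · have hm' : m < n - n₀ := by simpa using hm
          have := hφ.ordered _ _ _ _ (hj (n₀ + m) (Nat.le_add_right _ _)) hni (by omega)
          simpa using this
        · rcases lt_trichotomy a b with hlt | heq | hlt
          · have := hφ.ordered _ _ _ _ (hj (n₀ + a) (Nat.le_add_right _ _))
              (hj (n₀ + b) (Nat.le_add_right _ _)) (by omega)
            exact absurd (PNat.coe_injective hab) this.ne
          · exact heq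
          · have := hφ.ordered _ _ _ _ (hj (n₀ + b) (Nat.le_add_right _ _))
              (hj (n₀ + a) (Nat.le_add_right _ _)) (by omega)
            exact absurd (PNat.coe_injective hab) this.ne'
      simp only [Finset.card_range] at hcard
      omega
    obtain ⟨x', hx', ξ', hξ', h1, h2, he'⟩ := hni.1
    exact ⟨x', hx', ξ', hξ', h1.trans (by gcongr), h2.trans (by gcongr), he'⟩
  · push Not at h
    -- All translates of the window vanish on `Ω`, so every element is zero and the parameters `0,
    -- 0` describe it.
    refine ⟨0, fun i => ⟨0, ⟨0, by simp⟩, 0, ⟨0, by simp⟩, by simp; positivity,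
      by simp; positivity, ?_⟩⟩
    obtain ⟨x, hx, ξ, hξ, he⟩ : φ i ∈ gaborSystem g α β Ω := hφ.range_eq ▸ mem_range_self i
    filter_upwards [he, h x hx, h 0 ⟨0, by simp⟩] with t h1 h2 h3
    rw [h1, gaborAtom, gaborAtom, h2, h3]
    simp

/-- Gabor systems are effectively representable by neural networks. -/
lemma IsGaborOrdering.effectivelyRepresentable (hd : 0 < d) (hΩ : MeasurableSet Ω) (hα : 0 < α)
    (hβ : 0 < β) (hg2 : MemLp g 2 volume) (hgtop : MemLp g ∞ volume)
    (hcase : Bornology.IsBounded Ω ∨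
      (Ω = univ ∧ ∃ K : Set (Fin d → ℝ), IsCompact K ∧ ∀ᵐ t, t ∉ K → g t = 0))
    (happrox : ∃ π : MvPolynomial (Fin 2) ℝ, ∀ x : Fin d → ℝ, ∀ ε ∈ Ioo (0 : ℝ) (1 / 2),
      ∃ Φ ∈ reluNets d 1,
        eLpNorm (fun t => g t - realOut (Φ.realize t)) ∞
            (volume.restrict ((fun t => x + t) '' Ω)) ≤ ENNReal.ofReal ε ∧
        (Φ.connectivity : ℝ) ≤ MvPolynomial.eval ![Real.logb 2 ε⁻¹, Real.logb 2 ‖x‖] π ∧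
        (Φ.weightMagnitude : ℝ) ≤ MvPolynomial.eval ![ε⁻¹, ‖x‖] π)
    {φ : ℕ+ → L2 ℂ Ω} (hφ : IsGaborOrdering g α β Ω φ) : EffectivelyRepresentable φ := by
  obtain ⟨N, hN⟩ := hφ.exists_parameters hd hα hβ hg2
  obtain ⟨C, p, hnet⟩ := exists_uniform_gaborAtom_net hd hΩ hgtop hcase happrox
    (((N : ℝ) + 1) * (α + β)) hα
  -- The atom bounds are used with `T = i / ε`, whose logarithm is a sum. One polynomial has to
  -- serve for both bounds, hence the sum of two: the superfluous summand is non-negative in either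
  -- evaluation.
  refine ⟨MvPolynomial.C |C| * (MvPolynomial.X 0 + MvPolynomial.X 1) ^ p +
    MvPolynomial.C |C| * (MvPolynomial.X 0 * MvPolynomial.X 1) ^ p, fun i ε hε => ?_⟩
  obtain ⟨x, hx, ξ, hξ, hxn, hξn, he⟩ := hN i
  have hε2 : 2 ≤ ε⁻¹ := by
    rw [le_inv_comm₀ (by norm_num) hε.1]; linarith [hε.2]
  have hi : (1 : ℝ) ≤ ((i : ℕ) : ℝ) := Nat.one_le_cast.2 i.pos
  have hNi : ((N + (i : ℕ) : ℕ) : ℝ) ≤ (N + 1) * (ε⁻¹ * (i : ℕ)) := by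
    push_cast
    have hT : ((i : ℕ) : ℝ) ≤ ε⁻¹ * (i : ℕ) := by nlinarith
    nlinarith [show (0 : ℝ) ≤ N by positivity]
  have hT0 : 0 ≤ ((N : ℝ) + 1) * (ε⁻¹ * (i : ℕ)) := by positivity
  obtain ⟨Ψ, hΨ, hc, hw, hdist⟩ := hnet x ξ ε (ε⁻¹ * (i : ℕ)) hε (by nlinarith)
    (hxn.trans (by nlinarith)) (hξn.trans (by nlinarith)) (scaledLattice_eq_zero_or_le hα hx)
  have hl1 : 0 ≤ Real.logb 2 ε⁻¹ := Real.logb_nonneg (by norm_num) (by linarith)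
  have hl2 : 0 ≤ Real.logb 2 ((i : ℕ) : ℝ) := Real.logb_nonneg (by norm_num) hi
  refine ⟨Ψ, hΨ, hc.trans ?_, hw.trans ?_, hdist _ he⟩
  · rw [Real.logb_mul (by linarith) (by linarith)]
    simp only [map_add, map_mul, map_pow, MvPolynomial.eval_C, MvPolynomial.eval_X,
      Matrix.cons_val_zero, Matrix.cons_val_one, Matrix.cons_val_fin_one]
    have h1 : 0 ≤ |C| * (Real.logb 2 ε⁻¹ * Real.logb 2 ((i : ℕ) : ℝ)) ^ p := by positivity
    have h2 : C * (Real.logb 2 ε⁻¹ + Real.logb 2 ((i : ℕ) : ℝ)) ^ p ≤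
        |C| * (Real.logb 2 ε⁻¹ + Real.logb 2 ((i : ℕ) : ℝ)) ^ p :=
      mul_le_mul_of_nonneg_right (le_abs_self C) (by positivity)
    linarith
  · simp only [map_add, map_mul, map_pow, MvPolynomial.eval_C, MvPolynomial.eval_X,
      Matrix.cons_val_zero, Matrix.cons_val_one, Matrix.cons_val_fin_one]
    have h1 : 0 ≤ |C| * (ε⁻¹ + ((i : ℕ) : ℝ)) ^ p := by positivity
    have h2 : C * (ε⁻¹ * ((i : ℕ) : ℝ)) ^ p ≤ |C| * (ε⁻¹ * ((i : ℕ) : ℝ)) ^ p :=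
      mul_le_mul_of_nonneg_right (le_abs_self C) (by positivity)
    linarith

end GaborOrdering

/-! ### Transfer of approximation rates from dictionaries to networks -/

section Transfer

variable {d : ℕ} {B : ℝ} {L S s K : ℕ}

lemma NetFun.coord {ι : Type} [Fintype ι] {f : (Fin d → ℝ) → ι → ℝ} (h : NetFun B L S s f)
    (j : ι) : NetFun B L S s (fun x (_ : Unit) => f x j) := by
  obtain ⟨κ, i, F, A, b, h₀, hw, hc, hf⟩ := h
  refine ⟨κ, i, F, Matrix.of fun _ k => A j k, fun _ => b j, h₀,
    ⟨fun _ k => hw.1 j k, fun _ => hw.2 j⟩, le_trans ?_ hc, fun x => ?_⟩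
  · simp only [weightCount, Finset.univ_unique, Matrix.of_apply, Finset.sum_const,
      Finset.card_singleton, one_smul]
    exact Finset.single_le_sum (f := fun j => ∑ k, nz (A j k) + nz (b j))
      (fun _ _ => Nat.zero_le _) (Finset.mem_univ j)
  · ext u
    exact congrFun (hf x) j

lemma ScalarNet.net_coord (hB : 1 ≤ B) (hd : 0 < d) {n : ℕ} {Φ : ReLUNet d n}
    (hΦ : Φ.Nondegenerate) (hΦB : (Φ.weightMagnitude : ℝ) ≤ B) (j : Fin n) :
    ScalarNet B (10 * (d + 1) ^ 2 + 7 * Φ.connectivity) (fun t => Φ.realize t j) := by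
  have h1 := (NetFun.affine_input hB (1 : Matrix (Fin d) (Fin d) ℝ) 0
    (weightsLE_one hB)).mono (le_refl B) le_rfl (Nat.mul_le_mul_left 2 (weightCount_le_card _ _))
  have h2 := (h1.comp_net hB Φ hΦB).coord j
  have hw := hΦ.width_le_connectivity
  have hdep := hΦ.depth_le_connectivity hd
  refine (h2.scalarNet (K := 10 * (d + 1) ^ 2 + 7 * Φ.connectivity) ?_ ?_ ?_).congr fun t => ?_
  rotate_left 3
  · simp
  · omega
  · simp only [Fintype.card_fin]
    nlinarith
  · omega

/-- Linear combinations of the components of networks. -/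
lemma exists_sum_net (hB : 1 ≤ B) (hd : 0 < d) {n : ℕ} (hn : 0 < n) (hn2 : n ≤ 2) {ι : Type}
    [Fintype ι] [Nonempty ι] {Ψ : ι → ReLUNet d 2} (hΨ : ∀ i, Ψ i ∈ reluNets d 2) {k : ℕ}
    (hk : ∀ i, (Ψ i).connectivity ≤ k) (hΨB : ∀ i, ((Ψ i).weightMagnitude : ℝ) ≤ B)
    (W : Fin n → ι × Fin 2 → ℝ) (hW : ∀ r p, |W r p| ≤ B) :
    ∃ Φ ∈ reluNets d n, (∀ t, Φ.realize t = fun r => ∑ p, W r p * (Ψ p.1).realize t p.2) ∧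
      (Φ.weightMagnitude : ℝ) ≤ B ∧
      Φ.connectivity ≤ 200 * (Fintype.card ι * (10 * (d + 1) ^ 2 + 7 * k)) ∧
      Φ.depth ≤ 10 * (d + 1) ^ 2 + 7 * k + 4 := by
  set K := 10 * (d + 1) ^ 2 + 7 * k with hK
  obtain ⟨M, hM'⟩ : ∃ M, M = Fintype.card ι := ⟨_, rfl⟩
  have hM : 0 < M := hM' ▸ Fintype.card_pos
  have h1 : ∀ p : ι × Fin 2, NetFun B K (9 * K) (K + 2)
      (fun t (_ : Unit) => (Ψ p.1).realize t p.2) := by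
    intro p
    obtain ⟨L, S, s, h, h1, h2, h3⟩ := (ScalarNet.net_coord hB hd (hΨ p.1) (hΨB p.1) p.2).mono
      le_rfl (show _ ≤ K by have := hk p.1; omega)
    refine (h.pad hB h1).mono le_rfl ?_ ?_
    · simp only [Fintype.card_unit]; omega
    · simp only [Fintype.card_unit]; omega
  have h2 := ((NetFun.stack (by linarith) h1).affine (Matrix.of W) (0 : Fin n → ℝ)
    ⟨hW, fun _ => by simp; linarith⟩).mono (le_refl B) le_rfl
    (Nat.mul_le_mul_left 2 (weightCount_le_card _ _))
  obtain ⟨Φ, hΦ, hr, hw, hdep, hc⟩ := h2.exists_reluNet hB hn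
  refine ⟨Φ, hΦ, fun t => ?_, hw, hc.trans ?_, by omega⟩
  · rw [hr]
    ext r
    simp [Matrix.mulVec, dotProduct]
  · simp only [Finset.sum_const, Finset.card_univ, Fintype.card_prod, Fintype.card_fin,
      smul_eq_mul, ← hM']
    have e1 : n * (2 * n + 3) ≤ 2 * 7 := Nat.mul_le_mul hn2 (by omega)
    have e2 : n * (M * 2 + 1) ≤ 2 * (M * 2 + 1) := Nat.mul_le_mul_right _ hn2
    have e3 : M * 2 * (9 * K) = 18 * (M * K) := by ring
    have e4 : M * 2 * (K + 2) = 2 * (M * K) + 4 * M := by ring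
    have e5 : K ≤ M * K := Nat.le_mul_of_pos_left _ hM
    have e6 : M * 10 ≤ M * K := Nat.mul_le_mul_left _ (by rw [hK]; nlinarith)
    have e7 : d ≤ K := by rw [hK]; nlinarith
    have e8 : 10 ≤ K := by rw [hK]; nlinarith
    rw [e3, e4]
    omega

variable {Ω : Set (Fin d → ℝ)}

lemma continuous_complexOut : Continuous complexOut := by
  have : complexOut = fun y => (y 0 : ℂ) + (y 1 : ℂ) * Complex.I := by
    ext y; apply Complex.ext <;> simp [complexOut]
  rw [this]
  fun_prop

/-- Error of a linear combination of networks as an approximation of a linear combination of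
dictionary elements. -/
lemma eLpNorm_sub_sum_le {φ : ℕ+ → L2 ℂ Ω} (I : Finset ℕ+) (c : ℕ+ → ℂ) (F : L2 ℂ Ω)
    {Ψ : ℕ+ → ReLUNet d 2} {δ P : ℝ} (hP : 0 ≤ P) (hc : ∀ i ∈ I, ‖c i‖ ≤ P)
    (hΨ : ∀ i ∈ I, netDist complexOut (φ i) (Ψ i) ≤ ENNReal.ofReal δ) :
    eLpNorm (fun t => F t - ∑ i ∈ I, c i * complexOut ((Ψ i).realize t)) 2 (volume.restrict Ω) ≤
      ‖F - ∑ i ∈ I, c i • φ i‖ₑ + ENNReal.ofReal (I.card * (P * δ)) := by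
  have hmeas : ∀ i, AEStronglyMeasurable (fun t => φ i t - complexOut ((Ψ i).realize t))
      (volume.restrict Ω) := fun i =>
    (Lp.aestronglyMeasurable _).sub
      (continuous_complexOut.comp (Ψ i).continuous_realize).aestronglyMeasurable
  have hae : (fun t => F t - ∑ i ∈ I, c i * complexOut ((Ψ i).realize t))
      =ᵐ[volume.restrict Ω] (fun t => (F - ∑ i ∈ I, c i • φ i : L2 ℂ Ω) t) +
        ∑ i ∈ I, c i • (fun t => φ i t - complexOut ((Ψ i).realize t)) := by
    have h1 := Lp.coeFn_sub F (∑ i ∈ I, c i • φ i)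
    have h2 : ((∑ i ∈ I, c i • φ i : L2 ℂ Ω) : (Fin d → ℝ) → ℂ) =ᵐ[volume.restrict Ω]
        fun t => ∑ i ∈ I, (c i • φ i : L2 ℂ Ω) t := by
      filter_upwards [Lp.coeFn_finsetSum I fun i => c i • φ i] with t ht
      rw [ht, Finset.sum_apply]
    have h3 : ∀ᵐ t ∂(volume.restrict Ω), ∀ i, (c i • φ i : L2 ℂ Ω) t = c i • φ i t := by
      rw [ae_all_iff]
      exact fun i => Lp.coeFn_smul (c i) (φ i)
    filter_upwards [h1, h2, h3] with t h1 h2 h3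
    simp only [Pi.add_apply, Finset.sum_apply, Pi.smul_apply, h1, Pi.sub_apply, h2, h3,
      smul_eq_mul, mul_sub, Finset.sum_sub_distrib]
    ring
  rw [eLpNorm_congr_ae hae]
  refine (eLpNorm_add_le (Lp.aestronglyMeasurable _)
    (Finset.aestronglyMeasurable_sum _ fun i _ => (hmeas i).const_smul _) (by norm_num)).trans ?_
  refine add_le_add (le_of_eq (Lp.enorm_def _).symm) ?_
  refine (eLpNorm_sum_le (fun i _ => (hmeas i).const_smul _) (by norm_num)).trans ?_
  calc ∑ i ∈ I, eLpNorm (c i • fun t => φ i t - complexOut ((Ψ i).realize t)) 2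
        (volume.restrict Ω) ≤ ∑ _i ∈ I, ENNReal.ofReal (P * δ) := by
        refine Finset.sum_le_sum fun i hi => eLpNorm_const_smul_le.trans ?_
        rw [ENNReal.ofReal_mul hP]
        refine mul_le_mul' ?_ (hΨ i hi)
        rw [← ofReal_norm]
        exact ENNReal.ofReal_le_ofReal (hc i hi)
    _ = ENNReal.ofReal (I.card * (P * δ)) := by
        rw [Finset.sum_const, nsmul_eq_mul, ENNReal.ofReal_mul (Nat.cast_nonneg _),
          ENNReal.ofReal_natCast]

/-- Networks reading off complex linear combinations, either completely (`F = ℂ`) or only their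
real parts (`F = ℝ`); `emb` is the embedding of `L²(Ω, F)` into `L²(Ω, ℂ)`. -/
def CombinesNets {F : Type*} [NormedAddCommGroup F] {n : ℕ} (out : (Fin n → ℝ) → F)
    (emb : L2 F Ω → L2 ℂ Ω) : Prop :=
  ∀ (B : ℝ) (I : Finset ℕ+) (c : ℕ+ → ℂ) (Ψ : ℕ+ → ReLUNet d 2) (k : ℕ), 1 ≤ B → I.Nonempty →
    (∀ i ∈ I, ‖c i‖ ≤ B ∧ Ψ i ∈ reluNets d 2 ∧ (Ψ i).connectivity ≤ k ∧
      ((Ψ i).weightMagnitude : ℝ) ≤ B) →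
    ∃ Φ ∈ reluNets d n, (Φ.weightMagnitude : ℝ) ≤ B ∧
      Φ.connectivity ≤ 200 * (I.card * (10 * (d + 1) ^ 2 + 7 * k)) ∧
      Φ.depth ≤ 10 * (d + 1) ^ 2 + 7 * k + 4 ∧
      ∀ f : L2 F Ω, netDist out f Φ ≤
        eLpNorm (fun t => emb f t - ∑ i ∈ I, c i * complexOut ((Ψ i).realize t)) 2
          (volume.restrict Ω)

/-- Multiplication by a complex coefficient acts on the two outputs as a real 2×2 matrix with
entries at most its modulus. -/
lemma combinesNets_complex (hd : 0 < d) :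
    CombinesNets (Ω := Ω) complexOut (fun f : L2 ℂ Ω => f) := by
  intro B I c Ψ k hB hI h
  have : Nonempty I := hI.to_subtype
  obtain ⟨Φ, hΦ, hr, hw, hc, hdep⟩ := exists_sum_net (Ψ := fun i : I => Ψ i) hB hd two_pos le_rfl
    (fun i => (h i i.2).2.1) (fun i => (h i i.2).2.2.1) (fun i => (h i i.2).2.2.2)
    (fun r p => (![![(c p.1).re, -(c p.1).im], ![(c p.1).im, (c p.1).re]] : Fin 2 → Fin 2 → ℝ)
      r p.2) (by
      rintro r ⟨i, j⟩
      have h1 := (Complex.abs_re_le_norm (c i)).trans (h i i.2).1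
      have h2 := (Complex.abs_im_le_norm (c i)).trans (h i i.2).1
      fin_cases r <;> fin_cases j <;> simpa)
  refine ⟨Φ, hΦ, hw, by simpa using hc, hdep, fun f => le_of_eq ?_⟩
  refine congrArg (fun u => eLpNorm u 2 (volume.restrict Ω)) ?_
  ext t
  congr 1
  rw [hr, ← Finset.sum_coe_sort I]
  apply Complex.ext
  · simp [complexOut, Fintype.sum_prod_type, Complex.mul_re, sub_eq_add_neg]
  · simp [complexOut, Fintype.sum_prod_type, Complex.mul_im, add_comm]

/-- Only the first row of that matrix is kept: the target is real, and passing to real parts does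
not increase the distance. -/
lemma combinesNets_real (hd : 0 < d) :
    CombinesNets (Ω := Ω) realOut (fun f : L2 ℝ Ω => toComplexL2 f) := by
  intro B I c Ψ k hB hI h
  have : Nonempty I := hI.to_subtype
  obtain ⟨Φ, hΦ, hr, hw, hc, hdep⟩ := exists_sum_net (Ψ := fun i : I => Ψ i) hB hd one_pos
    (by norm_num) (fun i => (h i i.2).2.1) (fun i => (h i i.2).2.2.1) (fun i => (h i i.2).2.2.2)
    (fun _ p => (![(c p.1).re, -(c p.1).im] : Fin 2 → ℝ) p.2) (by
      rintro r ⟨i, j⟩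
      have h1 := (Complex.abs_re_le_norm (c i)).trans (h i i.2).1
      have h2 := (Complex.abs_im_le_norm (c i)).trans (h i i.2).1
      fin_cases j <;> simpa)
  refine ⟨Φ, hΦ, hw, by simpa using hc, hdep, fun f => eLpNorm_mono_ae ?_⟩
  have hf : (toComplexL2 f : (Fin d → ℝ) → ℂ) =ᵐ[volume.restrict Ω] fun t => ((f t : ℝ) : ℂ) :=
    ContinuousLinearMap.coeFn_compLpL Complex.ofRealCLM f
  filter_upwards [hf] with t ht
  rw [ht]
  refine le_trans (le_of_eq ?_) (Complex.abs_re_le_norm _)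
  rw [Real.norm_eq_abs, hr, ← Finset.sum_coe_sort I]
  congr 1
  simp [realOut, complexOut, Fintype.sum_prod_type, Complex.mul_re, sub_eq_add_neg]

/-- Effective representability with errors and indices that are polynomial in `N`. -/
lemma EffectivelyRepresentable.exists_net {φ : ℕ+ → L2 ℂ Ω} (h : EffectivelyRepresentable φ)
    (q : ℕ) (hq : 0 < q) (C₀ : ℝ) (k : ℕ) :
    ∃ (C : ℝ) (p : ℕ), 0 ≤ C ∧ ∀ (N : ℕ) (i : ℕ+), 3 ≤ N → ((i : ℕ) : ℝ) ≤ C₀ * (N : ℝ) ^ k →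
      ∃ Ψ ∈ reluNets d 2, (Ψ.connectivity : ℝ) ≤ C * Real.logb 2 N ^ p ∧
        (Ψ.weightMagnitude : ℝ) ≤ C * (N : ℝ) ^ p ∧
        netDist complexOut (φ i) Ψ ≤ ENNReal.ofReal (((N : ℝ) ^ q)⁻¹) := by
  obtain ⟨π, hπ⟩ := h
  let J := {z : ℕ × ℕ+ // 3 ≤ z.1 ∧ ((z.2 : ℕ) : ℝ) ≤ C₀ * (z.1 : ℝ) ^ k}
  let T : J → ℝ := fun j => (j.1.1 : ℝ)
  have hT3 : ∀ j, 3 ≤ T j := fun j => Nat.ofNat_le_cast.2 j.2.1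
  have hT2 : ∀ j, 2 ≤ T j := fun j => by linarith [hT3 j]
  have hT1 : ∀ j, 1 ≤ T j := fun j => by linarith [hT3 j]
  have hl1 : ∀ j, 1 ≤ Real.logb 2 (T j) := fun j => one_le_logb_two (hT2 j)
  have hi1 : ∀ j : J, (1 : ℝ) ≤ ((j.1.2 : ℕ) : ℝ) := fun j => Nat.one_le_cast.2 j.1.2.pos
  have pi : PolyBdd T (fun j => ((j.1.2 : ℕ) : ℝ)) :=
    ((PolyBdd.const C₀).mul ((PolyBdd.self hT1).pow k)).of_le (fun j => by positivity)
      fun j => j.2.2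
  have pq : PolyBdd T (fun j => T j ^ q) := (PolyBdd.self hT1).pow q
  -- The restriction to `N ≥ 3` ensures that the accuracy `N^(-q)` is below `1 / 2`.
  have hTq : ∀ j, 3 ≤ T j ^ q := fun j =>
    (hT3 j).trans (le_self_pow₀ (hT1 j) hq.ne')
  obtain ⟨C₁, p₁, hC₁, h₁⟩ := (pq.mvEval hT1 pi π).exists_ge hT1
  obtain ⟨C₂, p₂, hC₂, h₂⟩ := ((pq.logb hT2 fun j => by linarith [hTq j]).mvEval hl1
    (pi.logb hT2 hi1) π).exists_ge hl1
  refine ⟨C₁ + C₂, p₁ + p₂, by linarith, fun N i hN hi => ?_⟩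
  let j : J := ⟨(N, i), hN, hi⟩
  have hε : ((N : ℝ) ^ q)⁻¹ ∈ Ioo (0 : ℝ) (1 / 2) := by
    have : 3 ≤ (N : ℝ) ^ q := hTq j
    refine ⟨by positivity, ?_⟩
    rw [inv_lt_comm₀ (by positivity) (by norm_num)]
    linarith
  obtain ⟨Ψ, hΨ, hc, hw, hd⟩ := hπ i _ hε
  rw [inv_inv] at hc hw
  refine ⟨Ψ, hΨ, hc.trans ((le_abs_self _).trans ?_), hw.trans ((le_abs_self _).trans ?_), hd⟩
  · exact h₂ (C₁ + C₂) (by linarith) (p₁ + p₂) (by omega) j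
  · exact h₁ (C₁ + C₂) (by linarith) (p₁ + p₂) (by omega) j

/-- A power with exponent below 1 leaves room for any power of the logarithm; this absorbs every
polylogarithmic factor in the transfer of rates. -/
lemma eventually_mul_logb_pow_le (C θ : ℝ) (p : ℕ) (hθ : θ < 1) :
    ∀ᶠ N : ℕ in atTop, C * ((N : ℝ) ^ θ * Real.logb 2 N ^ p) ≤ N := by
  have h1 : (fun x : ℝ => Real.log x ^ p) =o[atTop] fun x => x ^ (1 - θ) := by
    have := isLittleO_log_rpow_rpow_atTop (p : ℝ) (show 0 < 1 - θ by linarith)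
    simpa using this
  have h2 := (h1.const_mul_left (|C| * ((Real.log 2)⁻¹) ^ p)).comp_tendsto
    tendsto_natCast_atTop_atTop
  filter_upwards [h2.bound one_pos, eventually_ge_atTop 1] with N hN hN1
  have hN0 : (0 : ℝ) < N := by exact_mod_cast hN1
  have hlog : 0 ≤ Real.logb 2 N := Real.logb_nonneg (by norm_num) (by exact_mod_cast hN1)
  simp only [Function.comp_apply, one_mul, Real.norm_eq_abs] at hN
  rw [abs_of_pos (Real.rpow_pos_of_pos hN0 (1 - θ))] at hN
  have h3 : |C| * Real.logb 2 N ^ p ≤ (N : ℝ) ^ (1 - θ) := by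
    refine le_trans (le_of_eq ?_) ((le_abs_self _).trans hN)
    rw [Real.logb, div_eq_inv_mul, mul_pow]; ring
  calc C * ((N : ℝ) ^ θ * Real.logb 2 N ^ p) ≤ |C| * ((N : ℝ) ^ θ * Real.logb 2 N ^ p) :=
        mul_le_mul_of_nonneg_right (le_abs_self C) (by positivity)
    _ = (N : ℝ) ^ θ * (|C| * Real.logb 2 N ^ p) := by ring
    _ ≤ (N : ℝ) ^ θ * (N : ℝ) ^ (1 - θ) := mul_le_mul_of_nonneg_left h3 (by positivity)
    _ = N := by rw [← Real.rpow_add hN0]; simp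

end Transfer

/-! ### Dictionary rates are at most network rates -/

section TransferRate

variable {d : ℕ} {Ω : Set (Fin d → ℝ)}

lemma exists_abs_eval_le (π : Polynomial ℝ) :
    ∃ (C : ℝ) (k : ℕ), 0 ≤ C ∧ ∀ x : ℝ, 1 ≤ x → |π.eval x| ≤ C * x ^ k := by
  let T : Ici (1 : ℝ) → ℝ := fun x => x
  obtain ⟨C, k, hC, h⟩ := ((PolyBdd.self (T := T) fun x => x.2).eval (fun x => x.2) π).exists_ge
    fun x => x.2
  exact ⟨C, k, hC, fun x hx => h C le_rfl k le_rfl ⟨x, hx⟩⟩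

/-- An approximation rate of a dictionary carries over to networks, up to an arbitrarily small
loss. -/
lemma exists_isBigOPow_netError {F : Type*} [NormedAddCommGroup F] {n : ℕ}
    {out : (Fin n → ℝ) → F} {emb : L2 F Ω → L2 ℂ Ω} (hcomb : CombinesNets out emb)
    {φ : ℕ+ → L2 ℂ Ω} (hφ : EffectivelyRepresentable φ) {C : Set (L2 F Ω)} {π : Polynomial ℝ}
    {γ r : ℝ} (hr : 0 < r) (hrγ : r < γ) (h : IsBigOPow (dictError (emb '' C) φ π) γ) :
    ∃ π' : Polynomial ℝ, IsBigOPow (netError out C π') r := by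
  obtain ⟨K, hK⟩ := h
  obtain ⟨C₀, k₀, hC₀, hπ⟩ := exists_abs_eval_le π
  -- At most `N` terms with coefficients of order `N^k₀` are summed, so accuracy `N^(-q)` per term
  -- leaves an error of order `N^(-r)`.
  set q := k₀ + 1 + ⌈r⌉₊ with hq
  obtain ⟨C₁, p, hC₁, hnet⟩ := hφ.exists_net q (by omega) C₀ k₀
  have hγ : 0 < γ := hr.trans hrγ
  -- With about `N^θ` terms the dictionary error is of order `N^(-θ γ) = N^(-r)`, and the remaining
  -- factor `N^(1 - θ)` pays for the networks of the individual terms.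
  set θ := r / γ with hθ
  have hθ0 : 0 < θ := div_pos hr hγ
  have hθ1 : θ < 1 := (div_lt_one hγ).2 hrγ
  set E : ℝ := 10 * ((d : ℝ) + 1) ^ 2 + 7 * C₁ + 4 with hE
  have hE0 : 0 < E := by positivity
  refine ⟨Polynomial.C (1 + C₀ + E) * Polynomial.X ^ (p + k₀), |K| + 1 + C₀, ?_⟩
  have htend : Tendsto (fun N : ℕ => ⌈(N : ℝ) ^ θ⌉₊) atTop atTop :=
    tendsto_nat_ceil_atTop.comp ((tendsto_rpow_atTop hθ0).comp tendsto_natCast_atTop_atTop)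
  filter_upwards [htend.eventually hK, eventually_mul_logb_pow_le (400 * E) θ p hθ1,
    eventually_ge_atTop 3] with N hKN hNconn hN3
  set M := ⌈(N : ℝ) ^ θ⌉₊ with hM
  have hN3' : (3 : ℝ) ≤ N := by exact_mod_cast hN3
  have hN1 : (1 : ℝ) ≤ N := by linarith
  have hN0 : (0 : ℝ) < N := by linarith
  have hl1 : 1 ≤ Real.logb 2 N := one_le_logb_two (by linarith)
  have hNθ : 1 ≤ (N : ℝ) ^ θ := Real.one_le_rpow hN1 hθ0.le
  have hM1 : (1 : ℝ) ≤ M := hNθ.trans (Nat.le_ceil _)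
  have hM2 : (M : ℝ) ≤ 2 * (N : ℝ) ^ θ := by
    have := Nat.ceil_lt_add_one (by linarith : 0 ≤ (N : ℝ) ^ θ)
    linarith
  have hMN : (M : ℝ) ≤ N := by
    refine Nat.cast_le.2 (Nat.ceil_le.2 ?_)
    simpa using Real.rpow_le_rpow_of_exponent_le hN1 hθ1.le
  have hπM : π.eval (M : ℝ) ≤ C₀ * (N : ℝ) ^ k₀ :=
    (le_abs_self _).trans ((hπ M hM1).trans (by gcongr))
  have hMγ : (M : ℝ) ^ (-γ) ≤ (N : ℝ) ^ (-r) := by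
    calc (M : ℝ) ^ (-γ) ≤ ((N : ℝ) ^ θ) ^ (-γ) :=
          Real.rpow_le_rpow_of_nonpos (by linarith) (Nat.le_ceil _) (by linarith)
      _ = (N : ℝ) ^ (-r) := by
          rw [← Real.rpow_mul hN0.le, hθ]
          congr 1
          field_simp
  have hNr : 0 < (N : ℝ) ^ (-r) := Real.rpow_pos_of_pos hN0 _
  refine iSup₂_le fun f hf => ?_
  -- The infimum need not be attained; enlarging the constant to `|K| + 1` makes the inequality
  -- strict and yields an actual approximant.
  have hlt : (⨅ (I : Finset ℕ+) (c : ℕ+ → ℂ)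
      (_ : I.card = M ∧ ∀ i ∈ I, ((i : ℕ) : ℝ) ≤ π.eval (M : ℝ) ∧ ‖c i‖ ≤ π.eval (M : ℝ)),
      ‖emb f - ∑ i ∈ I, c i • φ i‖ₑ) < ENNReal.ofReal ((|K| + 1) * (N : ℝ) ^ (-r)) := by
    refine lt_of_le_of_lt ((le_iSup₂ (f := fun (F : L2 ℂ Ω) (_ : F ∈ emb '' C) =>
      ⨅ (I : Finset ℕ+) (c : ℕ+ → ℂ)
      (_ : I.card = M ∧ ∀ i ∈ I, ((i : ℕ) : ℝ) ≤ π.eval (M : ℝ) ∧ ‖c i‖ ≤ π.eval (M : ℝ)),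
      ‖F - ∑ i ∈ I, c i • φ i‖ₑ) (emb f) (mem_image_of_mem emb hf)).trans hKN) ?_
    rw [ENNReal.ofReal_lt_ofReal_iff (by positivity)]
    calc K * (M : ℝ) ^ (-γ) ≤ |K| * (M : ℝ) ^ (-γ) :=
          mul_le_mul_of_nonneg_right (le_abs_self K) (by positivity)
      _ ≤ |K| * (N : ℝ) ^ (-r) := mul_le_mul_of_nonneg_left hMγ (abs_nonneg K)
      _ < (|K| + 1) * (N : ℝ) ^ (-r) := by linarith
  simp only [iInf_lt_iff] at hlt
  obtain ⟨I, c, ⟨hcard, hI⟩, hlt⟩ := hlt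
  have hex : ∀ i ∈ I, ∃ Ψ ∈ reluNets d 2, (Ψ.connectivity : ℝ) ≤ C₁ * Real.logb 2 N ^ p ∧
      (Ψ.weightMagnitude : ℝ) ≤ C₁ * (N : ℝ) ^ p ∧
      netDist complexOut (φ i) Ψ ≤ ENNReal.ofReal (((N : ℝ) ^ q)⁻¹) :=
    fun i hi => hnet N i hN3 ((hI i hi).1.trans hπM)
  have : Nonempty (ReLUNet d 2) := ⟨.output 0 0⟩
  choose! Ψ hΨ hΨc hΨw hΨd using hex
  set B : ℝ := 1 + C₀ * (N : ℝ) ^ k₀ + C₁ * (N : ℝ) ^ p with hB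
  have hB1 : 0 ≤ C₀ * (N : ℝ) ^ k₀ := by positivity
  have hB2 : 0 ≤ C₁ * (N : ℝ) ^ p := by positivity
  set k := ⌊C₁ * Real.logb 2 N ^ p⌋₊
  have hlp : 1 ≤ Real.logb 2 N ^ p := one_le_pow₀ hl1
  have hkE : 10 * ((d : ℝ) + 1) ^ 2 + 7 * k + 4 ≤ E * Real.logb 2 N ^ p := by
    have h1 : (k : ℝ) ≤ C₁ * Real.logb 2 N ^ p := Nat.floor_le (by positivity)
    have h2 : 0 ≤ 10 * ((d : ℝ) + 1) ^ 2 + 4 := by positivity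
    calc 10 * ((d : ℝ) + 1) ^ 2 + 7 * k + 4
        ≤ (10 * ((d : ℝ) + 1) ^ 2 + 4) * Real.logb 2 N ^ p + 7 * (C₁ * Real.logb 2 N ^ p) := by
          linarith [le_mul_of_one_le_right h2 hlp]
      _ = E * Real.logb 2 N ^ p := by rw [hE]; ring
  obtain ⟨Φ, hΦ, hΦw, hΦc, hΦd, hΦe⟩ := hcomb B I c Ψ k (by linarith)
    (Finset.card_pos.1 (by rw [hcard]; exact_mod_cast hM1)) fun i hi =>
      ⟨((hI i hi).2.trans hπM).trans (by linarith), hΨ i hi, Nat.le_floor (hΨc i hi),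
        (hΨw i hi).trans (by linarith)⟩
  have hcoef : ∀ y : ℝ, 1 ≤ y → ∀ m ≤ p + k₀, y ^ m ≤ y ^ (p + k₀) := fun y hy m hm =>
    pow_le_pow_right₀ hy hm
  have hmem : Φ ∈ reluNetsBdd (Polynomial.C (1 + C₀ + E) * Polynomial.X ^ (p + k₀)) N d n := by
    refine ⟨hΦ, ?_, ?_, ?_⟩
    · have h1 : (Φ.connectivity : ℝ) ≤ 200 * (M * (10 * ((d : ℝ) + 1) ^ 2 + 7 * k)) := by
        rw [hcard] at hΦc
        exact_mod_cast hΦc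
      have h2 : (Φ.connectivity : ℝ) ≤ N := by
        calc (Φ.connectivity : ℝ) ≤ 200 * (M * (10 * ((d : ℝ) + 1) ^ 2 + 7 * k)) := h1
          _ ≤ 200 * (2 * (N : ℝ) ^ θ * (E * Real.logb 2 N ^ p)) := by
              gcongr
              linarith
          _ = 400 * E * ((N : ℝ) ^ θ * Real.logb 2 N ^ p) := by ring
          _ ≤ N := hNconn
      exact_mod_cast h2
    · have h1 : (Φ.depth : ℝ) ≤ 10 * ((d : ℝ) + 1) ^ 2 + 7 * k + 4 := by exact_mod_cast hΦd
      simp only [Polynomial.eval_mul, Polynomial.eval_C, Polynomial.eval_pow, Polynomial.eval_X]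
      calc (Φ.depth : ℝ) ≤ E * Real.logb 2 N ^ p := h1.trans hkE
        _ ≤ (1 + C₀ + E) * Real.logb 2 N ^ (p + k₀) :=
          mul_le_mul (by linarith) (hcoef _ hl1 _ (by omega)) (by positivity) (by positivity)
    · simp only [Polynomial.eval_mul, Polynomial.eval_C, Polynomial.eval_pow, Polynomial.eval_X]
      refine hΦw.trans ?_
      have h1 := hcoef N hN1 p (by omega)
      have h2 := hcoef N hN1 k₀ (by omega)
      have h3 := hcoef N hN1 0 (by omega)
      rw [pow_zero] at h3
      have h4 : C₁ ≤ E := by rw [hE]; nlinarith [sq_nonneg ((d : ℝ) + 1)]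
      calc B ≤ 1 * (N : ℝ) ^ (p + k₀) + C₀ * (N : ℝ) ^ (p + k₀) + E * (N : ℝ) ^ (p + k₀) := by
            rw [hB]; gcongr; linarith
        _ = _ := by ring
  refine (iInf₂_le Φ hmem).trans ((hΦe f).trans ?_)
  refine (eLpNorm_sub_sum_le I c (emb f) hB1 (fun i hi => (hI i hi).2.trans hπM) hΨd).trans ?_
  refine (add_le_add_left hlt.le _).trans ?_
  rw [← ENNReal.ofReal_add (by positivity) (by positivity)]
  refine ENNReal.ofReal_le_ofReal ?_
  have hlast : (I.card : ℝ) * (C₀ * (N : ℝ) ^ k₀ * ((N : ℝ) ^ q)⁻¹) ≤ C₀ * (N : ℝ) ^ (-r) := by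
    rw [hcard]
    calc (M : ℝ) * (C₀ * (N : ℝ) ^ k₀ * ((N : ℝ) ^ q)⁻¹)
        ≤ N * (C₀ * (N : ℝ) ^ k₀ * ((N : ℝ) ^ q)⁻¹) := by gcongr
      _ = C₀ * ((N : ℝ) ^ ⌈r⌉₊)⁻¹ := by
          rw [hq, pow_add, pow_succ]; field_simp
      _ ≤ C₀ * (N : ℝ) ^ (-r) := by
          rw [Real.rpow_neg hN0.le, ← Real.rpow_natCast]
          gcongr
          exact Nat.le_ceil r
  linarith

/-- The loss from `γ` to any smaller `r` is invisible in the supremum. -/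
lemma dictRate_le_netRate {F : Type*} [NormedAddCommGroup F] {n : ℕ}
    {out : (Fin n → ℝ) → F} {emb : L2 F Ω → L2 ℂ Ω} (hcomb : CombinesNets out emb)
    {φ : ℕ+ → L2 ℂ Ω} (hφ : EffectivelyRepresentable φ) (C : Set (L2 F Ω)) :
    dictRate (emb '' C) φ ≤ netRate out C := by
  refine iSup₂_le fun γ ⟨π, hπ⟩ => ENNReal.le_of_forall_nnreal_lt fun r hr => ?_
  rcases eq_or_ne r 0 with rfl | h0
  · simp
  · exact le_iSup₂ (f := fun (γ : ℝ≥0) (_ : ∃ π : Polynomial ℝ, IsBigOPow (netError out C π) γ) =>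
      (γ : ℝ≥0∞)) r (exists_isBigOPow_netError hcomb hφ (NNReal.coe_pos.2 (pos_iff_ne_zero.2 h0))
        (NNReal.coe_lt_coe.2 (ENNReal.coe_lt_coe.1 hr)) hπ)

end TransferRate

/-! ### Quantization and counting of networks -/

namespace ReLUNet

/-- The network with a function applied to all weights. -/
def map (r : ℝ → ℝ) : {m n : ℕ} → ReLUNet m n → ReLUNet m n
  | _, _, output A b => output (A.map r) (r ∘ b)
  | _, _, hidden A b Φ => hidden (A.map r) (r ∘ b) (Φ.map r)

/-- All weights of the network lie in `V`. -/
def WeightsIn (V : Set ℝ) : {m n : ℕ} → ReLUNet m n → Prop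
  | _, _, output A b => (∀ i j, A i j ∈ V) ∧ ∀ i, b i ∈ V
  | _, _, hidden A b Φ => ((∀ i j, A i j ∈ V) ∧ ∀ i, b i ∈ V) ∧ Φ.WeightsIn V

variable {r : ℝ → ℝ} {m n : ℕ}

lemma depth_map (Φ : ReLUNet m n) : (Φ.map r).depth = Φ.depth := by
  induction Φ with
  | output A b => rfl
  | hidden A b Φ ih => simp only [map, depth, ih]

lemma hiddenWidth_map (Φ : ReLUNet m n) : (Φ.map r).hiddenWidth = Φ.hiddenWidth := by
  induction Φ with
  | output A b => rfl
  | hidden A b Φ ih => simp only [map, hiddenWidth, ih]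

lemma nnz_map_le (hr : r 0 = 0) (A : Matrix (Fin n) (Fin m) ℝ) (b : Fin n → ℝ) :
    nnz (A.map r) (r ∘ b) ≤ nnz A b := by
  unfold nnz
  refine add_le_add (Finset.card_le_card fun p hp => ?_) (Finset.card_le_card fun i hi => ?_)
  · rw [Finset.mem_filter] at hp ⊢
    exact ⟨Finset.mem_univ _, fun h0 => hp.2 (by rw [Matrix.map_apply, h0, hr])⟩
  · rw [Finset.mem_filter] at hi ⊢
    exact ⟨Finset.mem_univ _, fun h0 => hi.2 (by rw [Function.comp_apply, h0, hr])⟩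

lemma connectivity_map_le (hr : r 0 = 0) (Φ : ReLUNet m n) :
    (Φ.map r).connectivity ≤ Φ.connectivity := by
  induction Φ with
  | output A b => exact nnz_map_le hr A b
  | hidden A b Φ ih => exact add_le_add (nnz_map_le hr A b) ih

lemma weightsIn_map {B : ℝ} (hB : 0 ≤ B) {V : Set ℝ} (hV : ∀ a, |a| ≤ B → r a ∈ V)
    (Φ : ReLUNet m n) (hΦ : (Φ.weightMagnitude : ℝ) ≤ B) : (Φ.map r).WeightsIn V := by
  induction Φ with
  | output A b =>
    have h := (maxAbs_le_iff hB).1 hΦ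
    exact ⟨fun i j => hV _ (h.1 i j), fun i => hV _ (h.2 i)⟩
  | hidden A b Φ ih =>
    rw [weightMagnitude, NNReal.coe_max, max_le_iff] at hΦ
    have h := (maxAbs_le_iff hB).1 hΦ.1
    exact ⟨⟨fun i j => hV _ (h.1 i j), fun i => hV _ (h.2 i)⟩, ih hΦ.2⟩

lemma abs_mulVec_le {A : Matrix (Fin n) (Fin m) ℝ} {B X : ℝ} (hB : 0 ≤ B)
    (hA : ∀ i j, |A i j| ≤ B) {x : Fin m → ℝ} (hx : ‖x‖ ≤ X) (i : Fin n) :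
    |A.mulVec x i| ≤ m * (B * X) := by
  change |∑ j, A i j * x j| ≤ _
  calc |∑ j, A i j * x j| ≤ ∑ j, |A i j * x j| := Finset.abs_sum_le_sum_abs _ _
    _ ≤ ∑ _j : Fin m, B * X := by
      refine Finset.sum_le_sum fun j _ => ?_
      rw [abs_mul]
      exact mul_le_mul (hA i j) ((norm_le_pi_norm x j).trans hx) (abs_nonneg _) hB
    _ = _ := by simp

/-- One affine map: size and effect of rounding. -/
lemma affine_perturbation {A : Matrix (Fin n) (Fin m) ℝ} {b : Fin n → ℝ} {B δ X W : ℝ}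
    (hB : 1 ≤ B) (hδ : 0 ≤ δ) (hδ1 : δ ≤ 1) (hX : 1 ≤ X) (hW : 1 ≤ W) (hm : (m : ℝ) ≤ W)
    (hr : ∀ a, |r a - a| ≤ δ) (hw : WeightsLE B A b) {x y : Fin m → ℝ} (hx : ‖x‖ ≤ X)
    (hxy : ‖y - x‖ ≤ δ * X) (i : Fin n) :
    |(A.mulVec x + b) i| ≤ 4 * W * B * X ∧
    |((A.map r).mulVec y + r ∘ b) i - (A.mulVec x + b) i| ≤ δ * (4 * W * B * X) := by
  have hm0 : (0 : ℝ) ≤ m := Nat.cast_nonneg m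
  have hWX : 1 ≤ W * X := one_le_mul_of_one_le_of_one_le hW hX
  have hBX : 1 ≤ B * X := one_le_mul_of_one_le_of_one_le hB hX
  have hmW : ∀ z : ℝ, 0 ≤ z → (m : ℝ) * z ≤ W * z := fun z hz => mul_le_mul_of_nonneg_right hm hz
  have hBWX : B ≤ W * B * X := by nlinarith
  have h1WBX : W * X ≤ W * B * X := by nlinarith
  constructor
  · have h1 := abs_mulVec_le (by linarith) hw.1 hx i
    have h2 := hmW (B * X) (by linarith)
    calc |(A.mulVec x + b) i| ≤ |A.mulVec x i| + |b i| := abs_add_le _ _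
      _ ≤ W * (B * X) + B := add_le_add (h1.trans h2) (hw.2 i)
      _ ≤ 4 * W * B * X := by nlinarith
  · have hr2 : ∀ i j, |(A.map r) i j| ≤ 2 * B := fun i j => by
      have h1 := abs_sub_abs_le_abs_sub (r (A i j)) (A i j)
      have h2 := hr (A i j)
      have h3 := hw.1 i j
      rw [Matrix.map_apply]
      linarith
    have h1 := abs_mulVec_le (by linarith) hr2 hxy i
    have h2 := abs_mulVec_le (A := A.map r - A) hδ
      (fun i j => by simpa using hr (A i j)) hx i
    have e : ((A.map r).mulVec y + r ∘ b) i - (A.mulVec x + b) i =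
        (A.map r).mulVec (y - x) i + (A.map r - A).mulVec x i + (r (b i) - b i) := by
      simp only [Matrix.mulVec_sub, Matrix.sub_mulVec, Pi.add_apply, Pi.sub_apply,
        Function.comp_apply]
      ring
    rw [e]
    have h3 := hmW (2 * B * (δ * X)) (by positivity)
    have h4 := hmW (δ * X) (by positivity)
    calc _ ≤ |(A.map r).mulVec (y - x) i| + |(A.map r - A).mulVec x i| + |r (b i) - b i| :=
          abs_add_three _ _ _
      _ ≤ W * (2 * B * (δ * X)) + W * (δ * X) + δ := by linarith [hr (b i)]
      _ = δ * (2 * (W * B * X) + W * X + 1) := by ring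
      _ ≤ δ * (4 * W * B * X) := by
          refine mul_le_mul_of_nonneg_left ?_ hδ
          linarith

/-- Effect of rounding the weights on the realized function. -/
lemma norm_realize_map_sub_le (Φ : ReLUNet m n) {B δ X : ℝ} {W : ℕ} (hB : 1 ≤ B) (hδ : 0 ≤ δ)
    (hδ1 : δ ≤ 1) (hX : 1 ≤ X) (hW : 1 ≤ W) (hm : m ≤ W) (hΦW : Φ.hiddenWidth ≤ W)
    (hr : ∀ a, |r a - a| ≤ δ) (hΦ : (Φ.weightMagnitude : ℝ) ≤ B) {x y : Fin m → ℝ}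
    (hx : ‖x‖ ≤ X) (hxy : ‖y - x‖ ≤ δ * X) :
    ‖(Φ.map r).realize y - Φ.realize x‖ ≤ δ * ((4 * W * B) ^ Φ.depth * X) := by
  have hW' : (1 : ℝ) ≤ W := by exact_mod_cast hW
  induction Φ generalizing X with
  | output A b =>
    have h := affine_perturbation hB hδ hδ1 hX hW' (Nat.cast_le.2 hm) hr
      ((maxAbs_le_iff (by linarith)).1 hΦ) hx hxy
    rw [pi_norm_le_iff_of_nonneg (by positivity)]
    intro i
    have h2 := (h i).2
    rw [depth, pow_one]
    exact h2
  | @hidden m k n A b Φ ih =>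
    rw [weightMagnitude, NNReal.coe_max, max_le_iff] at hΦ
    rw [hiddenWidth] at hΦW
    have h := affine_perturbation hB hδ hδ1 hX hW' (Nat.cast_le.2 hm) hr
      ((maxAbs_le_iff (by linarith)).1 hΦ.1) hx hxy
    have hX' : 1 ≤ 4 * (W : ℝ) * B * X := by
      have : 1 ≤ (W : ℝ) * B := one_le_mul_of_one_le_of_one_le hW' hB
      nlinarith
    -- The invariant is size at most `X` and perturbation at most `δ * X`; each layer multiplies `X`
    -- by `4 * W * B`.
    have h3 := ih (X := 4 * W * B * X) hX' (by omega) (by omega) hΦ.2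
      (x := fun i => max ((A.mulVec x + b) i) 0)
      (y := fun i => max (((A.map r).mulVec y + r ∘ b) i) 0) (by
        rw [pi_norm_le_iff_of_nonneg (by linarith)]
        intro i
        rw [Real.norm_eq_abs, abs_of_nonneg (le_max_right _ _)]
        exact max_le ((le_abs_self _).trans (h i).1) (by linarith)) (by
        rw [pi_norm_le_iff_of_nonneg (mul_nonneg hδ (by linarith))]
        intro i
        refine le_trans ?_ (h i).2
        rw [Pi.sub_apply, Real.norm_eq_abs]
        exact abs_max_sub_max_le_abs _ _ _)
    rw [map, realize, realize, depth, pow_add, pow_one]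
    refine h3.trans (le_of_eq ?_)
    ring

end ReLUNet

/-- Functions with few non-zero values in a finite set can be counted. -/
lemma exists_finset_sparse (P : Type*) [Fintype P] [DecidableEq P] (V : Finset ℝ) (s : ℕ) :
    ∃ T : Finset (P → ℝ), T.card ≤ (Fintype.card P * V.card) ^ s ∧
      ∀ h : P → ℝ, (∀ p, h p ∈ V) → (Finset.univ.filter fun p => h p ≠ 0).card = s → h ∈ T := by
  classical
  -- A sparse function is recovered from the list of its non-zero positions and values; there are
  -- `(|P| |V|)^s` such lists.
  let decode : (Fin s → P × V) → P → ℝ := fun c p =>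
    if h : ∃ j, (c j).1 = p then ((c h.choose).2 : ℝ) else 0
  refine ⟨Finset.univ.image decode, ?_, fun h hV hs => ?_⟩
  · refine Finset.card_image_le.trans (le_of_eq ?_)
    rw [Finset.card_univ, Fintype.card_fun, Fintype.card_prod, Fintype.card_coe, Fintype.card_fin]
  · let e := (Finset.univ.filter fun p => h p ≠ 0).equivFinOfCardEq hs
    rw [Finset.mem_image]
    refine ⟨fun j => ((e.symm j : P), ⟨h (e.symm j), hV _⟩), Finset.mem_univ _, ?_⟩
    ext p
    simp only [decode]
    split_ifs with hp
    · exact congrArg h hp.choose_spec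
    · by_contra hne
      refine hp ⟨e ⟨p, by simpa using Ne.symm hne⟩, by simp⟩

lemma exists_finset_layers (V : Finset ℝ) (k m s : ℕ) :
    ∃ T : Finset (Matrix (Fin k) (Fin m) ℝ × (Fin k → ℝ)), T.card ≤ ((k * m + k) * V.card) ^ s ∧
      ∀ (A : Matrix (Fin k) (Fin m) ℝ) (b : Fin k → ℝ), (∀ i j, A i j ∈ V) → (∀ i, b i ∈ V) →
        ReLUNet.nnz A b = s → (A, b) ∈ T := by
  classical
  obtain ⟨T, hT, hmem⟩ := exists_finset_sparse ((Fin k × Fin m) ⊕ Fin k) V s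
  refine ⟨T.image fun h => (Matrix.of fun i j => h (Sum.inl (i, j)), fun i => h (Sum.inr i)),
    Finset.card_image_le.trans (by simpa using hT), fun A b hA hb hs => ?_⟩
  rw [Finset.mem_image]
  refine ⟨Sum.elim (fun p => A p.1 p.2) b, hmem _ ?_ ?_, rfl⟩
  · rintro (p | i)
    · exact hA _ _
    · exact hb _
  · rw [← hs, ReLUNet.nnz, Finset.card_filter, Fintype.sum_sum_type, Finset.card_filter,
      Finset.card_filter]
    rfl

/-- The number of networks of bounded size with weights in a finite set. -/
lemma exists_finset_nets (V : Finset ℝ) (hV : V.Nonempty) (W M n : ℕ) (hn : n ≤ W) (hW : 1 ≤ W)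
    (L : ℕ) {s : ℕ} (hs : s ≤ M) {m : ℕ} (hm : m ≤ W) :
    ∃ T : Finset (ReLUNet m n),
      T.card ≤ ((W * W + W) * V.card) ^ s * ((W + 2) * (M + 1)) ^ L ∧
      ∀ Φ : ReLUNet m n, Φ.WeightsIn V → Φ.hiddenWidth ≤ W → Φ.depth ≤ L → Φ.connectivity ≤ s →
        Φ ∈ T := by
  classical
  set X := (W * W + W) * V.card with hX
  -- Per layer, `Y` counts the shape: output map or one of `W + 1` hidden widths, together with the
  -- number of non-zero weights. The weights themselves are counted by powers of `X`, whose
  -- exponents add up to `s`.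
  set Y := (W + 2) * (M + 1) with hY
  have hX1 : 1 ≤ X := Nat.mul_pos (by omega) (Finset.card_pos.2 hV)
  have hlayer : ∀ k ≤ W, ∀ m ≤ W, ∀ t, ((k * m + k) * V.card) ^ t ≤ X ^ t := fun k hk m hm t =>
    Nat.pow_le_pow_left (Nat.mul_le_mul_right _ (add_le_add (Nat.mul_le_mul hk hm) hk)) t
  choose Lay hLay hLaymem using fun k m t => exists_finset_layers V k m t
  induction L generalizing s m with
  | zero =>
    refine ⟨∅, by simp, fun Φ _ _ h _ => ?_⟩
    cases Φ <;> simp [ReLUNet.depth] at h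
  | succ L ih =>
    have ih' : ∀ k t : ℕ, ∃ T : Finset (ReLUNet k n), k ≤ W → t ≤ M → T.card ≤ X ^ t * Y ^ L ∧
        ∀ Φ : ReLUNet k n, Φ.WeightsIn V → Φ.hiddenWidth ≤ W → Φ.depth ≤ L →
          Φ.connectivity ≤ t → Φ ∈ T := by
      intro k t
      by_cases hk : k ≤ W
      · by_cases ht : t ≤ M
        · obtain ⟨T, hT⟩ := ih ht hk
          exact ⟨T, fun _ _ => hT⟩
        · exact ⟨∅, fun _ h => absurd h ht⟩
      · exact ⟨∅, fun h => absurd h hk⟩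
    choose R hR using ih'
    let T₁ : Finset (ReLUNet m n) := (Finset.range (s + 1)).biUnion fun t =>
      (Lay n m t).image fun p => ReLUNet.output p.1 p.2
    let T₂ : Finset (ReLUNet m n) := (Finset.range (W + 1)).biUnion fun k =>
      (Finset.range (s + 1)).biUnion fun t =>
        (Lay k m t ×ˢ R k (s - t)).image fun p => ReLUNet.hidden p.1.1 p.1.2 p.2
    refine ⟨T₁ ∪ T₂, ?_, fun Φ h1 h2 h3 h4 => ?_⟩
    · have hY1 : 1 ≤ Y ^ L := Nat.one_le_pow _ _ (Nat.mul_pos (by omega) (by omega))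
      have c1 : T₁.card ≤ (s + 1) * (X ^ s * Y ^ L) := by
        refine (Finset.card_biUnion_le_card_mul _ _ (X ^ s * Y ^ L) fun t ht => ?_).trans
          (by simp)
        rw [Finset.mem_range] at ht
        refine Finset.card_image_le.trans ((hLay _ _ _).trans ((hlayer n hn m hm t).trans ?_))
        exact (Nat.pow_le_pow_right hX1 (by omega)).trans (Nat.le_mul_of_pos_right _ hY1)
      have c2 : T₂.card ≤ (W + 1) * ((s + 1) * (X ^ s * Y ^ L)) := by
        refine (Finset.card_biUnion_le_card_mul _ _ ((s + 1) * (X ^ s * Y ^ L))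
          fun k hk => ?_).trans (by simp)
        refine (Finset.card_biUnion_le_card_mul _ _ (X ^ s * Y ^ L) fun t ht => ?_).trans
          (by simp)
        rw [Finset.mem_range] at hk ht
        refine Finset.card_image_le.trans ?_
        rw [Finset.card_product]
        refine (Nat.mul_le_mul ((hLay _ _ _).trans (hlayer k (by omega) m hm t))
          (hR k (s - t) (by omega) (by omega)).1).trans (le_of_eq ?_)
        rw [← mul_assoc, ← pow_add, Nat.add_sub_cancel' (by omega)]
      calc (T₁ ∪ T₂).card ≤ T₁.card + T₂.card := Finset.card_union_le _ _
        _ ≤ (s + 1) * (X ^ s * Y ^ L) + (W + 1) * ((s + 1) * (X ^ s * Y ^ L)) := add_le_add c1 c2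
        _ = ((W + 2) * (s + 1)) * (X ^ s * Y ^ L) := by ring
        _ ≤ Y * (X ^ s * Y ^ L) := Nat.mul_le_mul_right _ (Nat.mul_le_mul_left _ (by omega))
        _ = X ^ s * Y ^ (L + 1) := by ring
    · rw [Finset.mem_union]
      cases Φ with
      | output A b =>
        left
        simp only [T₁, Finset.mem_biUnion, Finset.mem_range, Finset.mem_image]
        rw [ReLUNet.connectivity] at h4
        exact ⟨_, by omega, (A, b), hLaymem _ _ _ A b h1.1 h1.2 rfl, rfl⟩
      | @hidden _ k _ A b Φ =>
        right
        simp only [T₂, Finset.mem_biUnion, Finset.mem_range, Finset.mem_image, Finset.mem_product]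
        rw [ReLUNet.hiddenWidth] at h2
        rw [ReLUNet.depth] at h3
        rw [ReLUNet.connectivity] at h4
        refine ⟨k, by omega, ReLUNet.nnz A b, by omega, ((A, b), Φ),
          ⟨hLaymem _ _ _ A b h1.1.1 h1.1.2 rfl, ?_⟩, rfl⟩
        exact (hR k _ (by omega) (by omega)).2 Φ h1.2 (by omega) (by omega) (by omega)

/-- The code word of `f` is its label; the decoder returns some member of the class with the same
label. Thus only members with equal labels need to be compared. -/
lemma hasCode_of_finset {H : Type*} [NormedAddCommGroup H] {C : Set H} {ε : ℝ} {ℓ : ℕ}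
    {τ : Type*} (q : C → τ) (T : Finset τ) (hq : ∀ f, q f ∈ T) (hT : T.card ≤ 2 ^ ℓ)
    (hclose : ∀ f f', q f = q f' → ‖(f' : H) - f‖ ≤ ε) : HasCode C ε ℓ := by
  classical
  have hcard : Fintype.card T ≤ Fintype.card (Fin ℓ → Bool) := by simpa using hT
  obtain ⟨e⟩ := Function.Embedding.nonempty_of_card_le hcard
  let E : C → (Fin ℓ → Bool) := fun f => e ⟨q f, hq f⟩
  refine ⟨E, fun w => if h : ∃ f, E f = w then ((h.choose : C) : H) else 0, fun f => ?_⟩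
  have hex : ∃ f', E f' = E f := ⟨f, rfl⟩
  beta_reduce
  rw [dif_pos hex]
  refine hclose _ _ ?_
  have := e.injective hex.choose_spec
  exact (Subtype.ext_iff.1 this).symm

lemma HasCode.mono {H : Type*} [NormedAddCommGroup H] {C : Set H} {ε ε' : ℝ} {ℓ : ℕ}
    (h : HasCode C ε ℓ) (hε : ε ≤ ε') : HasCode C ε' ℓ := by
  obtain ⟨E, D, h⟩ := h
  exact ⟨E, D, fun f => (h f).trans hε⟩

/-! ### Codes from quantized networks -/

section Encoding

variable {d : ℕ} {Ω : Set (Fin d → ℝ)} {F : Type*} [NormedAddCommGroup F] {n : ℕ}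
  {out : (Fin n → ℝ) → F}

/-- A class which is approximated by networks has a code, by quantization of the weights. -/
lemma hasCode_of_nets (hout : LipschitzWith 2 out) {C : Set (L2 F Ω)} {e B X V₀ δ : ℝ}
    {M L W : ℕ} (hB : 1 ≤ B) (hX : 1 ≤ X) (hV₀ : 0 ≤ V₀) (he : 0 ≤ e) (hδ : 0 < δ) (hδ1 : δ ≤ 1)
    (hΩ : MeasurableSet Ω) (hΩX : ∀ t ∈ Ω, ‖t‖ ≤ X)
    (hvol : (volume.restrict Ω) univ ^ (1 / 2 : ℝ) ≤ ENNReal.ofReal V₀)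
    (hnW : n ≤ W) (hMW : M ≤ W) (hW : 1 ≤ W)
    (h : ∀ f ∈ C, ∃ Φ ∈ reluNets d n, Φ.connectivity ≤ M ∧ Φ.depth ≤ L ∧
      (Φ.weightMagnitude : ℝ) ≤ B ∧ netDist out f Φ ≤ ENNReal.ofReal e) {ℓ : ℕ}
    (hℓ : ((W * W + W) * (2 * ⌈B / δ⌉₊ + 3)) ^ M * ((W + 2) * (M + 1)) ^ L ≤ 2 ^ ℓ) :
    HasCode C (2 * e + 4 * (δ * ((4 * W * B) ^ L * X)) * V₀) ℓ := by
  classical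
  rcases C.eq_empty_or_nonempty with rfl | ⟨f₀, hf₀⟩
  · exact ⟨fun _ _ => true, fun _ => 0, fun f => f.2.elim⟩
  -- Non-degeneracy bounds the input dimension by the connectivity of any available network, which
  -- requires a member of the class.
  have hdW : d ≤ W := by
    obtain ⟨Φ, hΦ, h1, -⟩ := h f₀ hf₀
    have := ReLUNet.Nondegenerate.width_le_connectivity hΦ
    omega
  -- Rounding down to multiples of `δ`; zero is fixed, so the connectivity does not increase.
  let r : ℝ → ℝ := fun a => δ * ⌊a / δ⌋
  have hr : ∀ a, |r a - a| ≤ δ := fun a => by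
    have h1 := Int.floor_le (a / δ)
    have h2 := Int.lt_floor_add_one (a / δ)
    rw [le_div_iff₀ hδ] at h1
    rw [div_lt_iff₀ hδ] at h2
    rw [abs_le]
    constructor <;> simp only [r] <;> linarith
  set Z := ⌈B / δ⌉₊ + 1 with hZ
  let V : Finset ℝ := (Finset.Icc (-(Z : ℤ)) Z).image fun z : ℤ => δ * z
  have hVmem : ∀ a, |a| ≤ B → r a ∈ (V : Set ℝ) := fun a ha => by
    simp only [V, Finset.coe_image, r]
    refine ⟨⌊a / δ⌋, ?_, rfl⟩
    have h0 := abs_le.1 ha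
    have h1 := Nat.le_ceil (B / δ)
    have h2 : a / δ ≤ B / δ := div_le_div_of_nonneg_right h0.2 hδ.le
    have h3 : -(B / δ) ≤ a / δ := by
      rw [← neg_div]; exact div_le_div_of_nonneg_right h0.1 hδ.le
    rw [Finset.coe_Icc, mem_Icc]
    constructor
    · rw [Int.le_floor, hZ]; push_cast; linarith
    · have h4 := Int.floor_le (a / δ)
      have : (⌊a / δ⌋ : ℝ) ≤ (Z : ℤ) := by rw [hZ]; push_cast; linarith
      exact_mod_cast this
  have hVne : V.Nonempty := ⟨r 0, hVmem 0 (by simp; linarith)⟩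
  have hVcard : V.card ≤ 2 * ⌈B / δ⌉₊ + 3 := by
    refine Finset.card_image_le.trans ?_
    rw [Int.card_Icc]
    omega
  obtain ⟨T, hTcard, hT⟩ := exists_finset_nets V hVne W M n hnW hW L le_rfl hdW
  choose Φ hΦ hΦc hΦL hΦw hΦe using fun f : C => h f f.2
  have hwid : ∀ f, (Φ f).hiddenWidth ≤ W := fun f => by
    have := ReLUNet.Nondegenerate.width_le_connectivity (hΦ f)
    have := hΦc f
    omega
  have hW' : (1 : ℝ) ≤ W := by exact_mod_cast hW
  have hWB : 1 ≤ 4 * (W : ℝ) * B := by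
    have : 1 ≤ (W : ℝ) * B := one_le_mul_of_one_le_of_one_le hW' hB
    nlinarith
  have hround : ∀ f, ∀ t ∈ Ω, ‖((Φ f).map r).realize t - (Φ f).realize t‖ ≤
      δ * ((4 * W * B) ^ L * X) := fun f t ht => by
    have h1 := (Φ f).norm_realize_map_sub_le hB hδ.le hδ1 hX hW hdW (hwid f) hr (hΦw f)
      (hΩX t ht) (y := t) (by rw [sub_self, norm_zero]; positivity)
    refine h1.trans ?_
    gcongr
    exact hΦL f
  refine hasCode_of_finset (fun f => (Φ f).map r) T (fun f => ?_) ?_ fun f f' hff' => ?_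
  · refine hT _ (ReLUNet.weightsIn_map (by linarith) hVmem _ (hΦw f)) ?_ ?_ ?_
    · rw [ReLUNet.hiddenWidth_map]; exact hwid f
    · rw [ReLUNet.depth_map]; exact hΦL f
    · exact (ReLUNet.connectivity_map_le (by simp [r]) _).trans (hΦc f)
  · refine hTcard.trans (le_trans ?_ hℓ)
    exact Nat.mul_le_mul_right _ (Nat.pow_le_pow_left (Nat.mul_le_mul_left _ hVcard) _)
  · have hη : 0 ≤ δ * ((4 * (W : ℝ) * B) ^ L * X) := by positivity
    have hcont : ∀ f, AEStronglyMeasurable (fun t => out ((Φ f).realize t)) (volume.restrict Ω) :=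
      fun f => (hout.continuous.comp (Φ f).continuous_realize).aestronglyMeasurable
    have hnet : eLpNorm (fun t => out ((Φ f').realize t) - out ((Φ f).realize t)) 2
        (volume.restrict Ω) ≤ ENNReal.ofReal (4 * (δ * ((4 * W * B) ^ L * X)) * V₀) := by
      -- Both networks are close to the same rounded network; the factor 4 is two such distances
      -- times the Lipschitz constant 2 of `out`.
      have hb : ∀ᵐ t ∂(volume.restrict Ω),
          ‖out ((Φ f').realize t) - out ((Φ f).realize t)‖ ≤
            4 * (δ * ((4 * W * B) ^ L * X)) := by
        filter_upwards [ae_restrict_mem hΩ] with t ht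
        have h1 := hround f t ht
        have h2 := hround f' t ht
        have h3 := hout.norm_sub_le ((Φ f').realize t) ((Φ f).realize t)
        have h4 := norm_sub_le_norm_sub_add_norm_sub ((Φ f').realize t)
          (((Φ f).map r).realize t) ((Φ f).realize t)
        have h6 := norm_sub_rev ((Φ f').realize t) (((Φ f').map r).realize t)
        rw [show ((Φ f).map r) = (Φ f').map r from hff'] at h1 h4
        have h5 : ((2 : ℝ≥0) : ℝ) = 2 := rfl
        rw [h5] at h3
        linarith
      refine (eLpNorm_le_of_ae_bound hb).trans ?_
      rw [mul_comm, ENNReal.ofReal_mul (p := 4 * (δ * ((4 * (W : ℝ) * B) ^ L * X))) (by positivity)]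
      refine mul_le_mul' le_rfl ?_
      simpa using hvol
    have htri : eLpNorm (fun t => ((f' : L2 F Ω) - (f : L2 F Ω) : L2 F Ω) t) 2
        (volume.restrict Ω) ≤
        ENNReal.ofReal e + ENNReal.ofReal (4 * (δ * ((4 * W * B) ^ L * X)) * V₀) +
          ENNReal.ofReal e := by
      have hae : (fun t => ((f' : L2 F Ω) - (f : L2 F Ω) : L2 F Ω) t) =ᵐ[volume.restrict Ω]
          ((fun t => (f' : L2 F Ω) t - out ((Φ f').realize t)) +
            (fun t => out ((Φ f').realize t) - out ((Φ f).realize t))) -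
            (fun t => (f : L2 F Ω) t - out ((Φ f).realize t)) := by
        filter_upwards [Lp.coeFn_sub (f' : L2 F Ω) (f : L2 F Ω)] with t ht
        simp only [ht, Pi.add_apply, Pi.sub_apply]
        abel
      have m1 : ∀ f : C, AEStronglyMeasurable (fun t => (f : L2 F Ω) t - out ((Φ f).realize t))
          (volume.restrict Ω) := fun f => (Lp.aestronglyMeasurable _).sub (hcont f)
      rw [eLpNorm_congr_ae hae]
      refine (eLpNorm_sub_le ((m1 f').add ((hcont f').sub (hcont f))) (m1 f)
        (by norm_num)).trans ?_
      refine add_le_add ((eLpNorm_add_le (m1 f') ((hcont f').sub (hcont f))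
        (by norm_num)).trans (add_le_add (hΦe f') hnet)) (hΦe f)
    rw [← ENNReal.ofReal_add he (by positivity), ← ENNReal.ofReal_add (by positivity) he] at htri
    rw [Lp.norm_def]
    refine (ENNReal.toReal_le_of_le_ofReal (by positivity) htri).trans (le_of_eq ?_)
    ring

end Encoding

/-! ### Network rates are bounded by the optimal exponent -/

section Converse

variable {d : ℕ} {Ω : Set (Fin d → ℝ)} {F : Type*} [NormedAddCommGroup F] {n : ℕ}
  {out : (Fin n → ℝ) → F}

/-- The number of bits for networks of connectivity `M` is `M` up to logarithmic factors. -/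
lemma exists_codeLength_le (n k₀ g : ℕ) {C₀ X : ℝ} (hC₀ : 0 ≤ C₀) (hX : 1 ≤ X) :
    ∃ (C : ℝ) (p : ℕ), ∀ M : ℕ, 3 ≤ M → ∀ (B δ : ℝ) (L W : ℕ), B = (C₀ + 1) * (M : ℝ) ^ k₀ →
      L = ⌊C₀ * Real.logb 2 M ^ k₀⌋₊ → W = M + n →
      δ = ((M : ℝ) ^ g * ((4 * W * B) ^ L * X))⁻¹ →
      ∃ ℓ : ℕ, 1 ≤ ℓ ∧ (ℓ : ℝ) ≤ C * (M * Real.logb 2 M ^ p) ∧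
        ((W * W + W) * (2 * ⌈B / δ⌉₊ + 3)) ^ M * ((W + 2) * (M + 1)) ^ L ≤ 2 ^ ℓ := by
  let J := {M : ℕ // 3 ≤ M}
  let T : J → ℝ := fun j => (j.1 : ℝ)
  have hT3 : ∀ j, 3 ≤ T j := fun j => Nat.ofNat_le_cast.2 j.2
  have hT2 : ∀ j, 2 ≤ T j := fun j => by linarith [hT3 j]
  have hT1 : ∀ j, 1 ≤ T j := fun j => by linarith [hT3 j]
  have hl1 : ∀ j, 1 ≤ Real.logb 2 (T j) := fun j => one_le_logb_two (hT2 j)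
  have pT := PolyBdd.self hT1
  have pW : PolyBdd T (fun j => T j + n) := pT.add hT1 (PolyBdd.const _)
  have pB : PolyBdd T (fun j => (C₀ + 1) * T j ^ k₀) := (PolyBdd.const _).mul (pT.pow k₀)
  have hW1 : ∀ j, 1 ≤ T j + n := fun j => by
    have : (0 : ℝ) ≤ n := Nat.cast_nonneg n
    linarith [hT1 j]
  have hB1 : ∀ j, 1 ≤ (C₀ + 1) * T j ^ k₀ := fun j =>
    one_le_mul_of_one_le_of_one_le (by linarith) (one_le_pow₀ (hT1 j))
  have pP : PolyBdd T (fun j => ((T j + n) * (T j + n) + (T j + n)) *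
      (7 * ((C₀ + 1) * T j ^ k₀) * T j ^ g * X)) :=
    ((pW.mul pW).add hT1 pW).mul ((((PolyBdd.const 7).mul pB).mul (pT.pow g)).mul
      (PolyBdd.const X))
  have hP1 : ∀ j, 1 ≤ ((T j + n) * (T j + n) + (T j + n)) *
      (7 * ((C₀ + 1) * T j ^ k₀) * T j ^ g * X) := fun j => by
    refine one_le_mul_of_one_le_of_one_le ?_ (one_le_mul_of_one_le_of_one_le
      (one_le_mul_of_one_le_of_one_le ?_ (one_le_pow₀ (hT1 j))) hX)
    · nlinarith [hW1 j]
    · linarith [hB1 j]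
  have pQ : PolyBdd T (fun j => 4 * (T j + n) * ((C₀ + 1) * T j ^ k₀)) :=
    ((PolyBdd.const 4).mul pW).mul pB
  have hQ1 : ∀ j, 1 ≤ 4 * (T j + n) * ((C₀ + 1) * T j ^ k₀) := fun j =>
    one_le_mul_of_one_le_of_one_le (by linarith [hW1 j]) (hB1 j)
  have pR : PolyBdd T (fun j => (T j + n + 2) * (T j + 1)) :=
    (pW.add hT1 (PolyBdd.const 2)).mul (pT.add hT1 (PolyBdd.const 1))
  have hR1 : ∀ j, 1 ≤ (T j + n + 2) * (T j + 1) := fun j =>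
    one_le_mul_of_one_le_of_one_le (by linarith [hW1 j]) (by linarith [hT1 j])
  have pL : PolyBdd (fun j => Real.logb 2 (T j))
      (fun j => ((⌊C₀ * Real.logb 2 (T j) ^ k₀⌋₊ : ℕ) : ℝ)) :=
    ((PolyBdd.const C₀).mul ((PolyBdd.self hl1).pow k₀)).of_le (fun j => Nat.cast_nonneg _)
      fun j => Nat.floor_le (mul_nonneg hC₀ (pow_nonneg (by linarith [hl1 j]) _))
  obtain ⟨C, p, hCp⟩ := (((pP.logb hT2 hP1).add hl1 (pL.mul (pQ.logb hT2 hQ1))).add hl1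
    (pL.mul (pR.logb hT2 hR1))).add hl1 (PolyBdd.const 2)
  refine ⟨C, p, fun M hM B δ L W hB hL hW hδ => ?_⟩
  have hj := (le_abs_self _).trans (hCp ⟨M, hM⟩)
  have hP1 := hP1 ⟨M, hM⟩
  have hQ1 := hQ1 ⟨M, hM⟩
  have hR1 := hR1 ⟨M, hM⟩
  have hB1 := hB1 ⟨M, hM⟩
  have hW1 := hW1 ⟨M, hM⟩
  have hW' : (W : ℝ) = (M : ℝ) + n := by rw [hW]; push_cast; rfl
  simp only [T, ← hB, ← hL, ← hW'] at hj hP1 hQ1 hR1 hB1 hW1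
  clear_value T
  have hM1 : (1 : ℝ) ≤ M := by exact_mod_cast (by omega : 1 ≤ M)
  set Q := (4 * (W : ℝ) * B) with hQ
  have hδ1 : B / δ = B * ((M : ℝ) ^ g * (Q ^ L * X)) := by rw [hδ, div_inv_eq_mul]
  have hMg : (1 : ℝ) ≤ (M : ℝ) ^ g := one_le_pow₀ hM1
  have hQL : 1 ≤ Q ^ L := one_le_pow₀ hQ1
  have hBδ : 1 ≤ B / δ := by
    rw [hδ1]
    exact one_le_mul_of_one_le_of_one_le hB1 (one_le_mul_of_one_le_of_one_le hMg
      (one_le_mul_of_one_le_of_one_le hQL hX))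
  set P := ((W : ℝ) * W + W) * (7 * B * (M : ℝ) ^ g * X) with hP
  set R := ((W : ℝ) + 2) * ((M : ℝ) + 1) with hR
  set N := ((W * W + W) * (2 * ⌈B / δ⌉₊ + 3)) ^ M * ((W + 2) * (M + 1)) ^ L with hN
  have hN1 : 0 < N := by
    have : 0 < W := by omega
    positivity
  -- The grid size `B / δ` contains the amplification `Q^L`, whose logarithm `L log Q` is still
  -- polylogarithmic in `M`, because `L` is.
  have hNle : (N : ℝ) ≤ (P * Q ^ L) ^ M * R ^ L := by
    rw [hN]
    push_cast
    have h1 : (2 * (⌈B / δ⌉₊ : ℝ) + 3) ≤ 7 * (B / δ) := by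
      have := Nat.ceil_lt_add_one (by linarith : 0 ≤ B / δ)
      linarith
    have h2 : ((W : ℝ) * W + W) * (2 * (⌈B / δ⌉₊ : ℝ) + 3) ≤ P * Q ^ L := by
      calc ((W : ℝ) * W + W) * (2 * (⌈B / δ⌉₊ : ℝ) + 3) ≤ ((W : ℝ) * W + W) * (7 * (B / δ)) := by
            gcongr
        _ = P * Q ^ L := by rw [hδ1, hP]; ring
    gcongr
  have hlog : Real.logb 2 N ≤ M * (Real.logb 2 P + L * Real.logb 2 Q) + L * Real.logb 2 R := by
    have hN0 : (0 : ℝ) < N := by exact_mod_cast hN1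
    refine (Real.logb_le_logb_of_le (by norm_num) hN0 hNle).trans (le_of_eq ?_)
    rw [Real.logb_mul (by positivity) (by positivity), Real.logb_pow, Real.logb_pow,
      Real.logb_mul (by positivity) (by positivity), Real.logb_pow]
  have hlogR : 0 ≤ L * Real.logb 2 R :=
    mul_nonneg (Nat.cast_nonneg _) (Real.logb_nonneg (by norm_num) hR1)
  refine ⟨⌈Real.logb 2 N⌉₊ + 1, by omega, ?_, ?_⟩
  · have h0 : 0 ≤ Real.logb 2 N := Real.logb_nonneg (by norm_num) (by exact_mod_cast hN1)
    have h1 := Nat.ceil_lt_add_one h0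
    push_cast
    calc (⌈Real.logb 2 N⌉₊ : ℝ) + 1
        ≤ M * (Real.logb 2 P + L * Real.logb 2 Q) + (L * Real.logb 2 R + 2) := by linarith
      _ ≤ M * (Real.logb 2 P + L * Real.logb 2 Q) + M * (L * Real.logb 2 R + 2) := by
          have := le_mul_of_one_le_left (by linarith : 0 ≤ L * Real.logb 2 R + 2) hM1
          linarith
      _ = M * (Real.logb 2 P + L * Real.logb 2 Q + L * Real.logb 2 R + 2) := by ring
      _ ≤ M * (C * Real.logb 2 M ^ p) := by gcongr
      _ = C * (M * Real.logb 2 M ^ p) := by ring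
  · have hN0 : (0 : ℝ) < N := by exact_mod_cast hN1
    have h1 : (N : ℝ) ≤ 2 ^ (⌈Real.logb 2 N⌉₊ + 1 : ℕ) := by
      rw [← Real.rpow_natCast, ← Real.logb_le_iff_le_rpow (by norm_num) hN0]
      push_cast
      linarith [Nat.le_ceil (Real.logb 2 N)]
    exact_mod_cast h1

/-- Network approximation at rate `γ` yields codes. -/
lemma exists_hasCode_of_isBigOPow (hout : LipschitzWith 2 out) (hΩ : MeasurableSet Ω)
    (hb : Bornology.IsBounded Ω) {C : Set (L2 F Ω)} {π : Polynomial ℝ} {γ : ℝ}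
    (h : IsBigOPow (netError out C π) γ) :
    ∃ (C₁ C₂ : ℝ) (p : ℕ), 0 < C₁ ∧ ∀ᶠ M : ℕ in atTop, ∃ ℓ : ℕ, 1 ≤ ℓ ∧
      (ℓ : ℝ) ≤ C₂ * (M * Real.logb 2 M ^ p) ∧ HasCode C (C₁ * (M : ℝ) ^ (-γ)) ℓ := by
  obtain ⟨K, hK⟩ := h
  obtain ⟨C₀, k₀, hC₀, hπ⟩ := exists_abs_eval_le π
  obtain ⟨R, hR⟩ := hb.subset_closedBall 0
  set X := max R 1 with hXdef
  have hX : 1 ≤ X := le_max_right _ _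
  have hΩX : ∀ t ∈ Ω, ‖t‖ ≤ X := fun t ht =>
    (mem_closedBall_zero_iff.1 (hR ht)).trans (le_max_left _ _)
  have hfin : (volume.restrict Ω) univ ^ (1 / 2 : ℝ) ≠ ∞ := by
    rw [Measure.restrict_apply_univ]
    exact ENNReal.rpow_ne_top_of_nonneg (by norm_num) hb.measure_lt_top.ne
  set V₀ := ((volume.restrict Ω) univ ^ (1 / 2 : ℝ)).toReal with hV₀def
  have hV₀ : 0 ≤ V₀ := ENNReal.toReal_nonneg
  obtain ⟨C₂, p, hcode⟩ := exists_codeLength_le n k₀ ⌈γ⌉₊ hC₀ hX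
  refine ⟨2 * (|K| + 1) + 4 * V₀, C₂, p, by positivity, ?_⟩
  filter_upwards [hK, eventually_ge_atTop 3] with M hKM hM3
  have hM3' : (3 : ℝ) ≤ M := by exact_mod_cast hM3
  have hM1 : (1 : ℝ) ≤ M := by linarith
  have hM0 : (0 : ℝ) < M := by linarith
  have hl1 : 1 ≤ Real.logb 2 M := one_le_logb_two (by linarith)
  obtain ⟨ℓ, hℓ1, hℓ, hcount⟩ := hcode M hM3 _ _ _ _ rfl rfl rfl rfl
  refine ⟨ℓ, hℓ1, hℓ, ?_⟩
  set B := (C₀ + 1) * (M : ℝ) ^ k₀ with hBdef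
  set L := ⌊C₀ * Real.logb 2 M ^ k₀⌋₊
  set W := M + n with hWdef
  have hMk : 1 ≤ (M : ℝ) ^ k₀ := one_le_pow₀ hM1
  have hB : 1 ≤ B := one_le_mul_of_one_le_of_one_le (by linarith) hMk
  have hW : 1 ≤ W := by omega
  have hW' : (1 : ℝ) ≤ W := by exact_mod_cast hW
  set Y := (4 * (W : ℝ) * B) ^ L * X with hY
  have hY1 : 1 ≤ Y := one_le_mul_of_one_le_of_one_le (one_le_pow₀
    (one_le_mul_of_one_le_of_one_le (by linarith) hB)) hX
  have hMg : 1 ≤ (M : ℝ) ^ ⌈γ⌉₊ := one_le_pow₀ hM1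
  have hMγ : 0 < (M : ℝ) ^ (-γ) := Real.rpow_pos_of_pos hM0 _
  -- The grid width cancels the amplification `Y` and leaves `M^(-⌈γ⌉)`, which is no larger than the
  -- approximation error.
  have hcode := hasCode_of_nets hout (C := C) (e := (|K| + 1) * (M : ℝ) ^ (-γ))
    (δ := ((M : ℝ) ^ ⌈γ⌉₊ * Y)⁻¹) hB hX hV₀
    (by positivity) (by positivity) (inv_le_one_of_one_le₀ (one_le_mul_of_one_le_of_one_le hMg hY1))
    hΩ hΩX (ENNReal.ofReal_toReal hfin).ge (by omega) (by omega : M ≤ W) hW (L := L)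
    (fun f hf => by
      have hlt : (⨅ Φ ∈ reluNetsBdd π M d n, netDist out f Φ) <
          ENNReal.ofReal ((|K| + 1) * (M : ℝ) ^ (-γ)) := by
        refine lt_of_le_of_lt ((le_iSup₂ (f := fun (f : L2 F Ω) (_ : f ∈ C) =>
          ⨅ Φ ∈ reluNetsBdd π M d n, netDist out f Φ) f hf).trans hKM) ?_
        rw [ENNReal.ofReal_lt_ofReal_iff (by positivity)]
        exact mul_lt_mul_of_pos_right ((le_abs_self K).trans_lt (lt_add_one _)) hMγ
      simp only [iInf_lt_iff] at hlt
      obtain ⟨Φ, ⟨hΦ, hc, hd, hw⟩, hlt⟩ := hlt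
      refine ⟨Φ, hΦ, hc, Nat.le_floor (hd.trans ((le_abs_self _).trans (hπ _ hl1))),
        (hw.trans ((le_abs_self _).trans (hπ _ hM1))).trans ?_, hlt.le⟩
      rw [hBdef]
      gcongr
      linarith) hcount
  refine hcode.mono ?_
  have h1 : ((M : ℝ) ^ ⌈γ⌉₊ * Y)⁻¹ * Y = ((M : ℝ) ^ ⌈γ⌉₊)⁻¹ := by
    field_simp
  have h2 : ((M : ℝ) ^ ⌈γ⌉₊)⁻¹ ≤ (M : ℝ) ^ (-γ) := by
    rw [Real.rpow_neg hM0.le, ← Real.rpow_natCast]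
    gcongr
    exact Nat.le_ceil γ
  rw [← hY, h1]
  have h3 := mul_le_mul_of_nonneg_left h2 (by positivity : 0 ≤ 4 * V₀)
  linarith

/-- Taking `M` of order `ε^(-1/γ)` makes the coding error at most `ε`. The length `M` times a power
of `log M` is eventually below `M^(γ/r)`, since `γ / r > 1`, and this is of order `ε^(-1/r)`. -/
lemma minimaxCodeLength_le_of_isBigOPow (hout : LipschitzWith 2 out) (hΩ : MeasurableSet Ω)
    (hb : Bornology.IsBounded Ω) {C : Set (L2 F Ω)} {π : Polynomial ℝ} {γ r : ℝ} (hr : 0 < r)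
    (hrγ : r < γ) (h : IsBigOPow (netError out C π) γ) :
    ∃ K : ℝ, ∀ᶠ ε : ℝ in 𝓝[>] 0,
      (minimaxCodeLength ε C : ℝ≥0∞) ≤ ENNReal.ofReal (K * ε ^ (-1 / r)) := by
  obtain ⟨C₁, C₂, p, hC₁, hcode⟩ := exists_hasCode_of_isBigOPow hout hΩ hb h
  have hγ : 0 < γ := hr.trans hrγ
  have hs : 1 < γ / r := (one_lt_div hr).2 hrγ
  set s := γ / r with hsdef
  have htend : Tendsto (fun ε : ℝ => ⌈(C₁ / ε) ^ (1 / γ)⌉₊) (𝓝[>] 0) atTop := by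
    have h1 : Tendsto (fun ε : ℝ => C₁ / ε) (𝓝[>] 0) atTop := by
      simp only [div_eq_mul_inv]
      exact tendsto_inv_nhdsGT_zero.const_mul_atTop hC₁
    exact tendsto_nat_ceil_atTop.comp ((tendsto_rpow_atTop (one_div_pos.2 hγ)).comp h1)
  refine ⟨2 ^ s * C₁ ^ (1 / r), ?_⟩
  -- The logarithmic factor is absorbed with exponent `2 - s < 1`; multiplying by `M^(s - 1)`
  -- afterwards gives the bound `M^s`.
  filter_upwards [htend.eventually hcode,
    htend.eventually (eventually_mul_logb_pow_le C₂ (2 - s) p (by linarith)),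
    Ioc_mem_nhdsGT hC₁] with ε h1 h2 hε
  set M := ⌈(C₁ / ε) ^ (1 / γ)⌉₊
  obtain ⟨ℓ, hℓ1, hℓ, hcode⟩ := h1
  have hq : 1 ≤ C₁ / ε := (one_le_div hε.1).2 hε.2
  have hx : 1 ≤ (C₁ / ε) ^ (1 / γ) := Real.one_le_rpow hq (by positivity)
  have hM : (C₁ / ε) ^ (1 / γ) ≤ M := Nat.le_ceil _
  have hM2 : (M : ℝ) ≤ 2 * (C₁ / ε) ^ (1 / γ) := by
    have := Nat.ceil_lt_add_one (by linarith : 0 ≤ (C₁ / ε) ^ (1 / γ))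
    linarith
  have hM0 : (0 : ℝ) < M := by linarith
  have hcodeε : HasCode C ε ℓ := by
    refine hcode.mono ?_
    have h3 : C₁ / ε ≤ (M : ℝ) ^ γ := by
      have := Real.rpow_le_rpow (by linarith) hM hγ.le
      rwa [← Real.rpow_mul (by linarith), one_div_mul_cancel hγ.ne', Real.rpow_one] at this
    rw [Real.rpow_neg hM0.le, ← div_eq_mul_inv, div_le_iff₀ (Real.rpow_pos_of_pos hM0 _)]
    rw [div_le_iff₀ hε.1] at h3
    linarith
  have hℓM : (ℓ : ℝ) ≤ (M : ℝ) ^ s := by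
    calc (ℓ : ℝ) ≤ C₂ * (M * Real.logb 2 M ^ p) := hℓ
      _ = (M : ℝ) ^ (s - 1) * (C₂ * ((M : ℝ) ^ (2 - s) * Real.logb 2 M ^ p)) := by
          have : (M : ℝ) = (M : ℝ) ^ (s - 1) * (M : ℝ) ^ (2 - s) := by
            rw [← Real.rpow_add hM0]
            norm_num
          nth_rewrite 1 [this]
          ring
      _ ≤ (M : ℝ) ^ (s - 1) * M := by gcongr
      _ = (M : ℝ) ^ s := by rw [← Real.rpow_add_one hM0.ne']; norm_num
  have hfinal : (ℓ : ℝ) ≤ 2 ^ s * C₁ ^ (1 / r) * ε ^ (-1 / r) := by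
    calc (ℓ : ℝ) ≤ (2 * (C₁ / ε) ^ (1 / γ)) ^ s :=
          hℓM.trans (Real.rpow_le_rpow hM0.le hM2 (by linarith))
      _ = 2 ^ s * C₁ ^ (1 / r) * ε ^ (-1 / r) := by
          rw [Real.mul_rpow (by norm_num) (by linarith), ← Real.rpow_mul (by linarith),
            show 1 / γ * s = 1 / r by rw [hsdef]; field_simp,
            Real.div_rpow hC₁.le hε.1.le, neg_div, Real.rpow_neg hε.1.le, div_eq_mul_inv, mul_assoc]
  have hmin : minimaxCodeLength ε C ≤ (ℓ : ℕ∞) := iInf₂_le ℓ ⟨hℓ1, hcodeε⟩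
  refine (ENat.toENNReal_le.2 hmin).trans ?_
  rw [ENat.toENNReal_coe, ← ENNReal.ofReal_natCast]
  exact ENNReal.ofReal_le_ofReal hfinal

/-- Every `r` below an achieved network rate is admissible for the optimal exponent, by
quantization. -/
lemma netRate_le_optimalExponent (hout : LipschitzWith 2 out) (hΩ : MeasurableSet Ω)
    (hb : Bornology.IsBounded Ω) (C : Set (L2 F Ω)) : netRate out C ≤ optimalExponent C := by
  refine iSup₂_le fun γ ⟨π, hπ⟩ => ENNReal.le_of_forall_nnreal_lt fun r hr => ?_
  rcases eq_or_ne r 0 with rfl | h0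
  · simp
  · have hr0 : 0 < r := pos_iff_ne_zero.2 h0
    exact le_iSup₂ (f := fun (γ : ℝ≥0) (_ : 0 < γ ∧ ∃ K : ℝ, ∀ᶠ ε : ℝ in 𝓝[>] 0,
      (minimaxCodeLength ε C : ℝ≥0∞) ≤ ENNReal.ofReal (K * ε ^ (-1 / (γ : ℝ)))) => (γ : ℝ≥0∞)) r
      ⟨hr0, minimaxCodeLength_le_of_isBigOPow hout hΩ hb (NNReal.coe_pos.2 hr0)
        (NNReal.coe_lt_coe.2 (ENNReal.coe_lt_coe.1 hr)) hπ⟩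

end Converse

lemma lipschitzWith_realOut : LipschitzWith 2 realOut :=
  LipschitzWith.of_dist_le_mul fun x y => by
    have h := dist_le_pi_dist x y 0
    have h0 := dist_nonneg (x := x) (y := y)
    rw [show ((2 : ℝ≥0) : ℝ) = 2 from rfl]
    exact h.trans (by linarith)

lemma lipschitzWith_complexOut : LipschitzWith 2 complexOut :=
  LipschitzWith.of_dist_le_mul fun x y => by
    have h0 := dist_le_pi_dist x y 0
    have h1 := dist_le_pi_dist x y 1
    rw [Real.dist_eq] at h0 h1
    rw [show ((2 : ℝ≥0) : ℝ) = 2 from rfl, Complex.dist_eq]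
    refine (Complex.norm_le_abs_re_add_abs_im _).trans ?_
    simp only [complexOut, Complex.sub_re, Complex.sub_im]
    linarith

/-! ### Real classes inside the complex space -/

section RealClasses

variable {d : ℕ} {Ω : Set (Fin d → ℝ)}

lemma norm_toComplexL2_le (f : L2 ℝ Ω) : ‖toComplexL2 f‖ ≤ ‖f‖ := by
  have h := ContinuousLinearMap.norm_compLp_le Complex.ofRealCLM f
  rwa [Complex.ofRealCLM_norm, one_mul] at h

/-- A code for the real class is used on preimages, and its decoder is followed by the embedding,
which does not increase norms. -/
lemma HasCode.image_toComplexL2 {C : Set (L2 ℝ Ω)} {ε : ℝ} {ℓ : ℕ} (h : HasCode C ε ℓ) :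
    HasCode (toComplexL2 '' C) ε ℓ := by
  obtain ⟨E, D, h⟩ := h
  choose pre hpre hpre' using fun F : toComplexL2 '' C => F.2
  refine ⟨fun F => E ⟨pre F, hpre F⟩, fun w => toComplexL2 (D w), fun F => ?_⟩
  have h1 := (norm_toComplexL2_le (D (E ⟨pre F, hpre F⟩) - pre F)).trans (h ⟨pre F, hpre F⟩)
  rwa [map_sub, hpre'] at h1

/-- For a real class, optimality for the dictionary refers to the exponent of the image, optimality
for networks to that of the class itself. This direction of the comparison bounds the latter from
above. -/
lemma optimalExponent_le_image_toComplexL2 (C : Set (L2 ℝ Ω)) :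
    optimalExponent C ≤ optimalExponent (toComplexL2 '' C) := by
  refine iSup₂_mono' fun γ ⟨hγ, K, hK⟩ => ⟨γ, ⟨hγ, K, hK.mono fun ε hε => ?_⟩, le_rfl⟩
  refine le_trans (ENat.toENNReal_le.2 ?_) hε
  exact iInf₂_mono' fun ℓ hℓ => ⟨ℓ, ⟨hℓ.1, hℓ.2.image_toComplexL2⟩, le_rfl⟩

end RealClasses

/-! ### The main theorem -/

theorem mainTheorem4 (d : ℕ) (hd : 0 < d) (Ω : Set (Fin d → ℝ)) (hΩ : MeasurableSet Ω)
    (α β : ℝ) (hα : 0 < α) (hβ : 0 < β) (g : (Fin d → ℝ) → ℝ)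
    (hg2 : MemLp g 2 volume) (hgtop : MemLp g ∞ volume)
    (hcase : Bornology.IsBounded Ω ∨
      (Ω = univ ∧ ∃ K : Set (Fin d → ℝ), IsCompact K ∧ ∀ᵐ t, t ∉ K → g t = 0))
    (happrox : ∃ π : MvPolynomial (Fin 2) ℝ, ∀ x : Fin d → ℝ, ∀ ε ∈ Ioo (0 : ℝ) (1 / 2),
      ∃ Φ ∈ reluNets d 1,
        eLpNorm (fun t => g t - realOut (Φ.realize t)) ∞
            (volume.restrict ((fun t => x + t) '' Ω)) ≤ ENNReal.ofReal ε ∧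
        (Φ.connectivity : ℝ) ≤ MvPolynomial.eval ![Real.logb 2 ε⁻¹, Real.logb 2 ‖x‖] π ∧
        (Φ.weightMagnitude : ℝ) ≤ MvPolynomial.eval ![ε⁻¹, ‖x‖] π)
    (φ : ℕ+ → L2 ℂ Ω) (hφ : IsGaborOrdering g α β Ω φ) :
    EffectivelyRepresentable φ ∧
    -- classes of complex-valued functions, networks with outputs in `ℝ² = ℂ`
    (∀ C : Set (L2 ℂ Ω), IsCompact C →
      dictRate C φ ≤ netRate complexOut C ∧
      (Bornology.IsBounded Ω → OptRepByDict C φ → OptRepByNets complexOut C)) ∧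
    -- classes of real-valued functions, networks with outputs in `ℝ`
    (∀ C : Set (L2 ℝ Ω), IsCompact C →
      dictRate (toComplexL2 '' C) φ ≤ netRate realOut C ∧
      (Bornology.IsBounded Ω → OptRepByDict (toComplexL2 '' C) φ → OptRepByNets realOut C)) := by
  have heff := hφ.effectivelyRepresentable hd hΩ hα hβ hg2 hgtop hcase happrox
  refine ⟨heff, fun C _ => ?_, fun C _ => ?_⟩
  · have h := dictRate_le_netRate (combinesNets_complex hd) heff C
    rw [image_id'] at h
    -- The chain is: network rate at most optimal exponent, equal to the dictionary rate, at most
    -- the network rate.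
    exact ⟨h, fun hb ho => le_antisymm
      (netRate_le_optimalExponent lipschitzWith_complexOut hΩ hb C) (ho.ge.trans h)⟩
  · have h := dictRate_le_netRate (combinesNets_real hd) heff C
    exact ⟨h, fun hb ho => le_antisymm
      (netRate_le_optimalExponent lipschitzWith_realOut hΩ hb C)
      ((optimalExponent_le_image_toComplexL2 C).trans (ho.ge.trans h))⟩
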